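/- **Conventions.** $\mathbb N$ contains $0$, and $(\mathfrak g,\mathfrak h)$ always ranges over $\{(\mathfrak f,\mathfrak b),(\mathfrak b,\mathfrak f)\}$. "Dense linear ordering" means nonempty dense linear ordering without endpoints. **Flow configurations.** A *flow configuration* $\Phi$ consists of pairwise disjoint finite sets $\Phi_{\rm open},\Phi_{\rm tan},\Phi_{\rm trans},\Phi_{\rm single}$, maps $a\mapsto a^{\mathfrak b}$, $a\mapsto a^{\mathfrak f}$ from $\Phi_{\rm trans}\cup\Phi_{\rm single}$ to $\Phi_{\rm open}\cup\Phi_{\rm tan}$, maps $\min,\max:\Phi_{\rm open}\cup\Phi_{\rm tan}\cup\Phi_{\rm trans}\to\Phi_{\rm single}\cup\{\infty\}$, and a number $N\in\mathbb N$. A *Dulac flow configuration* is a pair $\Psi=(\Phi,\nu)$ with $\Phi$ a flow configuration and $\nu\in\mathbb N$. Put $\Phi_0=\Phi_{\rm open}\cup\Phi_{\rm tan}\cup\Phi_{\rm trans}$ and $\Phi_1=\Phi_{\rm trans}\cup\{E_C: C\in\Phi_{\rm open}\}$. **Languages.** $\mathcal L(\Phi)$ has: a unary predicate $C$ and a binary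 predicate $<_C$ for $C\in\Phi_0$; a unary predicate $E_C$ for $C\in\Phi_{\rm open}$; a constant $e_C$ for $C\in\Phi_{\rm tan}$; a constant $s$ (which also serves as the name of $\infty$) and a constant $c$ for $c\in\Phi_{\rm single}$; unary function symbols $\mathfrak f,\mathfrak b$; constants $r^{\mathfrak g}_C,s^{\mathfrak g}_C$ for $C\in\Phi_{\rm trans}$. For $C\in\Phi_{\rm tan}$ we write $E_C(x)$ for $x=e_C$; $\le_C$ abbreviates "$<_C$ or $=$". $\mathcal L(\Psi)$ expands $\mathcal L(\Phi)$ by binary predicates $R_C$, $S^{\mathfrak g}_{m,C}$, $B^{\mathfrak g}_{m,C}$ ($m\in\mathbb N$) and constants $\gamma^1_C,\dots,\gamma^\nu_C$, for each $C\in\Phi_1$. **The theory $T(\Phi)$** consists of the universal closures of the following. * (F1) The elements $c\in\Phi_{\rm single}$ are pairwise distinct and different from $s$; they and $s$ lie in no $C\in\Phi_0$; every $x$ is $s$, or some $c\in\Phi_{\rm single}$, or lies in exactly one $C\in\Phi_0$. * (F2) For $C\in\Phi_0$: $<_C$ is a dense linear ordering on $C$; $C(x)\to \min(C)<_Cx<_C\max(C)$;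 and $x<_Cy$ implies $C(x)\wedge C(y)$, or $x=\min(C)\wedge C(y)$, or $C(x)\wedge y=\max(C)$. * (F3) $C(e_C)$ for $C\in\Phi_{\rm tan}$; $E_C(x)\to C(x)$ for $C\in\Phi_{\rm open}$. * (F4) For $C\in\Phi_{\rm open}$, $<_C$ restricted to $E_C$ is a dense linear ordering. * (F5) (a) $\mathfrak g(s)=s$, and $x\ne s\to\mathfrak g(x)\neq x$. (b) For $c\in\Phi_{\rm single}$: $\mathfrak g(c)\ne s\to\mathfrak h(\mathfrak g(c))=c$. (c) $C(\mathfrak g(x))\to E_C(\mathfrak g(x))$ for $C\in\Phi_{\rm open}\cup\Phi_{\rm tan}$. (d) For $C\in\Phi_{\rm tan}$ and $x\in C$: $e_C\le_C x\to\mathfrak f(x)=\mathfrak f(e_C)$ and $x\le_C e_C\to\mathfrak b(x)=\mathfrak b(e_C)$. (e) For $C\in\Phi_{\rm tan}$ and $x\in C$: $x<_Ce_C\to\mathfrak f(x)=e_C$ and $e_C<_Cx\to\mathfrak b(x)=e_C$. * (F6) For $C\in\Phi_{\rm open}$: $E_C(x)\wedge E_C(y)\wedge\mathfrak g(x)=\mathfrak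 g(y)\to(\mathfrak g(x)=s\vee x=y)$. * (F7) For $c\in\Phi_{\rm single}$: $E_{c^{\mathfrak g}}(\mathfrak g(c))$. * (F8) For $C\in\Phi_{\rm trans}$: $\mathfrak g$ maps $C$ order-isomorphically (for $<_C$ and $<_{C^{\mathfrak g}}$) onto a convex subset of $E_{C^{\mathfrak g}}$, and $C(x)\to\mathfrak h(\mathfrak g(x))=x$. * (F9) For $C\in\Phi_{\rm open}$: if $E_C(x)$, then $\mathfrak g(x)=s$, or $D(\mathfrak g(x))$ for some $D\in\Phi_{\rm trans}$ with $D^{\mathfrak h}=C$, or $\mathfrak g(x)=d$ for some $d\in\Phi_{\rm single}$ with $d^{\mathfrak h}=C$. * For $C\in\Phi_{\rm open}$ let $\varphi^{\mathfrak f}_C(x,y)$ be $C(x)\wedge\neg E_C(x)\wedge E_C(y)\wedge x<_Cy\wedge\neg\exists z(E_C(z)\wedge x<_Cz<_Cy)$, and let $\varphi^{\mathfrak b}_C(x,y)$ be $C(x)\wedge\neg E_C(x)\wedge E_C(y)\wedge y<_Cx\wedge\neg\exists z(E_C(z)\wedge y<_Cz<_Cx)$. * (F10) For $C\in\Phi_{\rm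 open}$: $C(x)\wedge\neg E_C(x)\to\exists y(\varphi^{\mathfrak f}_C(x,y)\vee\varphi^{\mathfrak b}_C(x,y))$; $\exists y\,\varphi^{\mathfrak g}_C(x,y)\to\neg\exists y\,\varphi^{\mathfrak h}_C(x,y)$; and, for each $k\in\mathbb N$, $E_C(y)\to$ "there are at least $k$ elements $x$ with $\varphi^{\mathfrak g}_C(x,y)$". * (F11) For $C\in\Phi_{\rm open}$ and every $y\in E_C$: $<_C$ restricted to $\{x:\varphi^{\mathfrak b}_C(x,y)\vee\varphi^{\mathfrak f}_C(x,y)\vee x=y\}$ is a dense linear ordering. * (F12) For $C\in\Phi_{\rm open}$: $\varphi^{\mathfrak g}_C(x,z)\to\mathfrak g(x)=z$ and $\varphi^{\mathfrak h}_C(x,z)\to\mathfrak g(x)=\mathfrak g(z)$. * (F13) For $C\in\Phi_{\rm trans}$ and $D=C^{\mathfrak g}$: each of $r^{\mathfrak g}_C$, $s^{\mathfrak g}_C$ lies in $E_D$ or equals $\min(D)$ or $\max(D)$; $r^{\mathfrak g}_C\le_Ds^{\mathfrak g}_C$ or ($r^{\mathfrak g}_C=\min(D)$ and $s^{\mathfrak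 g}_C=\max(D)$); and $E_D(x)\to\big(C(\mathfrak h(x))\leftrightarrow r^{\mathfrak g}_C<_Dx<_Ds^{\mathfrak g}_C\big)$. * (F14) For $m\ge0$, $n\geq 1$ and $C\in\Phi_1$: $C(x)\wedge C(\mathfrak g^m(x))\wedge\mathfrak g^n(x)=x\to\mathfrak g^m(x)=x$. * (F15) For $m\ge1$: $\mathfrak g^m(x)=x\to\mathfrak g^{N}(x)=x$. **The theory $T(\Psi)$.** For $C\in\Phi_1$ let $\bar C=C\cup\{\min(C),\max(C)\}$, where for $C=E_D$ we put $\min(C)=\min(D)$, $\max(C)=\max(D)$ and let $<_C$ be the restriction of $<_D$ to $\bar C$. For $x,y\in\bar C$ let $(x,y)_C=\{z\in C:x<_Cz<_Cy\}$. Let $\mathrm{fix}_C(x)$ be $C(x)\wedge\mathfrak f^N(x)=x$, and let $\mathrm{fixbd}_C(x)$ be $\mathrm{fix}_C(x)\wedge\forall y\forall z\big(y<_Cx<_Cz\to\exists w\in(y,z)_C\ \neg\mathrm{fix}_C(w)\big)$. For each new predicate $G$ define a formula $G^*(z)$ as follows: $R_C^*(z)$ is $\mathrm{fix}_C(z)$;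 $(S^{\mathfrak g}_{m,C})^*(z)$ is $C(z)\wedge C(\mathfrak g^m(z))\wedge\mathfrak g^m(z)<_Cz$; $(B^{\mathfrak g}_{m,C})^*(z)$ is $C(z)\wedge C(\mathfrak g^m(z))\wedge z<_C\mathfrak g^m(z)$. $T(\Psi)$ consists of $T(\Phi)$ and the universal closures of the following, for all $C\in\Phi_1$, $m\in\mathbb N$, $\mathfrak g$ and $G\in\{R_C,S^{\mathfrak g}_{m,C},B^{\mathfrak g}_{m,C}\}$: * (D1) $G(x,y)\to\bar C(x)\wedge\bar C(y)\wedge\big(x\le_Cy\vee(x=\min(C)\wedge y=\max(C))\big)$. * (D2), (D3) $G(x,y)\leftrightarrow\big(\exists z\in(x,y)_C\ G^*(z)\big)\vee\big(x=y\wedge G^*(x)\big)$. * (D4) If $G(x,y)$, $C(\mathfrak g^m(z))$ for all $z\in(x,y)_C$, and no $z\in(x,y)_C$ satisfies $\mathrm{fixbd}_C$, then $G(z,z)$ for all $z\in(x,y)_C$; here $m=N$ (and $\mathfrak g$ is arbitrary) if $G$ is $R_C$. * (D5)$_\nu$ $\bar C(\gamma^j_C)\wedge\big(C(\gamma^j_C)\to\mathrm{fix}_C(\gamma^j_C)\big)$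 for $1\le j\le\nu$; $\gamma^j_C\le_C\gamma^{j+1}_C\wedge\big(\gamma^j_C=\gamma^{j+1}_C\to\gamma^j_C=\max(C)\big)$ for $1\le j<\nu$. * (D6)$_\nu$ $\big(C(x)\wedge\mathrm{fixbd}_C(x)\big)\leftrightarrow\bigvee_{j=1}^\nu\big(x=\gamma^j_C\wedge C(\gamma^j_C)\big)$. **Theorem.** For every Dulac flow configuration $\Psi$, the theory $T(\Psi)$ admits quantifier elimination in $\mathcal L(\Psi)$: for every $n \in \mathbb N$, every $\mathcal L(\Psi)$-formula $\phi(x_1,\dots,x_n)$ is equivalent modulo $T(\Psi)$ to a quantifier-free $\mathcal L(\Psi)$-formula $\psi(x_1,\dots,x_n)$. -/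

import Mathlib

open FirstOrder FirstOrder.Language

/-- The two directions: `f` (forward progression) and `b` (reverse progression). -/
inductive Dir
  | f
  | b

/-- The opposite direction; a pair `(𝔤, 𝔥) ∈ {(f, b), (b, f)}` is a pair `(g, g.opp)`. -/
def Dir.opp : Dir → Dir
  | .f => .b
  | .b => .f

/-- A flow configuration. The four (pairwise disjoint) finite sets `Φ_open`, `Φ_tan`, `Φ_trans`,
`Φ_single` are four finite types; `adj g a` is `a^g`; `none` stands for `∞`. -/
structure FlowConfiguration where
  Opn : Type
  Tan : Type
  Trans : Type
  Single : Type
  [finOpn : Finite Opn]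
  [finTan : Finite Tan]
  [finTrans : Finite Trans]
  [finSingle : Finite Single]
  adj : Dir → Trans ⊕ Single → Opn ⊕ Tan
  minPt : Opn ⊕ Tan ⊕ Trans → Option Single
  maxPt : Opn ⊕ Tan ⊕ Trans → Option Single
  N : ℕ

attribute [instance] FlowConfiguration.finOpn FlowConfiguration.finTan
  FlowConfiguration.finTrans FlowConfiguration.finSingle

/-- A Dulac flow configuration `Ψ = (Φ, ν)`. -/
structure DulacFlowConfiguration where
  flow : FlowConfiguration
  nu : ℕ

namespace FlowConfiguration

/-- The set `Φ₀ = Φ_open ∪ Φ_tan ∪ Φ_trans`. -/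
abbrev Cell (Φ : FlowConfiguration) : Type := Φ.Opn ⊕ Φ.Tan ⊕ Φ.Trans

/-- The set `Φ₁ = Φ_trans ∪ {E_C : C ∈ Φ_open}`; `Sum.inr C` stands for `E_C`. -/
abbrev Section₁ (Φ : FlowConfiguration) : Type := Φ.Trans ⊕ Φ.Opn

variable {Φ : FlowConfiguration}

abbrev opn (C : Φ.Opn) : Φ.Cell := Sum.inl C
abbrev tan (C : Φ.Tan) : Φ.Cell := Sum.inr (Sum.inl C)
abbrev trans (C : Φ.Trans) : Φ.Cell := Sum.inr (Sum.inr C)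

/-- The inclusion of `Φ_open ∪ Φ_tan` into `Φ₀`. -/
def ofLeafed : Φ.Opn ⊕ Φ.Tan → Φ.Cell
  | .inl C => opn C
  | .inr C => tan C

/-- The cell on which an element of `Φ₁` lives: `D` for `D ∈ Φ_trans`, and `C` for `E_C`. -/
def Section₁.cell : Φ.Section₁ → Φ.Cell
  | .inl D => trans D
  | .inr C => opn C

variable (Φ) in
/-- The constant symbols and the unary function symbols of `L(Φ)`. -/
inductive Func : ℕ → Type
  | s : Func 0
  | single (c : Φ.Single) : Func 0
  | e (C : Φ.Tan) : Func 0
  | lowerEnd (g : Dir) (C : Φ.Trans) : Func 0 -- the constant `r^g_C`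
  | upperEnd (g : Dir) (C : Φ.Trans) : Func 0 -- the constant `s^g_C`
  | prog (g : Dir) : Func 1

variable (Φ) in
/-- The relation symbols of `L(Φ)`. -/
inductive Rel : ℕ → Type
  | cell (C : Φ.Cell) : Rel 1
  | E (C : Φ.Opn) : Rel 1
  | lt (C : Φ.Cell) : Rel 2

variable (Φ) in
/-- The language `L(Φ)`. -/
abbrev language : FirstOrder.Language := ⟨Func Φ, Rel Φ⟩

end FlowConfiguration

namespace DulacFlowConfiguration

/-- The constant symbols `γ^j_C` of `L(Ψ)`; the index `j : Fin ν` stands for `j + 1`. -/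
inductive Func (Ψ : DulacFlowConfiguration) : ℕ → Type
  | gamma (C : Ψ.flow.Section₁) (j : Fin Ψ.nu) : Func Ψ 0

/-- The binary relation symbols `R_C`, `S^g_{m,C}` and `B^g_{m,C}` of `L(Ψ)`. -/
inductive Rel (Ψ : DulacFlowConfiguration) : ℕ → Type
  | R (C : Ψ.flow.Section₁) : Rel Ψ 2
  | S (g : Dir) (m : ℕ) (C : Ψ.flow.Section₁) : Rel Ψ 2
  | B (g : Dir) (m : ℕ) (C : Ψ.flow.Section₁) : Rel Ψ 2

/-- The symbols of `L(Ψ)` that are not in `L(Φ)`. -/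
abbrev newSymbols (Ψ : DulacFlowConfiguration) : FirstOrder.Language := ⟨Func Ψ, Rel Ψ⟩

/-- The language `L(Ψ)`, an expansion of `L(Φ)`. -/
abbrev language (Ψ : DulacFlowConfiguration) : FirstOrder.Language :=
  Ψ.flow.language.sum Ψ.newSymbols

end DulacFlowConfiguration

namespace FlowConfiguration

/-- A language that contains the symbols of `L(Φ)`. It is used for `L(Φ)` and for `L(Ψ)` only, so
that formulas in the symbols of `L(Φ)` need not be written twice. -/
class Expansion (Φ : FlowConfiguration) (L : FirstOrder.Language.{0, 0}) where
  incl : Φ.language →ᴸ L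

instance (Φ : FlowConfiguration) : Expansion Φ Φ.language := ⟨LHom.id _⟩

instance (Ψ : DulacFlowConfiguration) : Expansion Ψ.flow Ψ.language := ⟨LHom.sumInl⟩

/-- Terms and formulas in the variables `&0, …, &(n - 1)`. -/
abbrev Tm (L : FirstOrder.Language.{0, 0}) (n : ℕ) : Type := L.Term (Empty ⊕ Fin n)

abbrev Fm (L : FirstOrder.Language.{0, 0}) (n : ℕ) : Type := L.BoundedFormula Empty n

section Builders

variable {L : FirstOrder.Language.{0, 0}} {n : ℕ}

/-- A term, seen as a term in one more variable. -/
def up (t : Tm L n) : Tm L (n + 1) := t.relabel (Sum.map id Fin.castSucc)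

/-- `∃ z, F z`. -/
def exV (F : Tm L (n + 1) → Fm L (n + 1)) : Fm L n := ∃' (F (&(Fin.last n)))

/-- `∀ z, F z`. -/
def allV (F : Tm L (n + 1) → Fm L (n + 1)) : Fm L n := ∀' (F (&(Fin.last n)))

/-- A block of `k` existential quantifiers. -/
def exN (n : ℕ) : (k : ℕ) → Fm L (n + k) → Fm L n
  | 0, φ => φ
  | k + 1, φ => exN n k (∃' φ)

/-- "`lt` restricted to the set defined by `P` is a (nonempty) dense linear ordering without
endpoints". The formulas `P` and `lt` may have the parameters `&0, …, &(k - 1)`. -/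
def isDLO (k : ℕ) (P : ∀ j, Tm L (k + j) → Fm L (k + j))
    (lt : ∀ j, Tm L (k + j) → Tm L (k + j) → Fm L (k + j)) : Fm L k :=
  let x (j : ℕ) (i : Fin j) : Tm L (k + j) := &(Fin.natAdd k i)
  -- nonempty
  (∃' (P 1 (x 1 0))) ⊓
  -- irreflexive
  (∀' (P 1 (x 1 0) ⟹ ∼(lt 1 (x 1 0) (x 1 0)))) ⊓
  -- transitive
  (∀' ∀' ∀' (P 3 (x 3 0) ⊓ P 3 (x 3 1) ⊓ P 3 (x 3 2) ⊓ lt 3 (x 3 0) (x 3 1) ⊓ lt 3 (x 3 1) (x 3 2) ⟹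
    lt 3 (x 3 0) (x 3 2))) ⊓
  -- linear
  (∀' ∀' (P 2 (x 2 0) ⊓ P 2 (x 2 1) ⟹
    lt 2 (x 2 0) (x 2 1) ⊔ (x 2 0) =' (x 2 1) ⊔ lt 2 (x 2 1) (x 2 0))) ⊓
  -- dense
  (∀' ∀' (P 2 (x 2 0) ⊓ P 2 (x 2 1) ⊓ lt 2 (x 2 0) (x 2 1) ⟹
    ∃' (P 3 (x 3 2) ⊓ lt 3 (x 3 0) (x 3 2) ⊓ lt 3 (x 3 2) (x 3 1)))) ⊓
  -- no endpoints
  (∀' (P 1 (x 1 0) ⟹ ∃' (P 2 (x 2 1) ⊓ lt 2 (x 2 1) (x 2 0)))) ⊓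
  (∀' (P 1 (x 1 0) ⟹ ∃' (P 2 (x 2 1) ⊓ lt 2 (x 2 0) (x 2 1))))

variable {Φ : FlowConfiguration} [Expansion Φ L]

variable (Φ) in
/-- A constant symbol of `L(Φ)`. -/
def const (c : Func Φ 0) : Tm L n :=
  Constants.term ((Expansion.incl (Φ := Φ) (L := L)).onFunction c)

variable (Φ) in
/-- The term `g(t)`. -/
def ap (g : Dir) (t : Tm L n) : Tm L n :=
  ((Expansion.incl (Φ := Φ) (L := L)).onFunction (Func.prog g)).apply₁ t

variable (Φ) in
/-- The term `g^m(t)`. -/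
def iter (g : Dir) (m : ℕ) (t : Tm L n) : Tm L n := (ap Φ g)^[m] t

/-- The formula `C(t)`. -/
def isIn (C : Φ.Cell) (t : Tm L n) : Fm L n :=
  ((Expansion.incl (Φ := Φ) (L := L)).onRelation (Rel.cell C)).boundedFormula₁ t

/-- The formula `t <_C u`. -/
def lt (C : Φ.Cell) (t u : Tm L n) : Fm L n :=
  ((Expansion.incl (Φ := Φ) (L := L)).onRelation (Rel.lt C)).boundedFormula₂ t u

/-- The formula `t ≤_C u`. -/
def le (C : Φ.Cell) (t u : Tm L n) : Fm L n := lt C t u ⊔ t =' u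

/-- The formula `E_C(t)`, where `E_C = {e_C}` for `C ∈ Φ_tan`. -/
def isE (C : Φ.Opn ⊕ Φ.Tan) (t : Tm L n) : Fm L n :=
  match C with
  | .inl C => ((Expansion.incl (Φ := Φ) (L := L)).onRelation (Rel.E C)).boundedFormula₁ t
  | .inr C => t =' const Φ (Func.e C)

/-- The constant that names an element of `Φ_single ∪ {∞}`; the constant `s` names `∞`. -/
def ptTerm : Option Φ.Single → Tm L n
  | some c => const Φ (Func.single c)
  | none => const Φ Func.s

/-- The constants `min(C)` and `max(C)`. -/
def mn (C : Φ.Cell) : Tm L n := ptTerm (Φ.minPt C)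

def mx (C : Φ.Cell) : Tm L n := ptTerm (Φ.maxPt C)

/-- The formula `φ_C^g(x, y)`: `y` is the successor (`g = f`) or the predecessor (`g = b`) of `x`
in `E_C`, where `x ∈ C` is not in `E_C`. -/
def phi (C : Φ.Opn) (g : Dir) (x y : Tm L n) : Fm L n :=
  isIn (opn C) x ⊓ ∼(isE (Sum.inl C) x) ⊓ isE (Sum.inl C) y ⊓
  match g with
  | .f => lt (opn C) x y ⊓
      ∼(exV fun z => isE (Sum.inl C) z ⊓ lt (opn C) (up x) z ⊓ lt (opn C) z (up y))
  | .b => lt (opn C) y x ⊓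
      ∼(exV fun z => isE (Sum.inl C) z ⊓ lt (opn C) (up y) z ⊓ lt (opn C) z (up x))

/-- The formula `C(x)` for `C ∈ Φ₁`. -/
def mem (C : Φ.Section₁) (x : Tm L n) : Fm L n :=
  match C with
  | .inl D => isIn (trans D) x
  | .inr C => isE (Sum.inl C) x

/-- The formula that defines `C̄ = C ∪ {min(C), max(C)}` for `C ∈ Φ₁`. -/
def bar (C : Φ.Section₁) (x : Tm L n) : Fm L n :=
  mem C x ⊔ x =' mn C.cell ⊔ x =' mx C.cell

/-- The relation `x <_C y` for `C ∈ Φ₁`: the restriction of the relation of the cell to `C̄`. -/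
def lt₁ (C : Φ.Section₁) (x y : Tm L n) : Fm L n :=
  lt C.cell x y ⊓ bar C x ⊓ bar C y

/-- "`z` is an element of `C` with `x <_C z <_C y`", for `C ∈ Φ₁`. -/
def between (C : Φ.Section₁) (x z y : Tm L n) : Fm L n :=
  mem C z ⊓ lt₁ C x z ⊓ lt₁ C z y

/-- The formula `fix_C(x)`. -/
def fix (C : Φ.Section₁) (x : Tm L n) : Fm L n :=
  mem C x ⊓ iter Φ .f Φ.N x =' x

/-- The formula `fixbd_C(x)`. -/
def fixbd (C : Φ.Section₁) (x : Tm L n) : Fm L n :=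
  fix C x ⊓ allV fun y => allV fun z =>
    (lt₁ C (up y) (up (up x)) ⊓ lt₁ C (up (up x)) z ⟹
      exV fun w => between C (up (up y)) w (up z) ⊓ ∼(fix C w))

end Builders

/-- The axioms (F1)–(F15) of `T(Φ)`. -/
inductive Axiom₁ (Φ : FlowConfiguration) : Φ.language.Sentence → Prop
  -- (F1): single points are distinct, lie in no cell and differ from `s`; the cells, the single
  -- points and `s` partition the universe
  | F1_single_ne (c d : Φ.Single) (h : c ≠ d) :
      Axiom₁ Φ (∼(const Φ (.single c) =' const Φ (.single d)))
  | F1_single_cell (c : Φ.Single) (C : Φ.Cell) :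
      Axiom₁ Φ (∼(isIn C (const Φ (.single c))))
  | F1_single_s (c : Φ.Single) :
      Axiom₁ Φ (∼(const Φ (.single c) =' const Φ .s))
  | F1_s_cell (C : Φ.Cell) :
      Axiom₁ Φ (∼(isIn C (const Φ .s)))
  | F1_cover :
      Axiom₁ Φ (∀' (&0 =' const Φ .s ⊔
        BoundedFormula.iSup (fun c : Φ.Single => &0 =' const Φ (.single c)) ⊔
        BoundedFormula.iSup (fun C : Φ.Cell => isIn C &0 ⊓
          BoundedFormula.iInf (fun D : {D : Φ.Cell // D ≠ C} => ∼(isIn D.1 &0)))))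
  -- (F2): `C` is the `<_C`-interval between `min(C)` and `max(C)`
  | F2_dlo (C : Φ.Cell) :
      Axiom₁ Φ (isDLO 0 (fun _ => isIn C) (fun _ => lt C))
  | F2_ends (C : Φ.Cell) :
      Axiom₁ Φ (∀' (isIn C &0 ⟹ lt C &0 (mx C) ⊓ lt C (mn C) &0))
  | F2_support (C : Φ.Cell) :
      Axiom₁ Φ (∀' ∀' (lt C &0 &1 ⟹
        isIn C &0 ⊓ isIn C &1 ⊔ &0 =' mn C ⊓ isIn C &1 ⊔ isIn C &0 ⊓ &1 =' mx C))
  -- (F3)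
  | F3_tan (C : Φ.Tan) :
      Axiom₁ Φ (isIn (tan C) (const Φ (.e C)))
  | F3_open (C : Φ.Opn) :
      Axiom₁ Φ (∀' (isE (.inl C) &0 ⟹ isIn (opn C) &0))
  -- (F4)
  | F4 (C : Φ.Opn) :
      Axiom₁ Φ (isDLO 0 (fun _ => isE (.inl C)) (fun _ => lt (opn C)))
  -- (F5)
  | F5_a (g : Dir) :
      Axiom₁ Φ (ap Φ g (const Φ .s) =' const Φ .s ⊓
        ∀' (∼(&0 =' const Φ .s) ⟹ ∼(ap Φ g &0 =' &0)))
  | F5_b (g : Dir) (c : Φ.Single) :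
      Axiom₁ Φ (∼(ap Φ g (const Φ (.single c)) =' const Φ .s) ⟹
        ap Φ g.opp (ap Φ g (const Φ (.single c))) ='
          const Φ (.single c))
  | F5_c (g : Dir) (C : Φ.Opn ⊕ Φ.Tan) :
      Axiom₁ Φ (∀' (isIn (ofLeafed C) (ap Φ g &0) ⟹ isE C (ap Φ g &0)))
  | F5_d_f (C : Φ.Tan) :
      Axiom₁ Φ (∀' (isIn (tan C) &0 ⊓ le (tan C) (const Φ (.e C)) &0 ⟹
        ap Φ .f &0 =' ap Φ .f (const Φ (.e C))))
  | F5_d_b (C : Φ.Tan) :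
      Axiom₁ Φ (∀' (isIn (tan C) &0 ⊓ le (tan C) &0 (const Φ (.e C)) ⟹
        ap Φ .b &0 =' ap Φ .b (const Φ (.e C))))
  | F5_e_f (C : Φ.Tan) :
      Axiom₁ Φ (∀' (isIn (tan C) &0 ⊓ lt (tan C) &0 (const Φ (.e C)) ⟹
        ap Φ .f &0 =' const Φ (.e C)))
  | F5_e_b (C : Φ.Tan) :
      Axiom₁ Φ (∀' (isIn (tan C) &0 ⊓ lt (tan C) (const Φ (.e C)) &0 ⟹
        ap Φ .b &0 =' const Φ (.e C)))
  -- (F6)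
  | F6 (C : Φ.Opn) (g : Dir) :
      Axiom₁ Φ (∀' ∀' (isE (.inl C) &0 ⊓ isE (.inl C) &1 ⊓
          ap Φ g &0 =' ap Φ g &1 ⟹
        ap Φ g &0 =' const Φ .s ⊔ &0 =' &1))
  -- (F7)
  | F7 (c : Φ.Single) (g : Dir) :
      Axiom₁ Φ (isE (Φ.adj g (.inr c)) (ap Φ g (const Φ (.single c))))
  -- (F8): `g` maps `C` order-isomorphically onto an interval of `E_{C^g}`, with inverse `g.opp`
  | F8_image (C : Φ.Trans) (g : Dir) :
      Axiom₁ Φ (∀' (isIn (trans C) &0 ⟹ isE (Φ.adj g (.inl C)) (ap Φ g &0)))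
  | F8_interval (C : Φ.Trans) (g : Dir) :
      Axiom₁ Φ (∀' ∀' ∀' (isIn (trans C) &0 ⊓ isIn (trans C) &1 ⊓ isE (Φ.adj g (.inl C)) &2 ⊓
          lt (ofLeafed (Φ.adj g (.inl C))) (ap Φ g &0) &2 ⊓
          lt (ofLeafed (Φ.adj g (.inl C))) &2 (ap Φ g &1) ⟹
        ∃' (isIn (trans C) &3 ⊓ ap Φ g &3 =' &2)))
  | F8_mono (C : Φ.Trans) (g : Dir) :
      Axiom₁ Φ (∀' ∀' (isIn (trans C) &0 ⊓ isIn (trans C) &1 ⟹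
        (lt (trans C) &0 &1 ⇔
          lt (ofLeafed (Φ.adj g (.inl C))) (ap Φ g &0) (ap Φ g &1))))
  | F8_inverse (C : Φ.Trans) (g : Dir) :
      Axiom₁ Φ (∀' (isIn (trans C) &0 ⟹ ap Φ g.opp (ap Φ g &0) =' &0))
  -- (F9)
  | F9 (C : Φ.Opn) (g : Dir) :
      Axiom₁ Φ (∀' (isE (.inl C) &0 ⟹ ap Φ g &0 =' const Φ .s ⊔
        BoundedFormula.iSup (fun D : {D : Φ.Trans // Φ.adj g.opp (.inl D) = .inl C} =>
          isIn (trans D.1) (ap Φ g &0)) ⊔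
        BoundedFormula.iSup (fun d : {d : Φ.Single // Φ.adj g.opp (.inr d) = .inl C} =>
          ap Φ g &0 =' const Φ (.single d.1))))
  -- (F10): the last one is the scheme "there are infinitely many `x` with `φ_C^g(x, y)`"
  | F10_a (C : Φ.Opn) :
      Axiom₁ Φ (∀' (isIn (opn C) &0 ⊓ ∼(isE (.inl C) &0) ⟹
        ∃' (phi C .f &0 &1 ⊔ phi C .b &0 &1)))
  | F10_bc (C : Φ.Opn) (g : Dir) :
      Axiom₁ Φ (∀' ((∃' phi C g &0 &1) ⟹ ∼(∃' phi C g.opp &0 &1)))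
  | F10_infinite (C : Φ.Opn) (g : Dir) (k : ℕ) :
      Axiom₁ Φ (∀' (isE (.inl C) &0 ⟹ exN 1 k (
        BoundedFormula.iInf (fun i : Fin k => phi C g &(Fin.natAdd 1 i) &(Fin.castAdd k 0)) ⊓
        BoundedFormula.iInf (fun p : {p : Fin k × Fin k // p.1 < p.2} =>
          ∼(&(Fin.natAdd 1 p.1.1) =' &(Fin.natAdd 1 p.1.2))))))
  -- (F11)
  | F11 (C : Φ.Opn) :
      Axiom₁ Φ (∀' (isE (.inl C) &0 ⟹ isDLO 1
        (fun j x => phi C .b x &(Fin.castAdd j 0) ⊔ phi C .f x &(Fin.castAdd j 0) ⊔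
          x =' &(Fin.castAdd j 0))
        (fun _ => lt (opn C))))
  -- (F12)
  | F12_a (C : Φ.Opn) (g : Dir) :
      Axiom₁ Φ (∀' (isIn (opn C) &0 ⊓ ∼(isE (.inl C) &0) ⊓ (∃' phi C g &0 &1) ⟹
        ∀' (phi C g &0 &1 ⟹ ap Φ g &0 =' &1)))
  | F12_b (C : Φ.Opn) (g : Dir) :
      Axiom₁ Φ (∀' (isIn (opn C) &0 ⊓ ∼(isE (.inl C) &0) ⊓ (∃' phi C g.opp &0 &1) ⟹
        ∀' (phi C g.opp &0 &1 ⟹ ap Φ g &0 =' ap Φ g &1)))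
  -- (F13)
  | F13_a (C : Φ.Trans) (g : Dir) :
      Axiom₁ Φ (isE (Φ.adj g (.inl C)) (const Φ (.lowerEnd g C)) ⊔
        const Φ (.lowerEnd g C) =' mn (ofLeafed (Φ.adj g (.inl C))) ⊔
        const Φ (.lowerEnd g C) =' mx (ofLeafed (Φ.adj g (.inl C))))
  | F13_b (C : Φ.Trans) (g : Dir) :
      Axiom₁ Φ (isE (Φ.adj g (.inl C)) (const Φ (.upperEnd g C)) ⊔
        const Φ (.upperEnd g C) =' mn (ofLeafed (Φ.adj g (.inl C))) ⊔
        const Φ (.upperEnd g C) =' mx (ofLeafed (Φ.adj g (.inl C))))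
  | F13_c (C : Φ.Trans) (g : Dir) :
      Axiom₁ Φ (le (ofLeafed (Φ.adj g (.inl C)))
          (const Φ (.lowerEnd g C)) (const Φ (.upperEnd g C)) ⊔
        const Φ (.lowerEnd g C) =' mn (ofLeafed (Φ.adj g (.inl C))) ⊓
          const Φ (.upperEnd g C) =' mx (ofLeafed (Φ.adj g (.inl C))))
  | F13_d (C : Φ.Trans) (g : Dir) :
      Axiom₁ Φ (∀' (isE (Φ.adj g (.inl C)) &0 ⟹ (isIn (trans C) (ap Φ g.opp &0) ⇔
        lt (ofLeafed (Φ.adj g (.inl C))) (const Φ (.lowerEnd g C)) &0 ⊓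
          lt (ofLeafed (Φ.adj g (.inl C))) &0 (const Φ (.upperEnd g C)))))
  -- (F14)
  | F14_a (C : Φ.Opn) (g : Dir) (m n : ℕ) (hn : 1 ≤ n) :
      Axiom₁ Φ (∀' (isE (.inl C) &0 ⊓ isE (.inl C) (iter Φ g m &0) ⊓
        iter Φ g n &0 =' &0 ⟹ iter Φ g m &0 =' &0))
  | F14_b (D : Φ.Trans) (g : Dir) (m n : ℕ) (hn : 1 ≤ n) :
      Axiom₁ Φ (∀' (isIn (trans D) &0 ⊓ isIn (trans D) (iter Φ g m &0) ⊓
        iter Φ g n &0 =' &0 ⟹ iter Φ g m &0 =' &0))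
  -- (F15)
  | F15 (g : Dir) (m : ℕ) (hm : 1 ≤ m) :
      Axiom₁ Φ (∀' (iter Φ g m &0 =' &0 ⟹ iter Φ g Φ.N &0 =' &0))

/-- The theory `T(Φ)`. -/
def theory (Φ : FlowConfiguration) : Φ.language.Theory := {σ | Axiom₁ Φ σ}

end FlowConfiguration

namespace DulacFlowConfiguration

open FlowConfiguration (Tm Fm)

variable (Ψ : DulacFlowConfiguration) {n : ℕ}

/-- The constant `γ^j_C`. -/
def gamma (C : Ψ.flow.Section₁) (j : Fin Ψ.nu) : Tm Ψ.language n :=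
  Constants.term ((LHom.sumInr : Ψ.newSymbols →ᴸ Ψ.language).onFunction (Func.gamma C j))

/-- The formula `G(x, y)` for one of the new predicates `G`. -/
def rel (G : Rel Ψ 2) (x y : Tm Ψ.language n) : Fm Ψ.language n :=
  ((LHom.sumInr : Ψ.newSymbols →ᴸ Ψ.language).onRelation G).boundedFormula₂ x y

/-- The element of `Φ₁` to which a new predicate belongs. -/
def Rel.sec {Ψ : DulacFlowConfiguration} : Rel Ψ 2 → Ψ.flow.Section₁
  | .R C => C
  | .S _ _ C => C
  | .B _ _ C => C

/-- The formula that defines a new predicate `G` at a point `z ∈ C`: `fix_C(z)` for `R_C`,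
`g^m(z) ∈ C` and `g^m(z) <_C z` for `S^g_{m,C}`, `g^m(z) ∈ C` and `z <_C g^m(z)` for `B^g_{m,C}`. -/
def atPt (G : Rel Ψ 2) (z : Tm Ψ.language n) : Fm Ψ.language n :=
  match G with
  | .R C => FlowConfiguration.fix C z
  | .S g m C => FlowConfiguration.mem C z ⊓
      FlowConfiguration.mem C (FlowConfiguration.iter Ψ.flow g m z) ⊓
      FlowConfiguration.lt₁ C (FlowConfiguration.iter Ψ.flow g m z) z
  | .B g m C => FlowConfiguration.mem C z ⊓
      FlowConfiguration.mem C (FlowConfiguration.iter Ψ.flow g m z) ⊓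
      FlowConfiguration.lt₁ C z (FlowConfiguration.iter Ψ.flow g m z)

/-- (D4) for the predicate `G` and the map `g^m`. -/
def coherence (G : Rel Ψ 2) (g : Dir) (m : ℕ) : Ψ.language.Sentence :=
  ∀' ∀' (Ψ.rel G &0 &1 ⊓
      (∀' (FlowConfiguration.between G.sec &0 &2 &1 ⟹
        FlowConfiguration.mem G.sec (FlowConfiguration.iter Ψ.flow g m &2))) ⊓
      ∼(∃' (FlowConfiguration.between G.sec &0 &2 &1 ⊓ FlowConfiguration.fixbd G.sec &2)) ⟹
    ∀' (FlowConfiguration.between G.sec &0 &2 &1 ⟹ Ψ.rel G &2 &2))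

/-- The axioms (D1)–(D4), (D5)_ν and (D6)_ν. -/
inductive Axiom₂ : Ψ.language.Sentence → Prop
  -- (D1)
  | D1_a (G : Rel Ψ 2) :
      Axiom₂ (∀' ∀' (Ψ.rel G &0 &1 ⟹
        FlowConfiguration.bar G.sec &0 ⊓ FlowConfiguration.bar G.sec &1))
  | D1_b (G : Rel Ψ 2) :
      Axiom₂ (∀' ∀' (Ψ.rel G &0 &1 ⟹ FlowConfiguration.le G.sec.cell &0 &1 ⊔
        (&0 =' FlowConfiguration.mn G.sec.cell ⊓ &1 =' FlowConfiguration.mx G.sec.cell)))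
  -- (D2) and (D3): `G(x, y)` holds if and only if there is a point `z ∈ C` between `x` and `y` with
  -- the property defining `G`, or `x = y ∈ C` has this property
  | D23 (G : Rel Ψ 2) :
      Axiom₂ (∀' ∀' (Ψ.rel G &0 &1 ⇔
        (∃' (FlowConfiguration.between G.sec &0 &2 &1 ⊓ Ψ.atPt G &2)) ⊔ &0 =' &1 ⊓ Ψ.atPt G &0))
  -- (D4)
  | D4_R (C : Ψ.flow.Section₁) (g : Dir) : Axiom₂ (Ψ.coherence (.R C) g Ψ.flow.N)
  | D4_S (C : Ψ.flow.Section₁) (g : Dir) (m : ℕ) : Axiom₂ (Ψ.coherence (.S g m C) g m)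
  | D4_B (C : Ψ.flow.Section₁) (g : Dir) (m : ℕ) : Axiom₂ (Ψ.coherence (.B g m C) g m)
  -- (D5)
  | D5_a (C : Ψ.flow.Section₁) (j : Fin Ψ.nu) :
      Axiom₂ (FlowConfiguration.bar C (Ψ.gamma C j) ⊓
        (FlowConfiguration.mem C (Ψ.gamma C j) ⟹ FlowConfiguration.fix C (Ψ.gamma C j)))
  | D5_b (C : Ψ.flow.Section₁) (j k : Fin Ψ.nu) (h : k.val = j.val + 1) :
      Axiom₂ (FlowConfiguration.le C.cell (Ψ.gamma C j) (Ψ.gamma C k) ⊓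
        (Ψ.gamma C j =' Ψ.gamma C k ⟹ Ψ.gamma C j =' FlowConfiguration.mx C.cell))
  -- (D6)
  | D6 (C : Ψ.flow.Section₁) :
      Axiom₂ (∀' (FlowConfiguration.mem C &0 ⊓ FlowConfiguration.fixbd C &0 ⇔
        BoundedFormula.iSup (fun j : Fin Ψ.nu =>
          &0 =' Ψ.gamma C j ⊓ FlowConfiguration.mem C (Ψ.gamma C j))))

/-- The theory `T(Ψ)`: the axioms of `T(Φ)` together with (D1)–(D4), (D5)_ν and (D6)_ν. -/
def theory : Ψ.language.Theory :=
  (LHom.sumInl : Ψ.flow.language →ᴸ Ψ.language).onTheory Ψ.flow.theory ∪ {σ | Ψ.Axiom₂ σ}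

end DulacFlowConfiguration

/-- A theory admits quantifier elimination if every formula is equivalent, modulo the theory, to a
quantifier-free formula with the same free variables. -/
def FirstOrder.Language.Theory.HasQuantifierElimination {L : FirstOrder.Language.{0, 0}} (T : L.Theory) :
    Prop :=
  ∀ (n : ℕ) (φ : L.Formula (Fin n)), ∃ ψ : L.Formula (Fin n), ψ.IsQF ∧ T.Iff φ ψ

/-!
By compactness, quantifier elimination follows once, in any two models `M` and `N`, a
quantifier-free condition `θ(v, x)` that has a solution `a` in `M` also has a solution over every
tuple `w` of `N` with the same atomic formulas as `v`
(`Theory.hasQuantifierElimination_of_sameAtoms`). The values of terms at `v` and `w` form the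
graph `A` of an isomorphism between the generated substructures (`PartIso`). No saturated models are
needed: as `θ` is a single formula, it suffices to find a proper filter on `N` near which, for each
atomic formula, all points satisfy it over `w` if and only if `a` satisfies it over `v` (`HasTracking`, `HasTracking.exists_realize`).

The main case is that of a point `a` of a transverse cell or of some `E_C` that is not the value of
a term. The filter is generated by the intervals of `N` that correspond to the intervals around `a`
with end points in the domain of `A` (`cutFilter`). A progression map sends `a` to `s` or to another
such point; in the second case it maps the filter of `a` to the filter of the image, and the
opposite map inverts it (`PartIso.prog_gen`). The constants `r^g_D` and `s^g_D` decide which case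
holds. So the substructure generated by `a` over the domain of `A` consists of that domain and of
the orbit of `a` under `f` and its inverse.

Two points of the orbit in the same section are an image `g^m(z)` and its argument `z`, so that
their order is expressed by the properties of `z` that define the predicates `B` and `S`. Each
property that defines a new predicate is constant on an interval around `a` with end points in the
domain of `A`, and it has the same truth value on the corresponding interval of `N`
(`PartIso.exists_interval_atPt`). Indeed, the boundary points of the set of fixed points are
constants `γ`, so that they can be avoided; then the coherence axioms say that the property holds at
every point of the interval as soon as it holds at one, and whether it holds at one is an atomic
formula about the end points. Thus all atomic formulas are transferred
(`PartIso.isTracking_orbitTracks`).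

A point of a tangential cell other than `e_C` generates no further new points, and its cut decides
its atomic formulas (`PartIso.hasTracking_of_tan`). For a point `a` of an open cell `C` outside
`E_C` the same is true if its neighbour `y` in `E_C` is the value of a term
(`PartIso.hasTracking_of_phi`). In general, this case shows that the condition "some `x` with
neighbour `y` satisfies `θ`" on `y` is equivalent to a quantifier-free one
(`exists_isQF_iff_exists_phi`), and the main case applies to `y`.
-/

/-! ### A semantic criterion for quantifier elimination -/

namespace FirstOrder.Language

variable {L : FirstOrder.Language.{0, 0}}

/-- Two tuples, possibly in different structures, satisfy the same atomic formulas. -/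
structure SameAtoms {β : Type*} {M N : Type*} [L.Structure M] [L.Structure N]
    (v : β → M) (w : β → N) : Prop where
  eq : ∀ t t' : L.Term β, t.realize v = t'.realize v ↔ t.realize w = t'.realize w
  rel : ∀ {k : ℕ} (R : L.Relations k) (ts : Fin k → L.Term β),
    Structure.RelMap R (fun i => (ts i).realize v) ↔
      Structure.RelMap R (fun i => (ts i).realize w)

/-- If every tuple with the same quantifier-free formulas as a realization of `χ` realizes `χ`,
then `χ` is equivalent to a quantifier-free formula. The set of complete types containing `χ` is
clopen in the compact space of types, and it is saturated for the topology generated by the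
quantifier-free formulas. -/
theorem Theory.exists_isQF_iff {T : L.Theory} {β : Type} (χ : L.Formula β)
    (h : ∀ (M N : Type) [L.Structure M] [L.Structure N] [Nonempty M] [Nonempty N] [M ⊨ T] [N ⊨ T]
      (v : β → M) (w : β → N),
      (∀ ψ : L.Formula β, ψ.IsQF → ψ.Realize v → ψ.Realize w) → χ.Realize v → χ.Realize w) :
    ∃ ψ : L.Formula β, ψ.IsQF ∧ T.Iff χ ψ := by
  classical
  let U : L.Formula β → Set (T.CompleteType β) := fun ψ => T.typesWith (Formula.equivSentence ψ)
  have hU : ∀ (M : Type) [L.Structure M] [Nonempty M] [M ⊨ T] (v : β → M) (ψ : L.Formula β),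
      T.typeOf v ∈ U ψ ↔ ψ.Realize v := fun M _ _ _ v ψ => CompleteType.formula_mem_typeOf
  have hreal : ∀ p : T.CompleteType β, ∃ (M : Type) (_ : L.Structure M) (_ : Nonempty M)
      (_ : M ⊨ T) (v : β → M), T.typeOf v = p := by
    intro p
    obtain ⟨M, v, hv⟩ := Theory.exists_modelType_is_realized_in T p
    exact ⟨M, inferInstance, inferInstance, inferInstance, v, hv⟩
  have hopen : ∀ ψ, IsClopen (U ψ) := fun ψ => CompleteType.isClopen_typesWith _
  have hbot : U ⊥ = ∅ := by
    ext p
    obtain ⟨M, _, _, _, v, rfl⟩ := hreal p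
    simp [hU]
  have hsup : ∀ φ ψ, U (φ ⊔ ψ) = U φ ∪ U ψ := by
    intro φ ψ
    ext p
    obtain ⟨M, _, _, _, v, rfl⟩ := hreal p
    simp [hU]
  have hnot : ∀ ψ, U ψ.not = (U ψ)ᶜ := by
    intro ψ
    ext p
    obtain ⟨M, _, _, _, v, rfl⟩ := hreal p
    simp [hU]
  -- a type with `χ` is separated from all types without `χ` by one quantifier-free formula
  have h1 : ∀ p ∈ U χ, ∃ ψ : L.Formula β, ψ.IsQF ∧ p ∈ U ψ ∧ U ψ ⊆ U χ := by
    intro p hp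
    have hc : IsCompact (U χ)ᶜ := (hopen χ).isOpen.isClosed_compl.isCompact
    have : ∃ ψ : L.Formula β, ψ.IsQF ∧ p ∉ U ψ ∧ (U χ)ᶜ ⊆ U ψ := by
      refine hc.induction_on (p := fun S => ∃ ψ : L.Formula β, ψ.IsQF ∧ p ∉ U ψ ∧ S ⊆ U ψ)
        ⟨⊥, BoundedFormula.isQF_bot, by simp [hbot], by simp⟩ ?_ ?_ ?_
      · rintro s t hst ⟨ψ, h1, h2, h3⟩
        exact ⟨ψ, h1, h2, hst.trans h3⟩
      · rintro s t ⟨ψ, h1, h2, h3⟩ ⟨ψ', h1', h2', h3'⟩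
        refine ⟨ψ ⊔ ψ', h1.sup h1', ?_, ?_⟩
        · rw [hsup]; rintro (h | h) <;> contradiction
        · rw [hsup]; exact Set.union_subset_union h3 h3'
      · intro q hq
        obtain ⟨M, _, _, _, v, rfl⟩ := hreal p
        obtain ⟨N, _, _, _, w, rfl⟩ := hreal q
        rw [Set.mem_compl_iff, hU] at hq
        rw [hU] at hp
        have : ∃ ψ : L.Formula β, ψ.IsQF ∧ ψ.Realize v ∧ ¬ ψ.Realize w := by
          by_contra hcon
          push Not at hcon
          exact hq (h M N v w hcon hp)
        obtain ⟨ψ, h1, h2, h3⟩ := this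
        refine ⟨U ψ.not, mem_nhdsWithin_of_mem_nhds ((hopen _).isOpen.mem_nhds ?_),
          ψ.not, h1.not, ?_, subset_rfl⟩
        · rw [hU]; simpa using h3
        · rw [hU]; simpa using h2
    obtain ⟨ψ, h1, h2, h3⟩ := this
    refine ⟨ψ.not, h1.not, by rw [hnot]; exact h2, ?_⟩
    rw [hnot]
    exact Set.compl_subset_comm.1 h3
  have h2 : ∃ ψ : L.Formula β, ψ.IsQF ∧ U χ ⊆ U ψ ∧ U ψ ⊆ U χ := by
    refine ((hopen χ).isClosed.isCompact).induction_on
      (p := fun S => ∃ ψ : L.Formula β, ψ.IsQF ∧ S ⊆ U ψ ∧ U ψ ⊆ U χ)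
      ⟨⊥, BoundedFormula.isQF_bot, by simp, by simp [hbot]⟩ ?_ ?_ ?_
    · rintro s t hst ⟨ψ, h1, h2, h3⟩
      exact ⟨ψ, h1, hst.trans h2, h3⟩
    · rintro s t ⟨ψ, h1, h2, h3⟩ ⟨ψ', h1', h2', h3'⟩
      refine ⟨ψ ⊔ ψ', h1.sup h1', ?_, ?_⟩
      · rw [hsup]; exact Set.union_subset_union h2 h2'
      · rw [hsup]; exact Set.union_subset h3 h3'
    · intro p hp
      obtain ⟨ψ, h1, h2, h3⟩ := h1 p hp
      exact ⟨U ψ, mem_nhdsWithin_of_mem_nhds ((hopen _).isOpen.mem_nhds h2), ψ, h1,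
        subset_rfl, h3⟩
  obtain ⟨ψ, hψ, h3, h4⟩ := h2
  refine ⟨ψ, hψ, ?_⟩
  intro M v xs
  have e : xs = default := Subsingleton.elim _ _
  rw [BoundedFormula.realize_iff]
  have := hU M v
  rw [e]
  exact (hU M v χ).symm.trans (_root_.Iff.trans ⟨fun h => h3 h, fun h => h4 h⟩ (hU M v ψ))

theorem BoundedFormula.IsQF.realize_iff_of_sameAtoms {β M N : Type*} [L.Structure M]
    [L.Structure N] {k : ℕ} {v : β → M} {w : β → N} {xs : Fin k → M} {ys : Fin k → N}
    {φ : L.BoundedFormula β k} (hφ : φ.IsQF)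
    (h : SameAtoms (L := L) (Sum.elim v xs) (Sum.elim w ys)) :
    φ.Realize v xs ↔ φ.Realize w ys := by
  induction hφ with
  | falsum => exact Iff.rfl
  | of_isAtomic h' =>
    cases h' with
    | equal t t' => simpa using h.eq t t'
    | rel R ts => simpa [realize_rel] using h.rel R ts
  | imp _ _ h1 h2 => simp [h1, h2]

theorem SameAtoms.comp {β β' M N : Type*} [L.Structure M] [L.Structure N] {v : β → M} {w : β → N}
    (h : SameAtoms (L := L) v w) (g : β' → β) : SameAtoms (L := L) (v ∘ g) (w ∘ g) :=
  ⟨fun t t' => by simpa using h.eq (t.relabel g) (t'.relabel g),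
   fun R ts => by simpa using h.rel R (fun i => (ts i).relabel g)⟩

theorem SameAtoms.of_isQF {β M N : Type*} [L.Structure M] [L.Structure N] {v : β → M} {w : β → N}
    (h : ∀ ψ : L.Formula β, ψ.IsQF → ψ.Realize v → ψ.Realize w) : SameAtoms (L := L) v w := by
  have h' : ∀ ψ : L.Formula β, ψ.IsQF → (ψ.Realize v ↔ ψ.Realize w) := fun ψ hψ =>
    ⟨h ψ hψ, fun h1 => by
      by_contra h2
      exact h ψ.not hψ.not h2 h1⟩
  refine ⟨fun t t' => ?_, fun R ts => ?_⟩
  · simpa using h' (t.equal t') (BoundedFormula.IsAtomic.equal _ _).isQF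
  · simpa using h' (R.formula ts) (BoundedFormula.IsAtomic.rel _ _).isQF

theorem Formula.IsQF.realize_iff_of_sameAtoms {β M N : Type*} [L.Structure M]
    [L.Structure N] {v : β → M} {w : β → N} {φ : L.Formula β} (hφ : φ.IsQF)
    (h : SameAtoms (L := L) v w) : φ.Realize v ↔ φ.Realize w :=
  BoundedFormula.IsQF.realize_iff_of_sameAtoms hφ <| by
    have := h.comp (Sum.elim id Fin.elim0 : β ⊕ Fin 0 → β)
    convert this using 1 <;> · ext (x | x) <;> [rfl; exact x.elim0]

theorem Theory.exists_isQF_iff_of_sameAtoms {T : L.Theory} {β : Type} (χ : L.Formula β)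
    (h : ∀ (M N : Type) [L.Structure M] [L.Structure N] [Nonempty M] [Nonempty N] [M ⊨ T] [N ⊨ T]
      (v : β → M) (w : β → N), SameAtoms (L := L) v w → χ.Realize v → χ.Realize w) :
    ∃ ψ : L.Formula β, ψ.IsQF ∧ T.Iff χ ψ :=
  T.exists_isQF_iff χ fun M N _ _ _ _ _ _ v w hvw => h M N v w (.of_isQF hvw)

/-- A theory eliminates quantifiers if, in its models, the truth of `∃ x, θ(x, y)` for a
quantifier-free formula `θ` depends only on the atomic formulas true at `y`. -/
theorem Theory.hasQuantifierElimination_of_sameAtoms {T : L.Theory}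
    (h : ∀ (β : Type) (θ : L.Formula (β ⊕ Unit)), θ.IsQF →
      ∀ (M N : Type) [L.Structure M] [L.Structure N] [Nonempty M] [Nonempty N] [M ⊨ T] [N ⊨ T]
      (v : β → M) (w : β → N), SameAtoms (L := L) v w →
      (∃ a : M, θ.Realize (Sum.elim v fun _ => a)) →
      ∃ b : N, θ.Realize (Sum.elim w fun _ => b)) : T.HasQuantifierElimination := by
  suffices H : ∀ (α : Type) (k : ℕ) (φ : L.BoundedFormula α k),
      ∃ ψ : L.Formula (α ⊕ Fin k), ψ.IsQF ∧ ∀ (M : Type) [L.Structure M] [Nonempty M] [M ⊨ T]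
        (v : α → M) (xs : Fin k → M), φ.Realize v xs ↔ ψ.Realize (Sum.elim v xs) by
    intro n φ
    obtain ⟨ψ, hψ, hi⟩ := H (Fin n) 0 φ
    refine ⟨BoundedFormula.relabel (n := 0) (id : Fin n ⊕ Fin 0 → Fin n ⊕ Fin 0) ψ,
      hψ.relabel _, ?_⟩
    intro M v xs
    rw [BoundedFormula.realize_iff]
    refine (hi M v xs).trans ?_
    refine _root_.Iff.trans ?_ (BoundedFormula.realize_relabel (m := 0) (n := 0)).symm
    have e : (xs ∘ Fin.castAdd 0) = xs := Subsingleton.elim _ _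
    rw [e, Function.comp_id, Formula.Realize]
    have e' : (default : Fin 0 → M) = xs ∘ Fin.natAdd 0 := Subsingleton.elim _ _
    rw [e']
  intro α k φ
  induction φ with
  | falsum =>
    exact ⟨⊥, BoundedFormula.isQF_bot,
      fun M _ _ _ v xs => by simp [BoundedFormula.Realize]⟩
  | equal t t' =>
    exact ⟨t.equal t', (BoundedFormula.IsAtomic.equal _ _).isQF,
      fun M _ _ _ v xs => by simp [BoundedFormula.Realize]⟩
  | rel R ts =>
    exact ⟨R.formula ts, (BoundedFormula.IsAtomic.rel _ _).isQF,
      fun M _ _ _ v xs => by simp [BoundedFormula.Realize]⟩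
  | imp φ₁ φ₂ ih₁ ih₂ =>
    obtain ⟨ψ₁, h₁, i₁⟩ := ih₁
    obtain ⟨ψ₂, h₂, i₂⟩ := ih₂
    exact ⟨ψ₁.imp ψ₂, h₁.imp h₂, fun M _ _ _ v xs => by simp [i₁, i₂]⟩
  | @all k φ ih =>
    obtain ⟨ψ, hψ, hi⟩ := ih
    let ρ : α ⊕ Fin (k + 1) → (α ⊕ Fin k) ⊕ Unit :=
      Sum.elim (fun a => .inl (.inl a)) (Fin.snoc (fun i => .inl (.inr i)) (.inr ()) :
        Fin (k + 1) → (α ⊕ Fin k) ⊕ Unit)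
    have hρ : ∀ (M : Type) (v : α → M) (xs : Fin k → M) (a : M),
        Sum.elim (Sum.elim v xs) (fun _ => a) ∘ ρ =
          Sum.elim v (Fin.snoc xs a : Fin (k + 1) → M) := by
      intro M v xs a
      funext i
      rcases i with i | i
      · rfl
      · refine Fin.lastCases ?_ (fun i => ?_) i <;> simp [ρ]
    let θ : L.Formula ((α ⊕ Fin k) ⊕ Unit) := ψ.not.relabel ρ
    have hθ : ∀ (M : Type) [L.Structure M] (v : α → M) (xs : Fin k → M) (a : M),
        θ.Realize (Sum.elim (Sum.elim v xs) fun _ => a) ↔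
          ¬ ψ.Realize (Sum.elim v (Fin.snoc xs a : Fin (k + 1) → M)) := by
      intro M _ v xs a
      rw [Formula.realize_relabel, hρ]
      exact Formula.realize_not
    have hq : θ.IsQF := hψ.not.relabel _
    obtain ⟨χ, hχ, hi'⟩ := T.exists_isQF_iff_of_sameAtoms (θ.iExs Unit) <| by
      intro M N _ _ _ _ _ _ v w hvw hv
      rw [Formula.realize_iExs] at hv ⊢
      obtain ⟨i, hi⟩ := hv
      obtain ⟨b, hb⟩ := h _ θ hq M N v w hvw ⟨i (), hi⟩
      exact ⟨fun _ => b, hb⟩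
    refine ⟨χ.not, hχ.not, fun M _ _ _ v xs => ?_⟩
    rw [Formula.realize_not, ← hi'.realize_iff, Formula.realize_iExs, BoundedFormula.realize_all]
    simp only [hi]
    constructor
    · rintro h1 ⟨i, h2⟩
      exact (hθ M v xs (i ())).1 h2 (h1 _)
    · intro h1 a
      by_contra h2
      exact h1 ⟨fun _ => a, (hθ M v xs a).2 h2⟩

end FirstOrder.Language

/-! ### Models of the theories as structures with operations -/

/-- `lt` restricted to `P` is a nonempty dense linear ordering without endpoints. -/
structure IsDLOOn {M : Type*} (P : M → Prop) (lt : M → M → Prop) : Prop where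
  nonempty : ∃ x, P x
  irrefl : ∀ x, P x → ¬ lt x x
  trans : ∀ x y z, P x → P y → P z → lt x y → lt y z → lt x z
  linear : ∀ x y, P x → P y → lt x y ∨ x = y ∨ lt y x
  dense : ∀ x y, P x → P y → lt x y → ∃ z, P z ∧ lt x z ∧ lt z y
  no_min : ∀ x, P x → ∃ y, P y ∧ lt y x
  no_max : ∀ x, P x → ∃ y, P y ∧ lt x y

namespace FlowConfiguration

/-- Interpretations of the symbols of `L(Φ)` on a type `M`. -/
structure FlowOps (Φ : FlowConfiguration) (M : Type) where
  cell : Φ.Cell → M → Prop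
  E : Φ.Opn → M → Prop
  lt : Φ.Cell → M → M → Prop
  prog : Dir → M → M
  s : M
  single : Φ.Single → M
  e : Φ.Tan → M
  lo : Dir → Φ.Trans → M
  hi : Dir → Φ.Trans → M

namespace FlowOps

variable {Φ : FlowConfiguration} {M : Type} (K : FlowOps Φ M)

/-- The element named by an element of `Φ_single ∪ {∞}`. -/
def pt : Option Φ.Single → M
  | some c => K.single c
  | none => K.s

/-- The element `min(C)`. -/
def mn (C : Φ.Cell) : M := K.pt (Φ.minPt C)

/-- The element `max(C)`. -/
def mx (C : Φ.Cell) : M := K.pt (Φ.maxPt C)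

/-- Membership in `E_C`, where `E_C = {e_C}` for `C ∈ Φ_tan`. -/
def leafE : Φ.Opn ⊕ Φ.Tan → M → Prop
  | .inl C, x => K.E C x
  | .inr C, x => x = K.e C

/-- `y ∈ E_C` is the successor (`g = f`) or predecessor (`g = b`) in `E_C` of `x ∈ C ∖ E_C`. -/
def phi (C : Φ.Opn) : Dir → M → M → Prop
  | .f, x, y => K.cell (opn C) x ∧ ¬ K.E C x ∧ K.E C y ∧ K.lt (opn C) x y ∧
      ¬ ∃ z, K.E C z ∧ K.lt (opn C) x z ∧ K.lt (opn C) z y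
  | .b, x, y => K.cell (opn C) x ∧ ¬ K.E C x ∧ K.E C y ∧ K.lt (opn C) y x ∧
      ¬ ∃ z, K.E C z ∧ K.lt (opn C) y z ∧ K.lt (opn C) z x

/-- Membership in an element of `Φ₁`. -/
def sec : Φ.Section₁ → M → Prop
  | .inl D, x => K.cell (trans D) x
  | .inr C, x => K.E C x

/-- Membership in `C ∪ {min(C), max(C)}`. -/
def bar (C : Φ.Section₁) (x : M) : Prop := (K.sec C x ∨ x = K.mn C.cell) ∨ x = K.mx C.cell

/-- `z` is an element of the section `C` strictly between the elements `x` and `y` of its closure. -/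
def between (C : Φ.Section₁) (x z y : M) : Prop :=
  (K.sec C z ∧ K.lt C.cell x z ∧ K.bar C x ∧ K.bar C z) ∧ K.lt C.cell z y ∧ K.bar C z ∧ K.bar C y

/-- `x` is an element of the section `C` fixed by `f^N`. -/
def fix (C : Φ.Section₁) (x : M) : Prop := K.sec C x ∧ (K.prog .f)^[Φ.N] x = x

/-- `x` is a boundary point of the set of fixed points of `f^N` in the section `C`. -/
def fixbd (C : Φ.Section₁) (x : M) : Prop :=
  K.fix C x ∧ ∀ y z, (K.lt C.cell y x ∧ K.bar C y ∧ K.bar C x) ∧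
    (K.lt C.cell x z ∧ K.bar C x ∧ K.bar C z) → ∃ w, K.between C y w z ∧ ¬ K.fix C w

end FlowOps

section Realize

variable {Φ : FlowConfiguration} {L : FirstOrder.Language.{0, 0}} [Expansion Φ L] {M : Type}
  [L.Structure M] {n : ℕ} {v : Empty → M} {xs : Fin n → M}

variable (Φ L M) in
/-- The interpretations of the symbols of `L(Φ)` in a structure for an expansion of `L(Φ)`. -/
def flowOps : FlowOps Φ M where
  cell C x := Structure.RelMap ((Expansion.incl (Φ := Φ) (L := L)).onRelation (Rel.cell C)) ![x]
  E C x := Structure.RelMap ((Expansion.incl (Φ := Φ) (L := L)).onRelation (Rel.E C)) ![x]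
  lt C x y := Structure.RelMap ((Expansion.incl (Φ := Φ) (L := L)).onRelation (Rel.lt C)) ![x, y]
  prog g x := Structure.funMap ((Expansion.incl (Φ := Φ) (L := L)).onFunction (Func.prog g)) ![x]
  s := Structure.funMap ((Expansion.incl (Φ := Φ) (L := L)).onFunction Func.s) ![]
  single c := Structure.funMap ((Expansion.incl (Φ := Φ) (L := L)).onFunction (Func.single c)) ![]
  e C := Structure.funMap ((Expansion.incl (Φ := Φ) (L := L)).onFunction (Func.e C)) ![]
  lo g C :=
    Structure.funMap ((Expansion.incl (Φ := Φ) (L := L)).onFunction (Func.lowerEnd g C)) ![]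
  hi g C :=
    Structure.funMap ((Expansion.incl (Φ := Φ) (L := L)).onFunction (Func.upperEnd g C)) ![]

local notation "K" => flowOps Φ L M

@[simp] theorem realize_up {t : Tm L n} {x : M} :
    (up t).realize (Sum.elim v (Fin.snoc xs x : Fin (n + 1) → M)) = t.realize (Sum.elim v xs) := by
  rw [up, Term.realize_relabel]
  congr 1
  ext (i | i) <;> simp

@[simp] theorem realize_exV {F : Tm L (n + 1) → Fm L (n + 1)} :
    (exV F).Realize v xs ↔ ∃ x, (F &(Fin.last n)).Realize v (Fin.snoc xs x) := by
  simp [exV]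

@[simp] theorem realize_allV {F : Tm L (n + 1) → Fm L (n + 1)} :
    (allV F).Realize v xs ↔ ∀ x, (F &(Fin.last n)).Realize v (Fin.snoc xs x) := by
  simp [allV]

theorem realize_const (c : Func Φ 0) : (const Φ c : Tm L n).realize (Sum.elim v xs) =
    Structure.funMap ((Expansion.incl (Φ := Φ) (L := L)).onFunction c) ![] := by
  simp only [const, Constants.term, Term.realize_func]
  congr 1
  exact Subsingleton.elim _ _

@[simp] theorem realize_const_s :
    (const Φ .s : Tm L n).realize (Sum.elim v xs) = (K).s := realize_const _

@[simp] theorem realize_const_single (c : Φ.Single) :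
    (const Φ (.single c) : Tm L n).realize (Sum.elim v xs) = (K).single c := realize_const _

@[simp] theorem realize_const_e (C : Φ.Tan) :
    (const Φ (.e C) : Tm L n).realize (Sum.elim v xs) = (K).e C := realize_const _

@[simp] theorem realize_const_lo (g : Dir) (C : Φ.Trans) :
    (const Φ (.lowerEnd g C) : Tm L n).realize (Sum.elim v xs) = (K).lo g C := realize_const _

@[simp] theorem realize_const_hi (g : Dir) (C : Φ.Trans) :
    (const Φ (.upperEnd g C) : Tm L n).realize (Sum.elim v xs) = (K).hi g C := realize_const _

@[simp] theorem realize_ap (g : Dir) (t : Tm L n) :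
    (ap Φ g t).realize (Sum.elim v xs) = (K).prog g (t.realize (Sum.elim v xs)) := by
  simp [ap, flowOps]

@[simp] theorem realize_iter (g : Dir) (m : ℕ) (t : Tm L n) :
    (iter Φ g m t).realize (Sum.elim v xs) =
      ((K).prog g)^[m] (t.realize (Sum.elim v xs)) := by
  unfold iter
  induction m with
  | zero => rfl
  | succ m ih => rw [Function.iterate_succ_apply', Function.iterate_succ_apply', realize_ap, ih]

@[simp] theorem realize_isIn (C : Φ.Cell) (t : Tm L n) :
    (isIn C t).Realize v xs ↔ (K).cell C (t.realize (Sum.elim v xs)) := by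
  simp [isIn, flowOps]

@[simp] theorem realize_lt (C : Φ.Cell) (t u : Tm L n) : (lt C t u).Realize v xs ↔
    (K).lt C (t.realize (Sum.elim v xs)) (u.realize (Sum.elim v xs)) := by
  simp [lt, flowOps]

@[simp] theorem realize_le (C : Φ.Cell) (t u : Tm L n) : (le C t u).Realize v xs ↔
    (K).lt C (t.realize (Sum.elim v xs)) (u.realize (Sum.elim v xs)) ∨
      t.realize (Sum.elim v xs) = u.realize (Sum.elim v xs) := by
  simp [le]

@[simp] theorem realize_isE (C : Φ.Opn ⊕ Φ.Tan) (t : Tm L n) :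
    (isE C t).Realize v xs ↔ (K).leafE C (t.realize (Sum.elim v xs)) := by
  rcases C with C | C
  · simp [isE, flowOps, FlowOps.leafE]
  · simp [isE, FlowOps.leafE]

@[simp] theorem realize_ptTerm (c : Option Φ.Single) :
    (ptTerm c : Tm L n).realize (Sum.elim v xs) = (K).pt c := by
  cases c <;> simp [ptTerm, FlowOps.pt]

@[simp] theorem realize_mn (C : Φ.Cell) :
    (mn C : Tm L n).realize (Sum.elim v xs) = (K).mn C := by simp [mn, FlowOps.mn]

@[simp] theorem realize_mx (C : Φ.Cell) :
    (mx C : Tm L n).realize (Sum.elim v xs) = (K).mx C := by simp [mx, FlowOps.mx]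

@[simp] theorem realize_phi (C : Φ.Opn) (g : Dir) (x y : Tm L n) : (phi C g x y).Realize v xs ↔
    (K).phi C g (x.realize (Sum.elim v xs)) (y.realize (Sum.elim v xs)) := by
  cases g <;> simp [phi, FlowOps.phi, FlowOps.leafE, and_assoc]

@[simp] theorem realize_mem (C : Φ.Section₁) (x : Tm L n) :
    (mem C x).Realize v xs ↔ (K).sec C (x.realize (Sum.elim v xs)) := by
  rcases C with C | C <;> simp [mem, FlowOps.sec, FlowOps.leafE]

@[simp] theorem realize_bar (C : Φ.Section₁) (x : Tm L n) :
    (bar C x).Realize v xs ↔ (K).bar C (x.realize (Sum.elim v xs)) := by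
  simp [bar, FlowOps.bar]

@[simp] theorem realize_between (C : Φ.Section₁) (x z y : Tm L n) :
    (between C x z y).Realize v xs ↔ (K).between C (x.realize (Sum.elim v xs))
      (z.realize (Sum.elim v xs)) (y.realize (Sum.elim v xs)) := by
  simp [between, FlowOps.between, lt₁, and_assoc]

@[simp] theorem realize_fix (C : Φ.Section₁) (x : Tm L n) :
    (fix C x).Realize v xs ↔ (K).fix C (x.realize (Sum.elim v xs)) := by
  simp [fix, FlowOps.fix]

@[simp] theorem realize_fixbd (C : Φ.Section₁) (x : Tm L n) :
    (fixbd C x).Realize v xs ↔ (K).fixbd C (x.realize (Sum.elim v xs)) := by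
  simp [fixbd, FlowOps.fixbd, lt₁, and_assoc]

/-- The sentence `isDLO` expresses the property `IsDLOOn`. The hypothesis `hP` is restricted to
extensions `ys` of the parameters `xs`, which the formula `P` may mention. -/
theorem isDLOOn_of_realize_isDLO {k : ℕ} {P : ∀ j, Tm L (k + j) → Fm L (k + j)}
    {lt' : ∀ j, Tm L (k + j) → Tm L (k + j) → Fm L (k + j)} {P' : M → Prop} {R : M → M → Prop}
    {xs : Fin k → M}
    (hP : ∀ j t (ys : Fin (k + j) → M), (∀ i, ys (Fin.castAdd j i) = xs i) →
      ((P j t).Realize v ys ↔ P' (t.realize (Sum.elim v ys))))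
    (hR : ∀ j t u (ys : Fin (k + j) → M), (lt' j t u).Realize v ys ↔
      R (t.realize (Sum.elim v ys)) (u.realize (Sum.elim v ys)))
    (h : (isDLO k P lt').Realize v xs) : IsDLOOn P' R := by
  have s1 : ∀ x : M, ∀ i, (Fin.snoc xs x : Fin (k + 1) → M) (Fin.castAdd 1 i) = xs i :=
    fun x i => Fin.snoc_castSucc (α := fun _ => M) x xs i
  have s2 : ∀ x y : M, ∀ i, (Fin.snoc (Fin.snoc xs x : Fin (k + 1) → M) y : Fin (k + 2) → M)
      (Fin.castAdd 2 i) = xs i := fun x y i =>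
    (Fin.snoc_castSucc (α := fun _ => M) y _ (Fin.castAdd 1 i)).trans (s1 x i)
  have s3 : ∀ x y z : M, ∀ i, (Fin.snoc (Fin.snoc (Fin.snoc xs x : Fin (k + 1) → M) y :
      Fin (k + 2) → M) z : Fin (k + 3) → M) (Fin.castAdd 3 i) = xs i := fun x y z i =>
    (Fin.snoc_castSucc (α := fun _ => M) z _ (Fin.castAdd 2 i)).trans (s2 x y i)
  have a1 : ∀ x : M, (Fin.snoc xs x : Fin (k + 1) → M) (Fin.natAdd k 0) = x :=
    fun x => Fin.snoc_last (α := fun _ => M) x xs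
  have a2 : ∀ x y : M, (Fin.snoc (Fin.snoc xs x : Fin (k + 1) → M) y : Fin (k + 2) → M)
      (Fin.natAdd k (0 : Fin 2)) = x := fun x y =>
    (Fin.snoc_castSucc (α := fun _ => M) y _ (Fin.natAdd k (0 : Fin 1))).trans (a1 x)
  have b2 : ∀ x y : M, (Fin.snoc (Fin.snoc xs x : Fin (k + 1) → M) y : Fin (k + 2) → M)
      (Fin.natAdd k (1 : Fin 2)) = y := fun x y => Fin.snoc_last (α := fun _ => M) y _
  have a3 : ∀ x y z : M, (Fin.snoc (Fin.snoc (Fin.snoc xs x : Fin (k + 1) → M) y :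
      Fin (k + 2) → M) z : Fin (k + 3) → M) (Fin.natAdd k (0 : Fin 3)) = x := fun x y z =>
    (Fin.snoc_castSucc (α := fun _ => M) z _ (Fin.natAdd k (0 : Fin 2))).trans (a2 x y)
  have b3 : ∀ x y z : M, (Fin.snoc (Fin.snoc (Fin.snoc xs x : Fin (k + 1) → M) y :
      Fin (k + 2) → M) z : Fin (k + 3) → M) (Fin.natAdd k (1 : Fin 3)) = y := fun x y z =>
    (Fin.snoc_castSucc (α := fun _ => M) z _ (Fin.natAdd k (1 : Fin 2))).trans (b2 x y)
  have c3 : ∀ x y z : M, (Fin.snoc (Fin.snoc (Fin.snoc xs x : Fin (k + 1) → M) y :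
      Fin (k + 2) → M) z : Fin (k + 3) → M) (Fin.natAdd k (2 : Fin 3)) = z := fun x y z =>
    Fin.snoc_last (α := fun _ => M) z _
  have p1 := fun t x => hP 1 t _ (s1 x)
  have p2 := fun t x y => hP 2 t _ (s2 x y)
  have p3 := fun t x y z => hP 3 t _ (s3 x y z)
  unfold isDLO at h
  simp only [BoundedFormula.realize_inf, BoundedFormula.realize_ex, BoundedFormula.realize_all,
    BoundedFormula.realize_imp, BoundedFormula.realize_not, BoundedFormula.realize_sup,
    BoundedFormula.realize_bdEqual, p1, p2, p3, hR, Term.realize_var, Function.comp_apply,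
    Sum.elim_inr, a1, a2, b2, a3, b3, c3] at h
  obtain ⟨⟨⟨⟨⟨⟨h1, h2⟩, h3⟩, h4⟩, h5⟩, h6⟩, h7⟩ := h
  exact ⟨h1, h2, fun x y z hx hy hz hxy hyz => h3 x y z ⟨⟨⟨⟨hx, hy⟩, hz⟩, hxy⟩, hyz⟩,
    fun x y hx hy => or_assoc.1 (h4 x y ⟨hx, hy⟩),
    fun x y hx hy hxy => by simpa [and_assoc] using h5 x y ⟨⟨hx, hy⟩, hxy⟩,
    fun x hx => h6 x hx, fun x hx => h7 x hx⟩

end Realize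

end FlowConfiguration

/-! ### Consequences of the axioms in a model -/

namespace FlowConfiguration

/-- The consequences of `T(Φ)` that the proof uses, for the interpretations of the symbols. -/
structure FlowOps.Laws {Φ : FlowConfiguration} {M : Type} (K : FlowOps Φ M) : Prop where
  single_cell : ∀ c C, ¬ K.cell C (K.single c)
  s_cell : ∀ C, ¬ K.cell C K.s
  single_ne_s : ∀ c, K.single c ≠ K.s
  cover : ∀ x, x = K.s ∨ (∃ c, x = K.single c) ∨ ∃ C, K.cell C x
  cell_unique : ∀ C D x, K.cell C x → K.cell D x → C = D
  dlo : ∀ C, IsDLOOn (K.cell C) (K.lt C)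
  lt_mx : ∀ C x, K.cell C x → K.lt C x (K.mx C)
  mn_lt : ∀ C x, K.cell C x → K.lt C (K.mn C) x
  lt_support : ∀ C x y, K.lt C x y →
    (K.cell C x ∧ K.cell C y) ∨ (x = K.mn C ∧ K.cell C y) ∨ (K.cell C x ∧ y = K.mx C)
  e_cell : ∀ C, K.cell (tan C) (K.e C)
  E_cell : ∀ C x, K.E C x → K.cell (opn C) x
  E_dlo : ∀ C, IsDLOOn (K.E C) (K.lt (opn C))
  opp_prog_single : ∀ g c, K.prog g (K.single c) ≠ K.s →
    K.prog g.opp (K.prog g (K.single c)) = K.single c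
  tan_f_ge : ∀ C x, K.cell (tan C) x → K.lt (tan C) (K.e C) x → K.prog .f x = K.prog .f (K.e C)
  tan_b_le : ∀ C x, K.cell (tan C) x → K.lt (tan C) x (K.e C) → K.prog .b x = K.prog .b (K.e C)
  tan_f_lt : ∀ C x, K.cell (tan C) x → K.lt (tan C) x (K.e C) → K.prog .f x = K.e C
  tan_b_gt : ∀ C x, K.cell (tan C) x → K.lt (tan C) (K.e C) x → K.prog .b x = K.e C
  E_inj : ∀ C g x y, K.E C x → K.E C y → K.prog g x = K.prog g y → K.prog g x = K.s ∨ x = y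
  single_leafE : ∀ c g, K.leafE (Φ.adj g (.inr c)) (K.prog g (K.single c))
  trans_leafE : ∀ C g x, K.cell (trans C) x → K.leafE (Φ.adj g (.inl C)) (K.prog g x)
  trans_mono : ∀ C g x y, K.cell (trans C) x → K.cell (trans C) y →
    (K.lt (trans C) x y ↔ K.lt (ofLeafed (Φ.adj g (.inl C))) (K.prog g x) (K.prog g y))
  trans_inv : ∀ C g x, K.cell (trans C) x → K.prog g.opp (K.prog g x) = x
  E_prog : ∀ C g x, K.E C x → K.prog g x = K.s ∨
    (∃ D, Φ.adj g.opp (.inl D) = .inl C ∧ K.cell (trans D) (K.prog g x)) ∨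
    ∃ d, Φ.adj g.opp (.inr d) = .inl C ∧ K.prog g x = K.single d
  exists_phi : ∀ C x, K.cell (opn C) x → ¬ K.E C x → ∃ y, K.phi C .f x y ∨ K.phi C .b x y
  phi_dlo : ∀ C y, K.E C y →
    IsDLOOn (fun x => (K.phi C .b x y ∨ K.phi C .f x y) ∨ x = y) (K.lt (opn C))
  phi_prog : ∀ C g x y, K.phi C g x y → K.prog g x = y
  phi_opp_prog : ∀ C g x y, K.phi C g.opp x y → K.prog g x = K.prog g y
  lo_mem : ∀ C g, (K.leafE (Φ.adj g (.inl C)) (K.lo g C) ∨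
    K.lo g C = K.mn (ofLeafed (Φ.adj g (.inl C)))) ∨ K.lo g C = K.mx (ofLeafed (Φ.adj g (.inl C)))
  hi_mem : ∀ C g, (K.leafE (Φ.adj g (.inl C)) (K.hi g C) ∨
    K.hi g C = K.mn (ofLeafed (Φ.adj g (.inl C)))) ∨ K.hi g C = K.mx (ofLeafed (Φ.adj g (.inl C)))
  mem_image_iff : ∀ C g x, K.leafE (Φ.adj g (.inl C)) x → (K.cell (trans C) (K.prog g.opp x) ↔
    K.lt (ofLeafed (Φ.adj g (.inl C))) (K.lo g C) x ∧
      K.lt (ofLeafed (Φ.adj g (.inl C))) x (K.hi g C))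

theorem phi_cell {Φ : FlowConfiguration} {M : Type} {K : FlowOps Φ M} {C : Φ.Opn} {g : Dir}
    {x y : M} (h : K.phi C g x y) : K.cell (opn C) x ∧ ¬ K.E C x ∧ K.E C y := by
  cases g <;> exact ⟨h.1, h.2.1, h.2.2.1⟩

theorem laws_of_model {Φ : FlowConfiguration} {M : Type} [Φ.language.Structure M]
    (h : M ⊨ Φ.theory) : (flowOps Φ Φ.language M).Laws := by
  have ax : ∀ {σ}, Axiom₁ Φ σ → M ⊨ σ := fun hσ => h.realize_of_mem _ hσ
  set K := flowOps Φ Φ.language M with hK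
  have single_cell : ∀ c C, ¬ K.cell C (K.single c) := fun c C => by
    simpa [Sentence.Realize, Formula.Realize] using ax (.F1_single_cell c C)
  have s_cell : ∀ C, ¬ K.cell C K.s := fun C => by
    simpa [Sentence.Realize, Formula.Realize] using ax (.F1_s_cell C)
  have cover := ax .F1_cover
  simp only [Sentence.Realize, Formula.Realize, BoundedFormula.realize_all,
    BoundedFormula.realize_sup, BoundedFormula.realize_inf, BoundedFormula.realize_iSup,
    BoundedFormula.realize_iInf, BoundedFormula.realize_bdEqual, BoundedFormula.realize_not,
    realize_isIn, realize_const_s, realize_const_single] at cover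
  simp only [Function.comp_apply, Nat.reduceAdd, ← hK] at cover
  refine
  { single_cell := single_cell
    s_cell := s_cell
    single_ne_s := fun c => ?_
    cover := fun x => ?_
    cell_unique := fun C D x hC hD => ?_
    dlo := fun C => isDLOOn_of_realize_isDLO (fun _ _ _ _ => realize_isIn _ _)
      (fun _ _ _ _ => realize_lt _ _ _) (ax (.F2_dlo C))
    lt_mx := fun C x hx => ?_
    mn_lt := fun C x hx => ?_
    lt_support := fun C x y hxy => ?_
    e_cell := fun C => ?_
    E_cell := fun C x hx => ?_
    E_dlo := fun C => isDLOOn_of_realize_isDLO (fun _ _ _ _ => realize_isE _ _)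
      (fun _ _ _ _ => realize_lt _ _ _) (ax (.F4 C))
    opp_prog_single := fun g c => ?_
    tan_f_ge := fun C x hx hlt => ?_
    tan_b_le := fun C x hx hlt => ?_
    tan_f_lt := fun C x hx hlt => ?_
    tan_b_gt := fun C x hx hlt => ?_
    E_inj := fun C g x y hx hy hxy => ?_
    single_leafE := fun c g => ?_
    trans_leafE := fun C g x hx => ?_
    trans_mono := fun C g x y hx hy => ?_
    trans_inv := fun C g x hx => ?_
    E_prog := fun C g x hx => ?_
    exists_phi := fun C x hx hx' => ?_
    phi_dlo := fun C y hy => ?_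
    phi_prog := fun C g x y hxy => ?_
    phi_opp_prog := fun C g x y hxy => ?_
    lo_mem := fun C g => ?_
    hi_mem := fun C g => ?_
    mem_image_iff := fun C g x hx => ?_ }
  · simpa [Sentence.Realize, Formula.Realize] using ax (.F1_single_s c)
  · rcases cover x with (h | h) | ⟨C, h, _⟩
    exacts [.inl h, .inr (.inl h), .inr (.inr ⟨C, h⟩)]
  · rcases cover x with (h | ⟨c, h⟩) | ⟨C', h, h'⟩
    · exact absurd (h ▸ hC) (s_cell C)
    · exact absurd (h ▸ hC) (single_cell c C)
    · have : ∀ D, K.cell D x → D = C' := fun D hD => by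
        by_contra hne
        exact h' ⟨D, hne⟩ hD
      rw [this C hC, this D hD]
  · have := ax (.F2_ends C)
    simp [Sentence.Realize, Formula.Realize, Fin.snoc, ← hK] at this
    exact (this x hx).1
  · have := ax (.F2_ends C)
    simp [Sentence.Realize, Formula.Realize, Fin.snoc, ← hK] at this
    exact (this x hx).2
  · have := ax (.F2_support C)
    simp [Sentence.Realize, Formula.Realize, Fin.snoc, ← hK] at this
    exact or_assoc.1 (this x y hxy)
  · simpa [Sentence.Realize, Formula.Realize] using ax (.F3_tan C)
  · have := ax (.F3_open C)
    simp [Sentence.Realize, Formula.Realize, Fin.snoc, ← hK] at this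
    exact this x hx
  · have := ax (.F5_b g c)
    simpa [Sentence.Realize, Formula.Realize, Fin.snoc, ← hK] using this
  · have := ax (.F5_d_f C)
    simp [Sentence.Realize, Formula.Realize, Fin.snoc, ← hK] at this
    exact this x hx (.inl hlt)
  · have := ax (.F5_d_b C)
    simp [Sentence.Realize, Formula.Realize, Fin.snoc, ← hK] at this
    exact this x hx (.inl hlt)
  · have := ax (.F5_e_f C)
    simp [Sentence.Realize, Formula.Realize, Fin.snoc, ← hK] at this
    exact this x hx hlt
  · have := ax (.F5_e_b C)
    simp [Sentence.Realize, Formula.Realize, Fin.snoc, ← hK] at this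
    exact this x hx hlt
  · have := ax (.F6 C g)
    simp [Sentence.Realize, Formula.Realize, Fin.snoc, ← hK] at this
    exact this x y hx hy hxy
  · have := ax (.F7 c g)
    simpa [Sentence.Realize, Formula.Realize, Fin.snoc, ← hK] using this
  · have := ax (.F8_image C g)
    simp [Sentence.Realize, Formula.Realize, Fin.snoc, ← hK] at this
    exact this x hx
  · have := ax (.F8_mono C g)
    simp [Sentence.Realize, Formula.Realize, Fin.snoc, ← hK] at this
    exact this x y hx hy
  · have := ax (.F8_inverse C g)
    simp [Sentence.Realize, Formula.Realize, Fin.snoc, ← hK] at this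
    exact this x hx
  · have := ax (.F9 C g)
    simp [Sentence.Realize, Formula.Realize, Fin.snoc, ← hK] at this
    simpa [or_assoc] using this x hx
  · have := ax (.F10_a C)
    simp [Sentence.Realize, Formula.Realize, Fin.snoc, ← hK] at this
    exact this x hx hx'
  · have := ax (.F11 C)
    simp only [Sentence.Realize, Formula.Realize, BoundedFormula.realize_all,
      BoundedFormula.realize_imp, realize_isE] at this
    refine isDLOOn_of_realize_isDLO ?_ (fun _ _ _ _ => realize_lt _ _ _) (this y hy)
    intro j t ys hys
    simp only [BoundedFormula.realize_sup, realize_phi, BoundedFormula.realize_bdEqual,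
      Term.realize_var, Sum.elim_inr, Function.comp_apply, hys, ← hK]
    exact Iff.rfl
  · have := ax (.F12_a C g)
    simp [Sentence.Realize, Formula.Realize, Fin.snoc, ← hK] at this
    obtain ⟨h1, h2, _⟩ := phi_cell hxy
    exact this x h1 h2 y hxy y hxy
  · have := ax (.F12_b C g)
    simp [Sentence.Realize, Formula.Realize, Fin.snoc, ← hK] at this
    obtain ⟨h1, h2, _⟩ := phi_cell hxy
    exact this x h1 h2 y hxy y hxy
  · have := ax (.F13_a C g)
    simpa [Sentence.Realize, Formula.Realize, Fin.snoc, ← hK] using this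
  · have := ax (.F13_b C g)
    simpa [Sentence.Realize, Formula.Realize, Fin.snoc, ← hK] using this
  · have := ax (.F13_d C g)
    simp [Sentence.Realize, Formula.Realize, Fin.snoc, ← hK] at this
    exact this x hx

end FlowConfiguration

namespace DulacFlowConfiguration

open FlowConfiguration

/-- Interpretations of the symbols of `L(Ψ)` on a type `M`. -/
structure Ops (Ψ : DulacFlowConfiguration) (M : Type) extends FlowOps Ψ.flow M where
  rel : Rel Ψ 2 → M → M → Prop
  gamma : Ψ.flow.Section₁ → Fin Ψ.nu → M

/-- The direction `g` of the map `g^m` that occurs in the definition of a new predicate. -/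
def Rel.dir {Ψ : DulacFlowConfiguration} : Rel Ψ 2 → Dir
  | .R _ => .f
  | .S g _ _ => g
  | .B g _ _ => g

/-- The exponent `m` of the map `g^m` that occurs in the definition of a new predicate. -/
def Rel.exp {Ψ : DulacFlowConfiguration} : Rel Ψ 2 → ℕ
  | .R _ => Ψ.flow.N
  | .S _ m _ => m
  | .B _ m _ => m

/-- The property of a point that defines a new predicate. -/
def Ops.atPt {Ψ : DulacFlowConfiguration} {M : Type} (K : Ops Ψ M) : Rel Ψ 2 → M → Prop
  | .R C, z => K.fix C z
  | .S g m C, z => K.sec C z ∧ K.sec C ((K.prog g)^[m] z) ∧ K.lt C.cell ((K.prog g)^[m] z) z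
  | .B g m C, z => K.sec C z ∧ K.sec C ((K.prog g)^[m] z) ∧ K.lt C.cell z ((K.prog g)^[m] z)

/-- The consequences of `T(Ψ)` that the proof uses, for the interpretations of the symbols. -/
structure Ops.Laws {Ψ : DulacFlowConfiguration} {M : Type} (K : Ops Ψ M) : Prop
    extends K.toFlowOps.Laws where
  rel_iff : ∀ G x y, K.rel G x y ↔ (∃ z, K.between G.sec x z y ∧ K.atPt G z) ∨ x = y ∧ K.atPt G x
  coherence : ∀ G x y, K.rel G x y →
    (∀ z, K.between G.sec x z y → K.sec G.sec ((K.prog G.dir)^[G.exp] z)) →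
    (∀ z, K.between G.sec x z y → ∀ j, z ≠ K.gamma G.sec j) →
    ∀ z, K.between G.sec x z y → K.rel G z z

variable {Ψ : DulacFlowConfiguration} {M : Type} [Ψ.language.Structure M]

variable (Ψ M) in
/-- The interpretations of the symbols of `L(Ψ)` in an `L(Ψ)`-structure. -/
def ops : Ops Ψ M where
  toFlowOps := flowOps Ψ.flow Ψ.language M
  rel G x y := Structure.RelMap (L := Ψ.language) (Sum.inr G : Ψ.language.Relations 2) ![x, y]
  gamma C j :=
    Structure.funMap (L := Ψ.language) (Sum.inr (Func.gamma C j) : Ψ.language.Functions 0) ![]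

theorem realize_rel {n : ℕ} {v : Empty → M} {xs : Fin n → M} (G : Rel Ψ 2) (x y : Tm Ψ.language n) :
    (Ψ.rel G x y).Realize v xs ↔
      (ops Ψ M).rel G (x.realize (Sum.elim v xs)) (y.realize (Sum.elim v xs)) := by
  exact BoundedFormula.realize_rel₂

theorem realize_gamma {n : ℕ} {v : Empty → M} {xs : Fin n → M} (C : Ψ.flow.Section₁)
    (j : Fin Ψ.nu) :
    (Ψ.gamma C j : Tm Ψ.language n).realize (Sum.elim v xs) = (ops Ψ M).gamma C j := by
  simp only [gamma, Constants.term, Term.realize_func, ops]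
  congr 1
  exact Subsingleton.elim _ _

theorem realize_atPt {n : ℕ} {v : Empty → M} {xs : Fin n → M} (G : Rel Ψ 2) (x : Tm Ψ.language n) :
    (Ψ.atPt G x).Realize v xs ↔ (ops Ψ M).atPt G (x.realize (Sum.elim v xs)) := by
  cases G <;> simp [atPt, Ops.atPt, lt₁] <;> simp +contextual [ops, FlowOps.bar, and_assoc]

theorem laws_of_model (h : M ⊨ Ψ.theory) : (ops Ψ M).Laws := by
  let _ : Ψ.flow.language.Structure M := (LHom.sumInl : _ →ᴸ Ψ.language).reduct M
  have h1 : M ⊨ Ψ.flow.theory := by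
    refine (LHom.onTheory_model (LHom.sumInl : Ψ.flow.language →ᴸ Ψ.language) _).1 ?_
    exact h.mono Set.subset_union_left
  have h2 : (flowOps Ψ.flow Ψ.language M).Laws := FlowConfiguration.laws_of_model h1
  have ax : ∀ {σ}, Ψ.Axiom₂ σ → M ⊨ σ := fun hσ => h.realize_of_mem _ (.inr hσ)
  have coh : ∀ G : Rel Ψ 2, M ⊨ Ψ.coherence G G.dir G.exp := by
    intro G
    cases G
    exacts [ax (.D4_R _ _), ax (.D4_S _ _ _), ax (.D4_B _ _ _)]
  refine { h2 with rel_iff := fun G x y => ?_, coherence := fun G x y hG hd hg z hz => ?_ }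
  · have := ax (.D23 G)
    simp [Sentence.Realize, Formula.Realize, Fin.snoc, realize_rel, realize_atPt] at this
    exact this x y
  · have d6 := ax (.D6 G.sec)
    have := coh G
    simp [Sentence.Realize, Formula.Realize, Fin.snoc, realize_gamma] at d6
    simp [Sentence.Realize, Formula.Realize, Fin.snoc, realize_rel, coherence] at this
    refine this x y hG hd (fun z hz hb => ?_) z hz
    obtain ⟨j, hj, _⟩ := (d6 z).1 ⟨hz.1.1, hb⟩
    exact hg z hz j hj

end DulacFlowConfiguration

/-! ### The geometry of a single model -/

@[simp] theorem Dir.opp_opp (g : Dir) : g.opp.opp = g := by cases g <;> rfl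

namespace FlowConfiguration

theorem Section₁.cell_injective {Φ : FlowConfiguration} :
    Function.Injective (Section₁.cell : Φ.Section₁ → Φ.Cell) := by
  rintro (C | C) (D | D) h <;> simp_all [Section₁.cell]

namespace FlowOps

variable {Φ : FlowConfiguration} {M : Type} {K : FlowOps Φ M}

/-- `x` lies in the leaf of the point `y ∈ E_C`: the set of points of `C` that are not separated
from `y` by a point of `E_C`. -/
def leaf (K : FlowOps Φ M) (C : Φ.Opn) (x y : M) : Prop :=
  K.E C y ∧ ((K.phi C .b x y ∨ K.phi C .f x y) ∨ x = y)

namespace Laws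

variable (hK : K.Laws)
include hK

theorem not_cell_pt (C : Φ.Cell) (o : Option Φ.Single) : ¬ K.cell C (K.pt o) := by
  cases o
  exacts [hK.s_cell C, hK.single_cell _ C]

theorem ne_mn {C D : Φ.Cell} {x : M} (hx : K.cell C x) : x ≠ K.mn D :=
  fun h => hK.not_cell_pt C _ (h ▸ hx)

theorem ne_mx {C D : Φ.Cell} {x : M} (hx : K.cell C x) : x ≠ K.mx D :=
  fun h => hK.not_cell_pt C _ (h ▸ hx)

theorem irrefl (C : Φ.Cell) (x : M) : ¬ K.lt C x x := by
  intro h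
  rcases hK.lt_support C x x h with ⟨h1, _⟩ | ⟨h1, h2⟩ | ⟨h1, h2⟩
  exacts [(hK.dlo C).irrefl x h1 h, hK.ne_mn h2 h1, hK.ne_mx h1 h2]

theorem lt_left {C : Φ.Cell} {x y : M} (h : K.lt C x y) : K.cell C x ∨ x = K.mn C := by
  rcases hK.lt_support C x y h with ⟨h1, _⟩ | ⟨h1, _⟩ | ⟨h1, _⟩
  exacts [.inl h1, .inr h1, .inl h1]

theorem lt_right {C : Φ.Cell} {x y : M} (h : K.lt C x y) : K.cell C y ∨ y = K.mx C := by
  rcases hK.lt_support C x y h with ⟨_, h1⟩ | ⟨_, h1⟩ | ⟨_, h1⟩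
  exacts [.inl h1, .inl h1, .inr h1]

theorem lt_trans {C : Φ.Cell} {x y z : M} (hx : K.cell C x) (hy : K.cell C y) (hxy : K.lt C x y)
    (hyz : K.lt C y z) : K.lt C x z := by
  rcases hK.lt_right hyz with hz | rfl
  · exact (hK.dlo C).trans x y z hx hy hz hxy hyz
  · exact hK.lt_mx C x hx

theorem lt_trans' {C : Φ.Cell} {x y z : M} (hy : K.cell C y) (hz : K.cell C z) (hxy : K.lt C x y)
    (hyz : K.lt C y z) : K.lt C x z := by
  rcases hK.lt_left hxy with hx | rfl
  · exact (hK.dlo C).trans x y z hx hy hz hxy hyz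
  · exact hK.mn_lt C z hz

/-- The order of a cell cannot be reversed; one of the points has to be in the cell, as `min(C)`
and `max(C)` may be equal. -/
theorem lt_asymm {C : Φ.Cell} {x y : M} (hx : K.cell C x) (hy : K.cell C y) (hxy : K.lt C x y) :
    ¬ K.lt C y x := fun hyx => hK.irrefl C x (hK.lt_trans hx hy hxy hyx)

theorem sec_cell {C : Φ.Section₁} {x : M} (h : K.sec C x) : K.cell C.cell x := by
  rcases C with C | C
  exacts [h, hK.E_cell C x h]

theorem sec_unique {C D : Φ.Section₁} {x : M} (hC : K.sec C x) (hD : K.sec D x) : C = D :=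
  Section₁.cell_injective (hK.cell_unique _ _ x (hK.sec_cell hC) (hK.sec_cell hD))

/-- A point of `C ∖ E_C` lies in no section. -/
theorem not_sec_of_opn {O : Φ.Opn} {x : M} (hx : K.cell (opn O) x) (hx' : ¬ K.E O x)
    (D : Φ.Section₁) : ¬ K.sec D x := by
  intro h
  have := hK.cell_unique _ _ _ (hK.sec_cell h) hx
  rcases D with D | D
  · simp [Section₁.cell] at this
  · simp only [Section₁.cell, Sum.inl.injEq] at this
    exact hx' (this ▸ h)

theorem not_sec_of_tan {C : Φ.Tan} {x : M} (hx : K.cell (tan C) x) (D : Φ.Section₁) :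
    ¬ K.sec D x := by
  intro h
  have := hK.cell_unique _ _ _ (hK.sec_cell h) hx
  rcases D with D | D <;> simp [Section₁.cell] at this

theorem sec_dlo (C : Φ.Section₁) : IsDLOOn (K.sec C) (K.lt C.cell) := by
  rcases C with C | C
  exacts [hK.dlo _, hK.E_dlo C]

omit hK in
theorem between_iff {C : Φ.Section₁} {x y z : M} : K.between C x z y ↔
    K.sec C z ∧ K.lt C.cell x z ∧ K.lt C.cell z y ∧ K.bar C x ∧ K.bar C y := by
  unfold between bar
  tauto

/-- Outside a section, membership in its closure is only possible for the two end points. -/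
theorem not_bar {C D : Φ.Section₁} {x : M} (hx : K.sec C x) (h : C ≠ D) : ¬ K.bar D x := by
  rintro ((h' | h') | h')
  exacts [h (hK.sec_unique hx h'), hK.ne_mn (hK.sec_cell hx) h', hK.ne_mx (hK.sec_cell hx) h']

theorem phi_iff {C : Φ.Opn} {g : Dir} {x y : M} (hx : K.cell (opn C) x) (hx' : ¬ K.E C x) :
    K.phi C g x y ↔ K.E C y ∧ K.prog g x = y := by
  refine ⟨fun h => ⟨(phi_cell h).2.2, hK.phi_prog C g x y h⟩, ?_⟩
  rintro ⟨hy, hxy⟩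
  have key : ∀ z, K.phi C g.opp x z → K.phi C g x y := by
    intro z hz
    exfalso
    have h1 := hK.phi_opp_prog C g x z hz
    rw [hxy] at h1
    have hyc := hK.E_cell C y hy
    rcases hK.E_prog C g z (phi_cell hz).2.2 with h2 | ⟨D, _, h2⟩ | ⟨d, _, h2⟩
    · exact hK.s_cell _ (h2 ▸ h1 ▸ hyc)
    · exact absurd (hK.cell_unique _ _ _ hyc (h1 ▸ h2)) (by simp)
    · exact hK.single_cell d _ (h2 ▸ h1 ▸ hyc)
  have key' : ∀ z, K.phi C g x z → K.phi C g x y := by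
    intro z hz
    rw [← hxy, hK.phi_prog C g x z hz]
    exact hz
  obtain ⟨z, hz⟩ := hK.exists_phi C x hx hx'
  cases g
  · rcases hz with hz | hz
    exacts [key' z hz, key z hz]
  · rcases hz with hz | hz
    exacts [key z hz, key' z hz]

theorem exists_phi_prog {C : Φ.Opn} {x : M} (hx : K.cell (opn C) x) (hx' : ¬ K.E C x) :
    ∃ g, K.phi C g x (K.prog g x) := by
  obtain ⟨y, h | h⟩ := hK.exists_phi C x hx hx'
  · exact ⟨.f, by rwa [hK.phi_prog _ _ _ _ h]⟩
  · exact ⟨.b, by rwa [hK.phi_prog _ _ _ _ h]⟩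

omit hK in
theorem leaf_of_phi {C : Φ.Opn} {g : Dir} {x y : M} (h : K.phi C g x y) : K.leaf C x y :=
  ⟨(phi_cell h).2.2, by cases g <;> simp [h]⟩

theorem leaf_cell {C : Φ.Opn} {x y : M} (h : K.leaf C x y) : K.cell (opn C) x := by
  obtain ⟨hy, (h | h) | rfl⟩ := h
  exacts [(phi_cell h).1, (phi_cell h).1, hK.E_cell C _ hy]

/-- The leaves of an open cell are ordered like their points in `E_C`. -/
theorem lt_of_leaf {C : Φ.Opn} {x x' y y' : M} (h : K.leaf C x y) (h' : K.leaf C x' y')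
    (hlt : K.lt (opn C) y y') : K.lt (opn C) x x' := by
  have hx := hK.leaf_cell h
  have hx' := hK.leaf_cell h'
  obtain ⟨z, hz, hyz, hzy⟩ := (hK.E_dlo C).dense y y' h.1 h'.1 hlt
  have hzc := hK.E_cell C z hz
  have hyc := hK.E_cell C y h.1
  have hyc' := hK.E_cell C y' h'.1
  have h1 : K.lt (opn C) x z := by
    obtain ⟨hy, (h | h) | rfl⟩ := h
    · rcases (hK.dlo _).linear x z hx hzc with h1 | rfl | h1
      · exact h1
      · exact absurd hz h.2.1
      · exact absurd ⟨z, hz, hyz, h1⟩ h.2.2.2.2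
    · exact hK.lt_trans hx hyc h.2.2.2.1 hyz
    · exact hyz
  have h2 : K.lt (opn C) z x' := by
    obtain ⟨hy, (h | h) | rfl⟩ := h'
    · exact hK.lt_trans hzc hyc' hzy h.2.2.2.1
    · rcases (hK.dlo _).linear z x' hzc hx' with h1 | rfl | h1
      · exact h1
      · exact absurd hz h.2.1
      · exact absurd ⟨z, hz, h1, hzy⟩ h.2.2.2.2
    · exact hzy
  exact hK.lt_trans hx hzc h1 h2

theorem adj_trans (D : Φ.Trans) (g : Dir) : ∃ C : Φ.Opn, Φ.adj g (.inl D) = .inl C := by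
  rcases h : Φ.adj g (.inl D) with C | C
  · exact ⟨C, rfl⟩
  · exfalso
    obtain ⟨x, hx⟩ := (hK.dlo (trans D)).nonempty
    obtain ⟨y, hy, hxy⟩ := (hK.dlo (trans D)).no_max x hx
    have h1 := hK.trans_leafE D g x hx
    have h2 := hK.trans_leafE D g y hy
    rw [hK.trans_mono D g x y hx hy] at hxy
    rw [h] at h1 h2
    change _ = _ at h1 h2
    rw [h1, h2] at hxy
    exact hK.irrefl _ _ hxy

/-- A progression map from a point of `E_C` into a transverse cell is inverted by the opposite
progression map. -/
theorem E_inv {C : Φ.Opn} {D : Φ.Trans} {g : Dir} {x : M} (hx : K.E C x)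
    (hD : Φ.adj g.opp (.inl D) = .inl C) (hgx : K.cell (trans D) (K.prog g x)) :
    K.prog g.opp (K.prog g x) = x := by
  have h1 := hK.trans_inv D g.opp _ hgx
  have h2 := hK.trans_leafE D g.opp _ hgx
  rw [hD] at h2
  rw [Dir.opp_opp] at h1
  rcases hK.E_inj C g _ x h2 hx h1 with h | h
  · rw [h1] at h
    exact absurd (h ▸ hgx) (hK.s_cell _)
  · exact h

/-- A point of `E_C` that progresses to a single point is the image of that point under the
opposite progression map. -/
theorem E_eq_of_single {C : Φ.Opn} {d : Φ.Single} {g : Dir} {x : M} (hx : K.E C x)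
    (hd : Φ.adj g.opp (.inr d) = .inl C) (hgx : K.prog g x = K.single d) :
    x = K.prog g.opp (K.single d) := by
  have h1 := hK.single_leafE d g.opp
  rw [hd] at h1
  have h2 : K.prog g.opp (K.single d) ≠ K.s := fun h =>
    hK.s_cell (opn C) (h ▸ hK.E_cell C _ h1)
  have h3 := hK.opp_prog_single g.opp d h2
  rw [Dir.opp_opp] at h3
  rcases hK.E_inj C g x _ hx h1 (hgx.trans h3.symm) with h | h
  · exact absurd (hgx.symm.trans h) (hK.single_ne_s d)
  · exact h

end Laws

end FlowOps

end FlowConfiguration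

/-! ### Cuts of dense linear orderings -/

section Cut

open Filter

variable {M N : Type} (P : M → Prop) (lt : M → M → Prop) (P' : N → Prop) (lt' : N → N → Prop)
  (A : M → N → Prop) (a : M)

/-- A pair of bounds for the cut of `a` in the domain of the relation `A`; each bound comes with
its counterpart in `N`, and `none` means that there is no bound. -/
def IsCut (o : Option (M × N) × Option (M × N)) : Prop :=
  (∀ p ∈ o.1, A p.1 p.2 ∧ P p.1 ∧ lt p.1 a) ∧ ∀ p ∈ o.2, A p.1 p.2 ∧ P p.1 ∧ lt a p.1

/-- The interval of `P` with bounds `o.1` and `o.2`. -/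
def cutSet (o : Option M × Option M) : Set M :=
  {z | P z ∧ (∀ p ∈ o.1, lt p z) ∧ ∀ p ∈ o.2, lt z p}

/-- The interval in the domain of `A` given by a pair of bounds. -/
abbrev cutLeft (o : Option (M × N) × Option (M × N)) : Set M :=
  cutSet P lt (o.1.map Prod.fst, o.2.map Prod.fst)

/-- The interval in the range of `A` given by a pair of bounds. -/
abbrev cutRight (o : Option (M × N) × Option (M × N)) : Set N :=
  cutSet P' lt' (o.1.map Prod.snd, o.2.map Prod.snd)

/-- The filter on `N` generated by the intervals that correspond, under the relation `A`, to the
intervals around `a`: a point near this filter fills the cut corresponding to that of `a`. -/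
def cutFilter : Filter N :=
  ⨅ o : {o : Option (M × N) × Option (M × N) // IsCut P lt A a o}, 𝓟 (cutRight P' lt' o.1)

variable {P lt P' lt' A a}

/-- The relation `A` is compatible with two dense linear orderings. -/
structure CutCompat (P : M → Prop) (lt : M → M → Prop) (P' : N → Prop) (lt' : N → N → Prop)
    (A : M → N → Prop) : Prop where
  dlo : IsDLOOn P lt
  dlo' : IsDLOOn P' lt'
  mem_iff : ∀ {x x'}, A x x' → (P x ↔ P' x')
  lt_iff : ∀ {x x' y y'}, A x x' → A y y' → P x → P y → (lt x y ↔ lt' x' y')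

namespace CutCompat

variable (h : CutCompat P lt P' lt' A)
include h

theorem diag : CutCompat P lt P lt (fun x y => x = y ∧ ∃ z, A x z) where
  dlo := h.dlo
  dlo' := h.dlo
  mem_iff := by rintro x _ ⟨rfl, _⟩; rfl
  lt_iff := by rintro x _ y _ ⟨rfl, _⟩ ⟨rfl, _⟩ _ _; rfl

theorem le_of_le {x y : M} {x' y' : N} (hx : A x x') (hy : A y y') (hPx : P x) (hPy : P y)
    (hxy : ¬ lt y x) : (x = y ∨ lt x y) ∧ (x' = y' ∨ lt' x' y') := by
  have h1 : ¬ lt' y' x' := by rwa [← h.lt_iff hy hx hPy hPx]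
  rcases h.dlo.linear x y hPx hPy with h2 | h2 | h2
  · exact ⟨.inr h2, .inr ((h.lt_iff hx hy hPx hPy).1 h2)⟩
  · refine ⟨.inl h2, ?_⟩
    rcases h.dlo'.linear x' y' ((h.mem_iff hx).1 hPx) ((h.mem_iff hy).1 hPy) with h3 | h3 | h3
    exacts [.inr h3, .inl h3, absurd h3 h1]
  · exact absurd h2 hxy

/-- Two intervals around the cut of `a` contain a common one, at the same time in `M` and in `N`. -/
theorem exists_cut_subset {o₁ o₂} (h₁ : IsCut P lt A a o₁) (h₂ : IsCut P lt A a o₂) :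
    ∃ o, IsCut P lt A a o ∧ (cutLeft P lt o ⊆ cutLeft P lt o₁ ∩ cutLeft P lt o₂) ∧
      cutRight P' lt' o ⊆ cutRight P' lt' o₁ ∩ cutRight P' lt' o₂ := by
  obtain ⟨l₁, u₁⟩ := o₁
  obtain ⟨l₂, u₂⟩ := o₂
  have hl : ∃ l : Option (M × N), (∀ p ∈ l, A p.1 p.2 ∧ P p.1 ∧ lt p.1 a) ∧
      (∀ z, P z → (∀ p ∈ l, lt p.1 z) → (∀ p ∈ l₁, lt p.1 z) ∧ ∀ p ∈ l₂, lt p.1 z) ∧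
      (∀ z, P' z → (∀ p ∈ l, lt' p.2 z) → (∀ p ∈ l₁, lt' p.2 z) ∧ ∀ p ∈ l₂, lt' p.2 z) := by
    rcases l₁ with _ | p
    · exact ⟨l₂, h₂.1, by simp, by simp⟩
    rcases l₂ with _ | q
    · exact ⟨some p, h₁.1, by simp, by simp⟩
    obtain ⟨hp, hPp, _⟩ := h₁.1 p rfl
    obtain ⟨hq, hPq, _⟩ := h₂.1 q rfl
    have hPp' := (h.mem_iff hp).1 hPp
    have hPq' := (h.mem_iff hq).1 hPq
    by_cases hpq : lt p.1 q.1
    · have hpq' := (h.lt_iff hp hq hPp hPq).1 hpq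
      refine ⟨some q, h₂.1, fun z hz hqz => ?_, fun z hz hqz => ?_⟩
      · simp only [Option.mem_def, Option.some.injEq, forall_eq'] at hqz ⊢
        exact ⟨h.dlo.trans _ _ _ hPp hPq hz hpq hqz, hqz⟩
      · simp only [Option.mem_def, Option.some.injEq, forall_eq'] at hqz ⊢
        exact ⟨h.dlo'.trans _ _ _ hPp' hPq' hz hpq' hqz, hqz⟩
    · obtain ⟨h3, h3'⟩ := h.le_of_le hq hp hPq hPp hpq
      refine ⟨some p, h₁.1, fun z hz hpz => ?_, fun z hz hpz => ?_⟩
      · simp only [Option.mem_def, Option.some.injEq, forall_eq'] at hpz ⊢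
        refine ⟨hpz, ?_⟩
        rcases h3 with h3 | h3
        exacts [h3 ▸ hpz, h.dlo.trans _ _ _ hPq hPp hz h3 hpz]
      · simp only [Option.mem_def, Option.some.injEq, forall_eq'] at hpz ⊢
        refine ⟨hpz, ?_⟩
        rcases h3' with h3 | h3
        exacts [h3 ▸ hpz, h.dlo'.trans _ _ _ hPq' hPp' hz h3 hpz]
  have hu : ∃ u : Option (M × N), (∀ p ∈ u, A p.1 p.2 ∧ P p.1 ∧ lt a p.1) ∧
      (∀ z, P z → (∀ p ∈ u, lt z p.1) → (∀ p ∈ u₁, lt z p.1) ∧ ∀ p ∈ u₂, lt z p.1) ∧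
      (∀ z, P' z → (∀ p ∈ u, lt' z p.2) → (∀ p ∈ u₁, lt' z p.2) ∧ ∀ p ∈ u₂, lt' z p.2) := by
    rcases u₁ with _ | p
    · exact ⟨u₂, h₂.2, by simp, by simp⟩
    rcases u₂ with _ | q
    · exact ⟨some p, h₁.2, by simp, by simp⟩
    obtain ⟨hp, hPp, _⟩ := h₁.2 p rfl
    obtain ⟨hq, hPq, _⟩ := h₂.2 q rfl
    have hPp' := (h.mem_iff hp).1 hPp
    have hPq' := (h.mem_iff hq).1 hPq
    by_cases hpq : lt q.1 p.1
    · have hpq' := (h.lt_iff hq hp hPq hPp).1 hpq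
      refine ⟨some q, h₂.2, fun z hz hqz => ?_, fun z hz hqz => ?_⟩
      · simp only [Option.mem_def, Option.some.injEq, forall_eq'] at hqz ⊢
        exact ⟨h.dlo.trans _ _ _ hz hPq hPp hqz hpq, hqz⟩
      · simp only [Option.mem_def, Option.some.injEq, forall_eq'] at hqz ⊢
        exact ⟨h.dlo'.trans _ _ _ hz hPq' hPp' hqz hpq', hqz⟩
    · obtain ⟨h3, h3'⟩ := h.le_of_le hp hq hPp hPq hpq
      refine ⟨some p, h₁.2, fun z hz hpz => ?_, fun z hz hpz => ?_⟩
      · simp only [Option.mem_def, Option.some.injEq, forall_eq'] at hpz ⊢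
        refine ⟨hpz, ?_⟩
        rcases h3 with h3 | h3
        exacts [h3 ▸ hpz, h.dlo.trans _ _ _ hz hPp hPq hpz h3]
      · simp only [Option.mem_def, Option.some.injEq, forall_eq'] at hpz ⊢
        refine ⟨hpz, ?_⟩
        rcases h3' with h3 | h3
        exacts [h3 ▸ hpz, h.dlo'.trans _ _ _ hz hPp' hPq' hpz h3]
  obtain ⟨l, hl, hl1, hl2⟩ := hl
  obtain ⟨u, hu, hu1, hu2⟩ := hu
  have e : ∀ {X : Type} (f : M × N → X) (o : Option (M × N)) (Q : X → Prop),
      (∀ p ∈ o.map f, Q p) ↔ ∀ p ∈ o, Q (f p) := by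
    intro X f o Q
    cases o <;> simp
  refine ⟨(l, u), ⟨hl, hu⟩, fun z hz => ?_, fun z hz => ?_⟩
  · simp only [cutSet, e, Set.mem_inter_iff, Set.mem_ofPred_eq] at hz ⊢
    have h3 := hl1 z hz.1 hz.2.1
    have h4 := hu1 z hz.1 hz.2.2
    exact ⟨⟨hz.1, h3.1, h4.1⟩, hz.1, h3.2, h4.2⟩
  · simp only [cutSet, e, Set.mem_inter_iff, Set.mem_ofPred_eq] at hz ⊢
    have h3 := hl2 z hz.1 hz.2.1
    have h4 := hu2 z hz.1 hz.2.2
    exact ⟨⟨hz.1, h3.1, h4.1⟩, hz.1, h3.2, h4.2⟩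

theorem mem_cutFilter {s : Set N} :
    s ∈ cutFilter P lt P' lt' A a ↔ ∃ o, IsCut P lt A a o ∧ cutRight P' lt' o ⊆ s := by
  have hne : Nonempty {o : Option (M × N) × Option (M × N) // IsCut P lt A a o} :=
    ⟨⟨(none, none), by simp [IsCut]⟩⟩
  rw [cutFilter, mem_iInf_of_directed]
  · simp
  · rintro ⟨o₁, h₁⟩ ⟨o₂, h₂⟩
    obtain ⟨o, ho, _, ho2⟩ := h.exists_cut_subset h₁ h₂
    exact ⟨⟨o, ho⟩, principal_mono.2 (ho2.trans Set.inter_subset_left),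
      principal_mono.2 (ho2.trans Set.inter_subset_right)⟩

theorem neBot (ha : P a) : (cutFilter P lt P' lt' A a).NeBot := by
  rw [← forall_mem_nonempty_iff_neBot]
  intro s hs
  obtain ⟨⟨l, u⟩, ho, hos⟩ := h.mem_cutFilter.1 hs
  refine Set.Nonempty.mono hos ?_
  obtain ⟨hl, hu⟩ := ho
  rcases l with _ | p <;> rcases u with _ | q
  · obtain ⟨z, hz⟩ := h.dlo'.nonempty
    exact ⟨z, by simpa [cutSet] using hz⟩
  · obtain ⟨hq, hPq, _⟩ := hu q rfl
    obtain ⟨z, hz⟩ := h.dlo'.no_min q.2 ((h.mem_iff hq).1 hPq)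
    exact ⟨z, by simpa [cutSet] using hz⟩
  · obtain ⟨hp, hPp, _⟩ := hl p rfl
    obtain ⟨z, hz⟩ := h.dlo'.no_max p.2 ((h.mem_iff hp).1 hPp)
    exact ⟨z, by simpa [cutSet] using hz⟩
  · obtain ⟨hp, hPp, hpa⟩ := hl p rfl
    obtain ⟨hq, hPq, haq⟩ := hu q rfl
    have := h.dlo.trans _ _ _ hPp ha hPq hpa haq
    obtain ⟨z, hz⟩ := h.dlo'.dense p.2 q.2 ((h.mem_iff hp).1 hPp) ((h.mem_iff hq).1 hPq)
      ((h.lt_iff hp hq hPp hPq).1 this)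
    exact ⟨z, by simpa [cutSet] using hz⟩

theorem eventually_mem : ∀ᶠ z in cutFilter P lt P' lt' A a, P' z :=
  h.mem_cutFilter.2 ⟨(none, none), by simp [IsCut], fun z hz => hz.1⟩

theorem eventually_gt {x : M} {x' : N} (hx : A x x') (hPx : P x) (hxa : lt x a) :
    ∀ᶠ z in cutFilter P lt P' lt' A a, lt' x' z :=
  h.mem_cutFilter.2 ⟨(some (x, x'), none), by simp [IsCut, hx, hPx, hxa],
    fun z hz => hz.2.1 _ rfl⟩

theorem eventually_lt {x : M} {x' : N} (hx : A x x') (hPx : P x) (hxa : lt a x) :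
    ∀ᶠ z in cutFilter P lt P' lt' A a, lt' z x' :=
  h.mem_cutFilter.2 ⟨(none, some (x, x')), by simp [IsCut, hx, hPx, hxa],
    fun z hz => hz.2.2 _ rfl⟩

omit h in
/-- A map tends to the filter of a cut if its values eventually respect each bound of the cut. -/
theorem tendsto {X : Type} {F : Filter X} {ζ : X → N} (h1 : ∀ᶠ z in F, P' (ζ z))
    (h2 : ∀ t t', A t t' → P t → lt t a → ∀ᶠ z in F, lt' t' (ζ z))
    (h3 : ∀ t t', A t t' → P t → lt a t → ∀ᶠ z in F, lt' (ζ z) t') :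
    Tendsto ζ F (cutFilter P lt P' lt' A a) := by
  refine tendsto_iInf.2 fun ⟨⟨l, u⟩, hl, hu⟩ => tendsto_principal.2 ?_
  have hl' : ∀ᶠ z in F, ∀ p ∈ l.map Prod.snd, lt' p (ζ z) := by
    rcases l with _ | p
    · simp
    · obtain ⟨hp, hPp, hpa⟩ := hl p rfl
      simpa using h2 _ _ hp hPp hpa
  have hu' : ∀ᶠ z in F, ∀ p ∈ u.map Prod.snd, lt' (ζ z) p := by
    rcases u with _ | p
    · simp
    · obtain ⟨hp, hPp, hpa⟩ := hu p rfl
      simpa using h3 _ _ hp hPp hpa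
  filter_upwards [h1, hl', hu'] with z h4 h5 h6
  exact ⟨h4, h5, h6⟩

/-- Two properties that hold near the cut of `a`, one in `M` and one in `N`, hold on intervals
with corresponding bounds. -/
theorem exists_cut {s : Set M} {s' : Set N}
    (hs : s ∈ cutFilter P lt P lt (fun x y => x = y ∧ ∃ z, A x z) a)
    (hs' : s' ∈ cutFilter P lt P' lt' A a) :
    ∃ o, IsCut P lt A a o ∧ cutLeft P lt o ⊆ s ∧ cutRight P' lt' o ⊆ s' := by
  obtain ⟨o₂, ho₂, hs₂⟩ := h.mem_cutFilter.1 hs'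
  obtain ⟨⟨l, u⟩, ho₁, hs₁⟩ := h.diag.mem_cutFilter.1 hs
  have hl : ∃ l' : Option (M × N), (∀ p ∈ l', A p.1 p.2 ∧ P p.1 ∧ lt p.1 a) ∧
      l'.map Prod.fst = l.map Prod.snd := by
    rcases l with _ | ⟨p, q⟩
    · exact ⟨none, by simp, rfl⟩
    · obtain ⟨⟨hpq, z, hz⟩, h1, h2⟩ := ho₁.1 _ rfl
      dsimp only at hpq hz
      subst hpq
      exact ⟨some (p, z), by rintro _ ⟨⟩; exact ⟨hz, h1, h2⟩, rfl⟩
  have hu : ∃ u' : Option (M × N), (∀ p ∈ u', A p.1 p.2 ∧ P p.1 ∧ lt a p.1) ∧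
      u'.map Prod.fst = u.map Prod.snd := by
    rcases u with _ | ⟨p, q⟩
    · exact ⟨none, by simp, rfl⟩
    · obtain ⟨⟨hpq, z, hz⟩, h1, h2⟩ := ho₁.2 _ rfl
      dsimp only at hpq hz
      subst hpq
      exact ⟨some (p, z), by rintro _ ⟨⟩; exact ⟨hz, h1, h2⟩, rfl⟩
  obtain ⟨l', hl, hl'⟩ := hl
  obtain ⟨u', hu, hu'⟩ := hu
  obtain ⟨o, ho, h1, h2⟩ := h.exists_cut_subset (o₁ := (l', u')) ⟨hl, hu⟩ ho₂
  refine ⟨o, ho, h1.trans (Set.inter_subset_left.trans ?_),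
    h2.trans (Set.inter_subset_right.trans hs₂)⟩
  rw [cutLeft, hl', hu']
  exact hs₁

end CutCompat

end Cut

/-! ### Partial isomorphisms and generic points of sections -/

namespace DulacFlowConfiguration

open FlowConfiguration Filter

variable {Ψ : DulacFlowConfiguration} {M N : Type}

/-- The graph `A` of an isomorphism between a substructure of `M` and a substructure of `N`. -/
structure PartIso (K : Ops Ψ M) (K' : Ops Ψ N) (A : M → N → Prop) : Prop where
  prog : ∀ g {x x'}, A x x' → A (K.prog g x) (K'.prog g x')
  s : A K.s K'.s
  single : ∀ c, A (K.single c) (K'.single c)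
  e : ∀ C, A (K.e C) (K'.e C)
  lo : ∀ g C, A (K.lo g C) (K'.lo g C)
  hi : ∀ g C, A (K.hi g C) (K'.hi g C)
  gamma : ∀ C j, A (K.gamma C j) (K'.gamma C j)
  eq_iff : ∀ {x x' y y'}, A x x' → A y y' → (x = y ↔ x' = y')
  cell_iff : ∀ C {x x'}, A x x' → (K.cell C x ↔ K'.cell C x')
  E_iff : ∀ C {x x'}, A x x' → (K.E C x ↔ K'.E C x')
  lt_iff : ∀ C {x x' y y'}, A x x' → A y y' → (K.lt C x y ↔ K'.lt C x' y')
  rel_iff : ∀ G {x x' y y'}, A x x' → A y y' → (K.rel G x y ↔ K'.rel G x' y')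

/-- A point of a section is generic if it is not in the domain of the partial isomorphism. -/
def Gen (K : Ops Ψ M) (A : M → N → Prop) (C : Ψ.flow.Section₁) (x : M) : Prop :=
  K.sec C x ∧ ∀ x', ¬ A x x'

/-- The filter of the cut of a generic point of a section. -/
abbrev secFilter (K : Ops Ψ M) (K' : Ops Ψ N) (A : M → N → Prop) (C : Ψ.flow.Section₁) (x : M) :
    Filter N :=
  cutFilter (K.sec C) (K.lt C.cell) (K'.sec C) (K'.lt C.cell) A x

namespace PartIso

variable {K : Ops Ψ M} {K' : Ops Ψ N} {A : M → N → Prop}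
variable (hA : PartIso K K' A)
include hA

theorem diag : PartIso K K (fun x y => x = y ∧ ∃ z, A x z) where
  prog := by rintro g x _ ⟨rfl, z, hz⟩; exact ⟨rfl, _, hA.prog g hz⟩
  s := ⟨rfl, _, hA.s⟩
  single c := ⟨rfl, _, hA.single c⟩
  e c := ⟨rfl, _, hA.e c⟩
  lo g c := ⟨rfl, _, hA.lo g c⟩
  hi g c := ⟨rfl, _, hA.hi g c⟩
  gamma C j := ⟨rfl, _, hA.gamma C j⟩
  eq_iff := by rintro x _ y _ ⟨rfl, _⟩ ⟨rfl, _⟩; rfl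
  cell_iff := by rintro C x _ ⟨rfl, _⟩; rfl
  E_iff := by rintro C x _ ⟨rfl, _⟩; rfl
  lt_iff := by rintro C x _ y _ ⟨rfl, _⟩ ⟨rfl, _⟩; rfl
  rel_iff := by rintro C x _ y _ ⟨rfl, _⟩ ⟨rfl, _⟩; rfl

omit hA in
theorem gen_diag {C : Ψ.flow.Section₁} {x : M} (hx : Gen K A C x) :
    Gen K (fun x y => x = y ∧ ∃ z, A x z) C x :=
  ⟨hx.1, fun _ ⟨_, z, hz⟩ => hx.2 z hz⟩

theorem pt (o : Option Ψ.flow.Single) : A (K.pt o) (K'.pt o) := by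
  cases o
  exacts [hA.s, hA.single _]

theorem mn (C : Ψ.flow.Cell) : A (K.mn C) (K'.mn C) := hA.pt _

theorem mx (C : Ψ.flow.Cell) : A (K.mx C) (K'.mx C) := hA.pt _

theorem sec_iff (C : Ψ.flow.Section₁) {x : M} {x' : N} (h : A x x') : K.sec C x ↔ K'.sec C x' := by
  rcases C with C | C
  exacts [hA.cell_iff _ h, hA.E_iff _ h]

theorem bar_iff (C : Ψ.flow.Section₁) {x : M} {x' : N} (h : A x x') : K.bar C x ↔ K'.bar C x' := by
  unfold FlowOps.bar
  rw [hA.sec_iff C h, hA.eq_iff h (hA.mn _), hA.eq_iff h (hA.mx _)]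

variable (hK : K.Laws) (hK' : K'.Laws)
include hK hK'

theorem phi_iff (C : Ψ.flow.Opn) (g : Dir) {x y : M} {x' y' : N} (hx : A x x') (hy : A y y') :
    K.phi C g x y ↔ K'.phi C g x' y' := by
  by_cases h : K.cell (opn C) x ∧ ¬ K.E C x
  · have h' : K'.cell (opn C) x' ∧ ¬ K'.E C x' := by
      rwa [← hA.cell_iff _ hx, ← hA.E_iff _ hx]
    rw [hK.phi_iff h.1 h.2, hK'.phi_iff h'.1 h'.2, hA.E_iff C hy, hA.eq_iff (hA.prog g hx) hy]
  · have h' : ¬ (K'.cell (opn C) x' ∧ ¬ K'.E C x') := by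
      rwa [← hA.cell_iff _ hx, ← hA.E_iff _ hx]
    exact ⟨fun h1 => absurd ⟨(phi_cell h1).1, (phi_cell h1).2.1⟩ h,
      fun h1 => absurd ⟨(phi_cell h1).1, (phi_cell h1).2.1⟩ h'⟩

theorem leaf_iff (C : Ψ.flow.Opn) {x y : M} {x' y' : N} (hx : A x x') (hy : A y y') :
    K.leaf C x y ↔ K'.leaf C x' y' := by
  unfold FlowOps.leaf
  rw [hA.E_iff C hy, hA.phi_iff hK hK' C .b hx hy, hA.phi_iff hK hK' C .f hx hy, hA.eq_iff hx hy]

theorem compat (C : Ψ.flow.Section₁) :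
    CutCompat (K.sec C) (K.lt C.cell) (K'.sec C) (K'.lt C.cell) A where
  dlo := hK.sec_dlo C
  dlo' := hK'.sec_dlo C
  mem_iff h := hA.sec_iff C h
  lt_iff hx hy _ _ := hA.lt_iff _ hx hy

/-- A point of an open cell in the domain of the partial isomorphism lies in the leaf of a point of
that domain. -/
theorem exists_leaf {O : Ψ.flow.Opn} {t : M} {t' : N} (ht : A t t') (htc : K.cell (opn O) t) :
    ∃ u u', A u u' ∧ K.leaf O t u ∧ K'.leaf O t' u' := by
  by_cases hs : K.E O t
  · exact ⟨t, t', ht, ⟨hs, .inr rfl⟩, (hA.E_iff O ht).1 hs, .inr rfl⟩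
  · obtain ⟨g, hg⟩ := hK.exists_phi_prog htc hs
    have hl := FlowOps.Laws.leaf_of_phi hg
    exact ⟨_, _, hA.prog g ht, hl, (hA.leaf_iff hK hK' O ht (hA.prog g ht)).1 hl⟩

omit hA hK hK' in
/-- Every point of the cell `C` in the domain of the partial isomorphism lies strictly on one side
of `x`, and near `F` its image lies on the same side. -/
def Separated (K : Ops Ψ M) (K' : Ops Ψ N) (A : M → N → Prop) (F : Filter N) (C : Ψ.flow.Cell)
    (x : M) : Prop :=
  ∀ t t', A t t' → K.cell C t →
    (K.lt C t x ∧ ∀ᶠ z in F, K'.lt C t' z) ∨ (K.lt C x t ∧ ∀ᶠ z in F, K'.lt C z t')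

section Separated

variable {F : Filter N} {C : Ψ.flow.Cell} {x : M} (hs : Separated K K' A F C x)
  (hxc : K.cell C x) (hF : ∀ᶠ z in F, K'.cell C z)
include hs hxc hF

theorem Separated.lt_iff {t : M} {t' : N} (ht : A t t') :
    ∀ᶠ z in F, K'.lt C t' z ↔ K.lt C t x := by
  by_cases htc : K.cell C t
  · have htc' := (hA.cell_iff _ ht).1 htc
    rcases hs t t' ht htc with ⟨h1, h2⟩ | ⟨h1, h2⟩
    · filter_upwards [h2] with z h3
      exact ⟨fun _ => h1, fun _ => h3⟩
    · filter_upwards [h2, hF] with z h3 h4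
      exact ⟨fun h => absurd h3 (hK'.lt_asymm htc' h4 h),
        fun h => absurd h1 (hK.lt_asymm htc hxc h)⟩
  · have htc' := (hA.cell_iff _ ht).not.1 htc
    filter_upwards [hF] with z h4
    have e : K.lt C t x ↔ t = K.mn C :=
      ⟨fun h => (hK.lt_left h).resolve_left htc, fun h => h ▸ hK.mn_lt _ _ hxc⟩
    have e' : K'.lt C t' z ↔ t' = K'.mn C :=
      ⟨fun h => (hK'.lt_left h).resolve_left htc', fun h => h ▸ hK'.mn_lt _ _ h4⟩
    rw [e, e', hA.eq_iff ht (hA.mn _)]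

theorem Separated.gt_iff {t : M} {t' : N} (ht : A t t') :
    ∀ᶠ z in F, K'.lt C z t' ↔ K.lt C x t := by
  by_cases htc : K.cell C t
  · have htc' := (hA.cell_iff _ ht).1 htc
    rcases hs t t' ht htc with ⟨h1, h2⟩ | ⟨h1, h2⟩
    · filter_upwards [h2, hF] with z h3 h4
      exact ⟨fun h => absurd h (hK'.lt_asymm htc' h4 h3),
        fun h => absurd h (hK.lt_asymm htc hxc h1)⟩
    · filter_upwards [h2] with z h3
      exact ⟨fun _ => h1, fun _ => h3⟩
  · have htc' := (hA.cell_iff _ ht).not.1 htc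
    filter_upwards [hF] with z h4
    have e : K.lt C x t ↔ t = K.mx C :=
      ⟨fun h => (hK.lt_right h).resolve_left htc, fun h => h ▸ hK.lt_mx _ _ hxc⟩
    have e' : K'.lt C z t' ↔ t' = K'.mx C :=
      ⟨fun h => (hK'.lt_right h).resolve_left htc', fun h => h ▸ hK'.lt_mx _ _ h4⟩
    rw [e, e', hA.eq_iff ht (hA.mx _)]

omit hK hxc in
theorem Separated.ne {t : M} {t' : N} (ht : A t t') : ∀ᶠ z in F, z ≠ t' := by
  by_cases htc : K.cell C t
  · rcases hs t t' ht htc with ⟨h1, h2⟩ | ⟨h1, h2⟩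
    · filter_upwards [h2] with z h3 h4
      exact hK'.irrefl _ _ (h4 ▸ h3)
    · filter_upwards [h2] with z h3 h4
      exact hK'.irrefl _ _ (h4 ▸ h3)
  · filter_upwards [hF] with z h3 h4
    exact htc ((hA.cell_iff _ ht).2 (h4 ▸ h3))

end Separated

variable {C : Ψ.flow.Section₁} {x : M} (hx : Gen K A C x)
include hx

/-- Points of an open cell outside the section are compared with a generic point of the section
through the leaves in which they lie. -/
theorem separated_secFilter : Separated K K' A (secFilter K K' A C x) C.cell x := by
  intro t t' ht htc
  have hc := hA.compat hK hK' C
  have key : ∀ {u u'}, A u u' → K.sec C u →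
      (K.lt C.cell u x ∧ ∀ᶠ z in secFilter K K' A C x, K'.lt C.cell u' z) ∨
      (K.lt C.cell x u ∧ ∀ᶠ z in secFilter K K' A C x, K'.lt C.cell z u') := by
    intro u u' hu hs
    rcases hc.dlo.linear u x hs hx.1 with h | rfl | h
    · exact .inl ⟨h, hc.eventually_gt hu hs h⟩
    · exact absurd hu (hx.2 _)
    · exact .inr ⟨h, hc.eventually_lt hu hs h⟩
  rcases C with D | O
  · exact key ht htc
  obtain ⟨u, u', hu, hl, hl'⟩ := hA.exists_leaf hK hK' ht htc
  rcases key hu hl.1 with ⟨h1, h2⟩ | ⟨h1, h2⟩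
  · refine .inl ⟨hK.lt_of_leaf hl ⟨hx.1, .inr rfl⟩ h1, ?_⟩
    filter_upwards [h2, hc.eventually_mem] with z h3 h4
    exact hK'.lt_of_leaf hl' ⟨h4, .inr rfl⟩ h3
  · refine .inr ⟨hK.lt_of_leaf ⟨hx.1, .inr rfl⟩ hl h1, ?_⟩
    filter_upwards [h2, hc.eventually_mem] with z h3 h4
    exact hK'.lt_of_leaf ⟨h4, .inr rfl⟩ hl' h3

omit hx in
theorem eventually_cell : ∀ᶠ z in secFilter K K' A C x, K'.cell C.cell z :=
  (hA.compat hK hK' C).eventually_mem.mono fun _ hz => hK'.sec_cell hz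

theorem eventually_lt_iff {t : M} {t' : N} (ht : A t t') :
    ∀ᶠ z in secFilter K K' A C x, K'.lt C.cell t' z ↔ K.lt C.cell t x :=
  Separated.lt_iff hA hK hK' (hA.separated_secFilter hK hK' hx) (hK.sec_cell hx.1)
    (hA.eventually_cell hK hK') ht

theorem eventually_gt_iff {t : M} {t' : N} (ht : A t t') :
    ∀ᶠ z in secFilter K K' A C x, K'.lt C.cell z t' ↔ K.lt C.cell x t :=
  Separated.gt_iff hA hK hK' (hA.separated_secFilter hK hK' hx) (hK.sec_cell hx.1)
    (hA.eventually_cell hK hK') ht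

theorem eventually_ne {t : M} {t' : N} (ht : A t t') :
    ∀ᶠ z in secFilter K K' A C x, z ≠ t' :=
  Separated.ne hA hK' (hA.separated_secFilter hK hK' hx) (hA.eventually_cell hK hK') ht

/-- A progression map sends a generic point of a section to `s`, and then points that fill the
corresponding cut as well, or to a generic point of a section, whose cut is then filled by the
images of the points that fill the corresponding cut. -/
theorem prog_gen (g : Dir) :
    (K.prog g x = K.s ∧ ∀ᶠ z in secFilter K K' A C x, K'.prog g z = K'.s) ∨
    ∃ D, Gen K A D (K.prog g x) ∧
      Tendsto (K'.prog g) (secFilter K K' A C x) (secFilter K K' A D (K.prog g x)) ∧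
      K.prog g.opp (K.prog g x) = x ∧
      ∀ᶠ z in secFilter K K' A C x, K'.prog g.opp (K'.prog g z) = z := by
  have hc := hA.compat hK hK' C
  rcases C with D | O
  · right
    obtain ⟨O, hO⟩ := hK.adj_trans D g
    have hxD : K.cell (trans D) x := hx.1
    have hinv := hK.trans_inv D g x hxD
    have hE : K.E O (K.prog g x) := by
      have := hK.trans_leafE D g x hxD
      rwa [hO] at this
    have hO' : Ψ.flow.adj g.opp.opp (.inl D) = .inl O := by rw [Dir.opp_opp, hO]
    have mono := hK.trans_mono D g
    have mono' := hK'.trans_mono D g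
    have im := hK.mem_image_iff D g
    have im' := hK'.mem_image_iff D g
    have lo := hK.lo_mem D g
    have hi := hK.hi_mem D g
    have hE' := hK'.trans_leafE D g
    rw [hO] at mono mono' im im' lo hi hE'
    change ∀ z, K'.cell (trans D) z → K'.E O (K'.prog g z) at hE'
    change (K.E O _ ∨ _ = K.mn (opn O)) ∨ _ = K.mx (opn O) at lo hi
    have imx := (im _ hE).1 (hinv.symm ▸ hxD)
    have hyc := hK.E_cell O _ hE
    have imz : ∀ z, K'.cell (trans D) z → K'.lt (opn O) (K'.lo g D) (K'.prog g z) ∧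
        K'.lt (opn O) (K'.prog g z) (K'.hi g D) := fun z hz =>
      (im' _ (hE' z hz)).1 ((hK'.trans_inv D g z hz).symm ▸ hz)
    have hev : ∀ᶠ z in secFilter K K' A (.inl D) x, K'.cell (trans D) z := hc.eventually_mem
    -- a bound of the cut of the image either has a preimage in `D`, which is a bound of the cut of
    -- `x`, or it lies outside the image of `D`, and then all values `g(z)` are on the same side
    refine ⟨.inr O, ⟨hE, fun y' hy' => hx.2 _ (hinv ▸ hA.prog g.opp hy')⟩,
      CutCompat.tendsto ?_ ?_ ?_, hinv, ?_⟩
    · filter_upwards [hev] with z hz using hE' z hz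
    · intro t t' ht hPt hlt
      have hPt' := (hA.E_iff O ht).1 hPt
      have htc := hK.E_cell O t hPt
      by_cases hc1 : K.cell (trans D) (K.prog g.opp t)
      · have hc1' := (hA.cell_iff _ (hA.prog g.opp ht)).1 hc1
        have i1 := hK.E_inv hPt hO' hc1
        have i1' := hK'.E_inv hPt' hO' hc1'
        rw [Dir.opp_opp] at i1 i1'
        have h2 : K.lt (trans D) (K.prog g.opp t) x := by
          rw [mono _ _ hc1 hxD, i1]; exact hlt
        filter_upwards [hc.eventually_gt (hA.prog g.opp ht) hc1 h2, hev] with z h3 hz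
        have h3 := (mono' _ _ hc1' hz).1 h3
        rwa [i1'] at h3
      · rw [im t hPt] at hc1
        have h2 := hK.lt_trans htc hyc hlt imx.2
        have h3 : ¬ K.lt (opn O) (K.lo g D) t := fun h => hc1 ⟨h, h2⟩
        have hlo : K.E O (K.lo g D) := by
          rcases lo with (h | h) | h
          · exact h
          · exact absurd (h ▸ hK.mn_lt _ _ htc) h3
          · rcases hK.lt_left imx.1 with h4 | h4
            · exact absurd h (hK.ne_mx h4)
            · exact absurd (h4 ▸ hK.mn_lt _ _ htc) h3
        have hloc' := hK'.E_cell O _ ((hA.E_iff O (hA.lo g D)).1 hlo)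
        have htc' := hK'.E_cell O _ hPt'
        filter_upwards [hev] with z hz
        have h5 := (imz z hz).1
        rcases (hK.E_dlo O).linear _ _ hlo hPt with h6 | h6 | h6
        · exact absurd h6 h3
        · rwa [(hA.eq_iff (hA.lo g D) ht).1 h6] at h5
        · exact hK'.lt_trans htc' hloc' ((hA.lt_iff _ ht (hA.lo g D)).1 h6) h5
    · intro t t' ht hPt hlt
      have hPt' := (hA.E_iff O ht).1 hPt
      have htc := hK.E_cell O t hPt
      by_cases hc1 : K.cell (trans D) (K.prog g.opp t)
      · have hc1' := (hA.cell_iff _ (hA.prog g.opp ht)).1 hc1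
        have i1 := hK.E_inv hPt hO' hc1
        have i1' := hK'.E_inv hPt' hO' hc1'
        rw [Dir.opp_opp] at i1 i1'
        have h2 : K.lt (trans D) x (K.prog g.opp t) := by
          rw [mono _ _ hxD hc1, i1]; exact hlt
        filter_upwards [hc.eventually_lt (hA.prog g.opp ht) hc1 h2, hev] with z h3 hz
        have h3 := (mono' _ _ hz hc1').1 h3
        rwa [i1'] at h3
      · rw [im t hPt] at hc1
        have h2 := hK.lt_trans' hyc htc imx.1 hlt
        have h3 : ¬ K.lt (opn O) t (K.hi g D) := fun h => hc1 ⟨h2, h⟩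
        have hhi : K.E O (K.hi g D) := by
          rcases hi with (h | h) | h
          · exact h
          · rcases hK.lt_right imx.2 with h4 | h4
            · exact absurd h (hK.ne_mn h4)
            · exact absurd (h4 ▸ hK.lt_mx _ _ htc) h3
          · exact absurd (h ▸ hK.lt_mx _ _ htc) h3
        have hhic' := hK'.E_cell O _ ((hA.E_iff O (hA.hi g D)).1 hhi)
        have htc' := hK'.E_cell O _ hPt'
        filter_upwards [hev] with z hz
        have h5 := (imz z hz).2
        rcases (hK.E_dlo O).linear _ _ hhi hPt with h6 | h6 | h6
        · exact hK'.lt_trans' hhic' htc' h5 ((hA.lt_iff _ (hA.hi g D) ht).1 h6)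
        · rwa [(hA.eq_iff (hA.hi g D) ht).1 h6] at h5
        · exact absurd h6 h3
    · filter_upwards [hev] with z hz using hK'.trans_inv D g z hz
  · have hxE : K.E O x := hx.1
    have hev : ∀ᶠ z in secFilter K K' A (.inr O) x, K'.E O z := hc.eventually_mem
    -- whether the image is in a transverse cell is decided by the constants of that cell
    have him : ∀ D, Ψ.flow.adj g.opp (.inl D) = .inl O →
        ∀ᶠ z in secFilter K K' A (.inr O) x,
          K'.cell (trans D) (K'.prog g z) ↔ K.cell (trans D) (K.prog g x) := by
      intro D hD
      have im := hK.mem_image_iff D g.opp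
      have im' := hK'.mem_image_iff D g.opp
      rw [hD] at im im'
      rw [Dir.opp_opp] at im im'
      filter_upwards [hev, hA.eventually_lt_iff hK hK' hx (hA.lo g.opp D),
        hA.eventually_gt_iff hK hK' hx (hA.hi g.opp D)] with z hz h1 h2
      rw [im x hxE, im' z hz]
      exact and_congr h1 h2
    rcases hK.E_prog O g x hxE with h | ⟨D, hD, h⟩ | ⟨d, hd, h⟩
    · left
      refine ⟨h, ?_⟩
      have e1 : ∀ᶠ z in secFilter K K' A (.inr O) x, ∀ D, Ψ.flow.adj g.opp (.inl D) = .inl O →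
          ¬ K'.cell (trans D) (K'.prog g z) := by
        refine eventually_all.2 fun D => ?_
        by_cases hD : Ψ.flow.adj g.opp (.inl D) = .inl O
        · filter_upwards [him D hD] with z hz _ hcon
          exact hK.s_cell _ (h ▸ hz.1 hcon)
        · exact Eventually.of_forall fun z hz => absurd hz hD
      have e2 : ∀ᶠ z in secFilter K K' A (.inr O) x, ∀ d, z ≠ K'.prog g.opp (K'.single d) :=
        eventually_all.2 fun d => hA.eventually_ne hK hK' hx (hA.prog g.opp (hA.single d))
      filter_upwards [hev, e1, e2] with z hz h1 h2
      rcases hK'.E_prog O g z hz with h3 | ⟨D, hD, h3⟩ | ⟨d, hd, h3⟩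
      · exact h3
      · exact absurd h3 (h1 D hD)
      · exact absurd (hK'.E_eq_of_single hz hd h3) (h2 d)
    · right
      have hinv := hK.E_inv hxE hD h
      have hev' : ∀ᶠ z in secFilter K K' A (.inr O) x, K'.cell (trans D) (K'.prog g z) := by
        filter_upwards [him D hD] with z hz using hz.2 h
      have mono := hK.trans_mono D g.opp
      have mono' := hK'.trans_mono D g.opp
      have hE := hK.trans_leafE D g.opp
      rw [hD] at mono mono' hE
      change ∀ z, K.cell (trans D) z → K.E O (K.prog g.opp z) at hE
      refine ⟨.inl D, ⟨h, fun y' hy' => hx.2 _ (hinv ▸ hA.prog g.opp hy')⟩,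
        CutCompat.tendsto hev' ?_ ?_, hinv, ?_⟩
      · intro t t' ht hPt hlt
        have hPt' := (hA.cell_iff _ ht).1 hPt
        have h2 := (mono _ _ hPt h).1 hlt
        rw [hinv] at h2
        filter_upwards [hc.eventually_gt (hA.prog g.opp ht) (hE t hPt) h2, hev, hev']
          with z h3 h4 h5
        refine (mono' _ _ hPt' h5).2 ?_
        rw [hK'.E_inv h4 hD h5]
        exact h3
      · intro t t' ht hPt hlt
        have hPt' := (hA.cell_iff _ ht).1 hPt
        have h2 := (mono _ _ h hPt).1 hlt
        rw [hinv] at h2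
        filter_upwards [hc.eventually_lt (hA.prog g.opp ht) (hE t hPt) h2, hev, hev']
          with z h3 h4 h5
        refine (mono' _ _ h5 hPt').2 ?_
        rw [hK'.E_inv h4 hD h5]
        exact h3
      · filter_upwards [hev, hev'] with z h4 h5 using hK'.E_inv h4 hD h5
    · have := hK.E_eq_of_single hxE hd h
      exact absurd (this ▸ hA.prog g.opp (hA.single d)) (hx.2 _)

end PartIso

end DulacFlowConfiguration

/-! ### Local constancy of the properties that define the new predicates -/

namespace DulacFlowConfiguration

open FlowConfiguration Filter

variable {Ψ : DulacFlowConfiguration} {M N : Type}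

theorem Ops.atPt_sec {K : Ops Ψ M} {G : Rel Ψ 2} {z : M} (h : K.atPt G z) :
    K.sec G.sec z ∧ K.sec G.sec ((K.prog G.dir)^[G.exp] z) := by
  cases G
  · refine ⟨h.1, ?_⟩
    change K.sec _ ((K.prog .f)^[Ψ.flow.N] z)
    rw [h.2]
    exact h.1
  · exact ⟨h.1, h.2.1⟩
  · exact ⟨h.1, h.2.1⟩

/-- A new predicate determines the property that defines it. -/
theorem Ops.Laws.rel_self {K : Ops Ψ M} (hK : K.Laws) {G : Rel Ψ 2} {z : M}
    (hz : K.cell G.sec.cell z) : K.rel G z z ↔ K.atPt G z := by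
  rw [hK.rel_iff]
  refine ⟨?_, fun h => .inr ⟨rfl, h⟩⟩
  rintro (⟨w, hw, _⟩ | ⟨_, h⟩)
  · rw [FlowOps.Laws.between_iff] at hw
    exact absurd hw.2.2.1 (hK.lt_asymm hz (hK.sec_cell hw.1) hw.2.1)
  · exact h

/-- On an interval without boundary points of the set of fixed points, on which a return map is
defined everywhere, the property defining a new predicate holds everywhere or nowhere. -/
theorem Ops.Laws.atPt_iff_rel {K : Ops Ψ M} (hK : K.Laws) {G : Rel Ψ 2} {x y : M}
    (h1 : ∀ z, K.between G.sec x z y → K.sec G.sec ((K.prog G.dir)^[G.exp] z))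
    (h2 : ∀ z, K.between G.sec x z y → ∀ j, z ≠ K.gamma G.sec j) {z : M}
    (hz : K.between G.sec x z y) : K.atPt G z ↔ K.rel G x y := by
  refine ⟨fun h => (hK.rel_iff G x y).2 (.inl ⟨z, hz, h⟩), fun h => ?_⟩
  exact (hK.rel_self (hK.sec_cell hz.1.1)).1 (hK.coherence G x y h h1 h2 z hz)

namespace PartIso

/-- The map `ζ` behaves near the filter `F` on `N` like the point `y` of `M`: either `y` is in the
domain of the partial isomorphism and `ζ` is eventually equal to its image, or `y` is a generic
point of a section and the values of `ζ` fill the corresponding cut. -/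
def Follows (K : Ops Ψ M) (K' : Ops Ψ N) (A : M → N → Prop) (F : Filter N) (y : M) (ζ : N → N) :
    Prop :=
  (∃ t', A y t' ∧ ∀ᶠ z in F, ζ z = t') ∨
    ∃ D, Gen K A D y ∧ Tendsto ζ F (secFilter K K' A D y)

variable {K : Ops Ψ M} {K' : Ops Ψ N} {A : M → N → Prop}
variable (hA : PartIso K K' A) (hK : K.Laws) (hK' : K'.Laws)
include hA hK hK'

theorem Follows.prog {F : Filter N} {y : M} {ζ : N → N} (h : Follows K K' A F y ζ) (g : Dir) :
    Follows K K' A F (K.prog g y) (fun z => K'.prog g (ζ z)) := by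
  rcases h with ⟨t', ht, hζ⟩ | ⟨D, hD, hζ⟩
  · exact .inl ⟨_, hA.prog g ht, hζ.mono fun z hz => congrArg (K'.prog g) hz⟩
  · rcases hA.prog_gen hK hK' hD g with ⟨h1, h2⟩ | ⟨D', h1, h2, _⟩
    · exact .inl ⟨K'.s, h1 ▸ hA.s, hζ.eventually h2⟩
    · exact .inr ⟨D', h1, h2.comp hζ⟩

theorem Follows.iterate {F : Filter N} {y : M} {ζ : N → N} (h : Follows K K' A F y ζ) (g : Dir)
    (m : ℕ) : Follows K K' A F ((K.prog g)^[m] y) (fun z => (K'.prog g)^[m] (ζ z)) := by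
  induction m with
  | zero => exact h
  | succ m ih =>
    simp only [Function.iterate_succ_apply']
    exact Follows.prog hA hK hK' ih g

theorem Follows.eventually_sec {F : Filter N} {y : M} {ζ : N → N} (h : Follows K K' A F y ζ)
    (C : Ψ.flow.Section₁) : ∀ᶠ z in F, K'.sec C (ζ z) ↔ K.sec C y := by
  rcases h with ⟨t', ht, hζ⟩ | ⟨D, hD, hζ⟩
  · filter_upwards [hζ] with z hz
    rw [hz, hA.sec_iff C ht]
  · filter_upwards [hζ.eventually (hA.compat hK hK' D).eventually_mem] with z hz
    exact ⟨fun h => hK'.sec_unique hz h ▸ hD.1, fun h => hK.sec_unique hD.1 h ▸ hz⟩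

omit hA hK hK' in
theorem follows_id {C : Ψ.flow.Section₁} {x : M} (hx : Gen K A C x) :
    Follows K K' A (secFilter K K' A C x) x id := .inr ⟨C, hx, tendsto_id⟩

/-- Around a generic point there is an interval with end points in the domain of the partial
isomorphism on which the property defining a new predicate is constant, and it has the same truth
value on the corresponding interval of `N`. -/
theorem exists_interval_atPt {G : Rel Ψ 2} {x : M} (hx : Gen K A G.sec x) :
    ∃ t t' u u', A t t' ∧ A u u' ∧ K.between G.sec t x u ∧
      (∀ z, K.between G.sec t z u → (K.atPt G z ↔ K.atPt G x)) ∧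
      ∀ z, K'.between G.sec t' z u' → (K'.atPt G z ↔ K.atPt G x) := by
  have hc := hA.compat hK hK' G.sec
  have e1 : ∀ᶠ z in secFilter K K (fun x y => x = y ∧ ∃ z, A x z) G.sec x,
      (K.sec G.sec ((K.prog G.dir)^[G.exp] z) ↔ K.sec G.sec ((K.prog G.dir)^[G.exp] x)) ∧
      ∀ j, z ≠ K.gamma G.sec j :=
    ((Follows.eventually_sec hA.diag hK hK
      (Follows.iterate hA.diag hK hK (follows_id (gen_diag hx)) _ _) _)).and
      (eventually_all.2 fun j =>
        hA.diag.eventually_ne hK hK (gen_diag hx) (hA.diag.gamma G.sec j))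
  have e2 : ∀ᶠ z in secFilter K K' A G.sec x,
      (K'.sec G.sec ((K'.prog G.dir)^[G.exp] z) ↔ K.sec G.sec ((K.prog G.dir)^[G.exp] x)) ∧
      ∀ j, z ≠ K'.gamma G.sec j :=
    ((Follows.eventually_sec hA hK hK'
      (Follows.iterate hA hK hK' (follows_id hx) _ _) _)).and
      (eventually_all.2 fun j => hA.eventually_ne hK hK' hx (hA.gamma G.sec j))
  obtain ⟨⟨l, u⟩, ⟨hl, hu⟩, h1, h2⟩ := hc.exists_cut e1 e2
  -- a missing bound is replaced by the end point `min` or `max` of the cell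
  have hL : ∃ t t', A t t' ∧ K.bar G.sec t ∧ K.lt G.sec.cell t x ∧
      (∀ z, K.sec G.sec z → K.lt G.sec.cell t z → ∀ p ∈ l.map Prod.fst, K.lt G.sec.cell p z) ∧
      (∀ z, K'.sec G.sec z → K'.lt G.sec.cell t' z →
        ∀ p ∈ l.map Prod.snd, K'.lt G.sec.cell p z) := by
    rcases l with _ | p
    · exact ⟨_, _, hA.mn G.sec.cell, .inl (.inr rfl), hK.mn_lt _ _ (hK.sec_cell hx.1),
        by simp, by simp⟩
    · obtain ⟨hp, hPp, hpx⟩ := hl p rfl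
      exact ⟨p.1, p.2, hp, .inl (.inl hPp), hpx, by simp, by simp⟩
  have hU : ∃ t t', A t t' ∧ K.bar G.sec t ∧ K.lt G.sec.cell x t ∧
      (∀ z, K.sec G.sec z → K.lt G.sec.cell z t → ∀ p ∈ u.map Prod.fst, K.lt G.sec.cell z p) ∧
      (∀ z, K'.sec G.sec z → K'.lt G.sec.cell z t' →
        ∀ p ∈ u.map Prod.snd, K'.lt G.sec.cell z p) := by
    rcases u with _ | p
    · exact ⟨_, _, hA.mx G.sec.cell, .inr rfl, hK.lt_mx _ _ (hK.sec_cell hx.1),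
        by simp, by simp⟩
    · obtain ⟨hp, hPp, hpx⟩ := hu p rfl
      exact ⟨p.1, p.2, hp, .inl (.inl hPp), hpx, by simp, by simp⟩
  obtain ⟨t, t', ht, htb, htx, ht1, ht2⟩ := hL
  obtain ⟨w, w', hw, hwb, hwx, hw1, hw2⟩ := hU
  have hM : ∀ z, K.between G.sec t z w →
      (K.sec G.sec ((K.prog G.dir)^[G.exp] z) ↔ K.sec G.sec ((K.prog G.dir)^[G.exp] x)) ∧
      ∀ j, z ≠ K.gamma G.sec j := fun z hz => by
    rw [FlowOps.Laws.between_iff] at hz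
    exact h1 ⟨hz.1, ht1 z hz.1 hz.2.1, hw1 z hz.1 hz.2.2.1⟩
  have hN : ∀ z, K'.between G.sec t' z w' →
      (K'.sec G.sec ((K'.prog G.dir)^[G.exp] z) ↔ K.sec G.sec ((K.prog G.dir)^[G.exp] x)) ∧
      ∀ j, z ≠ K'.gamma G.sec j := fun z hz => by
    rw [FlowOps.Laws.between_iff] at hz
    exact h2 ⟨hz.1, ht2 z hz.1 hz.2.1, hw2 z hz.1 hz.2.2.1⟩
  have hxb : K.between G.sec t x w := FlowOps.Laws.between_iff.2 ⟨hx.1, htx, hwx, htb, hwb⟩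
  refine ⟨t, t', w, w', ht, hw, hxb, ?_⟩
  by_cases hs : K.sec G.sec ((K.prog G.dir)^[G.exp] x)
  · have c1 : ∀ z, K.between G.sec t z w → (K.atPt G z ↔ K.rel G t w) := fun z hz =>
      hK.atPt_iff_rel (fun z hz => (hM z hz).1.2 hs) (fun z hz => (hM z hz).2) hz
    have c2 : ∀ z, K'.between G.sec t' z w' → (K'.atPt G z ↔ K'.rel G t' w') := fun z hz =>
      hK'.atPt_iff_rel (fun z hz => (hN z hz).1.2 hs) (fun z hz => (hN z hz).2) hz
    refine ⟨fun z hz => (c1 z hz).trans (c1 x hxb).symm, fun z hz => ?_⟩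
    rw [c2 z hz, c1 x hxb, hA.rel_iff G ht hw]
  -- where the return map leaves the section, the property fails
  · have hx' : ¬ K.atPt G x := fun h => hs (Ops.atPt_sec h).2
    refine ⟨fun z hz => iff_of_false (fun h => ?_) hx', fun z hz => iff_of_false (fun h => ?_) hx'⟩
    · exact hs ((hM z hz).1.1 (Ops.atPt_sec h).2)
    · exact hs ((hN z hz).1.1 (Ops.atPt_sec h).2)

end PartIso

end DulacFlowConfiguration

/-! ### The new predicates on intervals -/

namespace DulacFlowConfiguration

open FlowConfiguration Filter

variable {Ψ : DulacFlowConfiguration} {M N : Type}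

namespace Ops.Laws

variable {K : Ops Ψ M} (hK : K.Laws) {G : Rel Ψ 2}
include hK

theorem rel_bar {x y : M} (h : K.rel G x y) : K.bar G.sec x ∧ K.bar G.sec y := by
  rcases (hK.rel_iff G x y).1 h with ⟨z, hz, _⟩ | ⟨rfl, hx⟩
  · rw [FlowOps.Laws.between_iff] at hz
    exact hz.2.2.2
  · exact ⟨.inl (.inl (Ops.atPt_sec hx).1), .inl (.inl (Ops.atPt_sec hx).1)⟩

theorem rel_left {x y : M} (hx : K.cell G.sec.cell x) (h : K.rel G x y) :
    x = y ∨ K.lt G.sec.cell x y := by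
  rcases (hK.rel_iff G x y).1 h with ⟨z, hz, _⟩ | ⟨rfl, _⟩
  · rw [FlowOps.Laws.between_iff] at hz
    exact .inr (hK.lt_trans hx (hK.sec_cell hz.1) hz.2.1 hz.2.2.1)
  · exact .inl rfl

theorem rel_right {x y : M} (hy : K.cell G.sec.cell y) (h : K.rel G x y) :
    x = y ∨ K.lt G.sec.cell x y := by
  rcases (hK.rel_iff G x y).1 h with ⟨z, hz, _⟩ | ⟨rfl, _⟩
  · rw [FlowOps.Laws.between_iff] at hz
    exact .inr (hK.lt_trans' (hK.sec_cell hz.1) hy hz.2.1 hz.2.2.1)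
  · exact .inl rfl

theorem rel_iff_of_lt {x y : M} (hx : K.bar G.sec x) (hy : K.bar G.sec y)
    (hxy : K.lt G.sec.cell x y) : K.rel G x y ↔
      ∃ z, K.sec G.sec z ∧ K.lt G.sec.cell x z ∧ K.lt G.sec.cell z y ∧ K.atPt G z := by
  rw [hK.rel_iff]
  constructor
  · rintro (⟨z, hz, h⟩ | ⟨rfl, _⟩)
    · rw [FlowOps.Laws.between_iff] at hz
      exact ⟨z, hz.1, hz.2.1, hz.2.2.1, h⟩
    · exact absurd hxy (hK.irrefl _ _)
  · rintro ⟨z, h1, h2, h3, h4⟩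
    exact .inl ⟨z, FlowOps.Laws.between_iff.2 ⟨h1, h2, h3, hx, hy⟩, h4⟩

/-- Splitting `G(y, v)` at a point `u` such that `G` is constant on the interval from `y` to `u`. -/
theorem rel_split_left {y u v : M} {β : Prop} (hy : K.sec G.sec y) (hv : K.bar G.sec v)
    (hyu : K.lt G.sec.cell y u) (h : v = u ∨ K.sec G.sec u ∧ K.lt G.sec.cell u v)
    (hβ : ∀ z, K.sec G.sec z → K.lt G.sec.cell y z → K.lt G.sec.cell z u → (K.atPt G z ↔ β)) :
    K.rel G y v ↔ β ∨ K.sec G.sec u ∧ K.lt G.sec.cell u v ∧ (K.rel G u u ∨ K.rel G u v) := by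
  have hyc := hK.sec_cell hy
  have hyv : K.lt G.sec.cell y v := by
    rcases h with rfl | ⟨h1, h2⟩
    exacts [hyu, hK.lt_trans hyc (hK.sec_cell h1) hyu h2]
  rw [hK.rel_iff_of_lt (.inl (.inl hy)) hv hyv]
  constructor
  · rintro ⟨z, hz, hyz, hzv, h4⟩
    rcases h with rfl | ⟨h1, h2⟩
    · exact .inl ((hβ z hz hyz hzv).1 h4)
    · rcases (hK.sec_dlo G.sec).linear z u hz h1 with h5 | rfl | h5
      · exact .inl ((hβ z hz hyz h5).1 h4)
      · exact .inr ⟨h1, h2, .inl ((hK.rel_self (hK.sec_cell h1)).2 h4)⟩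
      · exact .inr ⟨h1, h2, .inr ((hK.rel_iff_of_lt (.inl (.inl h1)) hv h2).2
          ⟨z, hz, h5, hzv, h4⟩)⟩
  · rintro (h3 | ⟨h1, h2, h3 | h3⟩)
    · have : ∃ z, K.sec G.sec z ∧ K.lt G.sec.cell y z ∧ K.lt G.sec.cell z u := by
        by_cases hu : K.sec G.sec u
        · exact (hK.sec_dlo G.sec).dense y u hy hu hyu
        · obtain rfl := h.resolve_right fun h => hu h.1
          rcases hK.lt_right hyu with h4 | rfl
          · rcases hv with (h5 | h5) | h5
            exacts [absurd h5 hu, absurd h5 (hK.ne_mn h4), absurd h5 (hK.ne_mx h4)]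
          · obtain ⟨z, hz, hyz⟩ := (hK.sec_dlo G.sec).no_max y hy
            exact ⟨z, hz, hyz, hK.lt_mx _ _ (hK.sec_cell hz)⟩
      obtain ⟨z, hz, hyz, hzu⟩ := this
      refine ⟨z, hz, hyz, ?_, (hβ z hz hyz hzu).2 h3⟩
      rcases h with rfl | ⟨h1, h2⟩
      exacts [hzu, hK.lt_trans (hK.sec_cell hz) (hK.sec_cell h1) hzu h2]
    · exact ⟨u, h1, hyu, h2, (hK.rel_self (hK.sec_cell h1)).1 h3⟩
    · obtain ⟨z, hz, huz, hzv, h4⟩ := (hK.rel_iff_of_lt (.inl (.inl h1)) hv h2).1 h3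
      exact ⟨z, hz, hK.lt_trans hyc (hK.sec_cell h1) hyu huz, hzv, h4⟩

/-- Splitting `G(v, y)` at a point `t` such that `G` is constant on the interval from `t` to `y`. -/
theorem rel_split_right {y t v : M} {β : Prop} (hy : K.sec G.sec y) (hv : K.bar G.sec v)
    (hty : K.lt G.sec.cell t y) (h : v = t ∨ K.sec G.sec t ∧ K.lt G.sec.cell v t)
    (hβ : ∀ z, K.sec G.sec z → K.lt G.sec.cell t z → K.lt G.sec.cell z y → (K.atPt G z ↔ β)) :
    K.rel G v y ↔ β ∨ K.sec G.sec t ∧ K.lt G.sec.cell v t ∧ (K.rel G t t ∨ K.rel G v t) := by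
  have hyc := hK.sec_cell hy
  have hvy : K.lt G.sec.cell v y := by
    rcases h with rfl | ⟨h1, h2⟩
    exacts [hty, hK.lt_trans' (hK.sec_cell h1) hyc h2 hty]
  rw [hK.rel_iff_of_lt hv (.inl (.inl hy)) hvy]
  constructor
  · rintro ⟨z, hz, hvz, hzy, h4⟩
    rcases h with rfl | ⟨h1, h2⟩
    · exact .inl ((hβ z hz hvz hzy).1 h4)
    · rcases (hK.sec_dlo G.sec).linear t z h1 hz with h5 | rfl | h5
      · exact .inl ((hβ z hz h5 hzy).1 h4)
      · exact .inr ⟨h1, h2, .inl ((hK.rel_self (hK.sec_cell h1)).2 h4)⟩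
      · exact .inr ⟨h1, h2, .inr ((hK.rel_iff_of_lt hv (.inl (.inl h1)) h2).2
          ⟨z, hz, hvz, h5, h4⟩)⟩
  · rintro (h3 | ⟨h1, h2, h3 | h3⟩)
    · have : ∃ z, K.sec G.sec z ∧ K.lt G.sec.cell t z ∧ K.lt G.sec.cell z y := by
        by_cases hu : K.sec G.sec t
        · exact (hK.sec_dlo G.sec).dense t y hu hy hty
        · obtain rfl := h.resolve_right fun h => hu h.1
          rcases hK.lt_left hty with h4 | rfl
          · rcases hv with (h5 | h5) | h5
            exacts [absurd h5 hu, absurd h5 (hK.ne_mn h4), absurd h5 (hK.ne_mx h4)]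
          · obtain ⟨z, hz, hzy⟩ := (hK.sec_dlo G.sec).no_min y hy
            exact ⟨z, hz, hK.mn_lt _ _ (hK.sec_cell hz), hzy⟩
      obtain ⟨z, hz, htz, hzy⟩ := this
      refine ⟨z, hz, ?_, hzy, (hβ z hz htz hzy).2 h3⟩
      rcases h with rfl | ⟨h1, h2⟩
      exacts [htz, hK.lt_trans' (hK.sec_cell h1) (hK.sec_cell hz) h2 htz]
    · exact ⟨t, h1, h2, hty, (hK.rel_self (hK.sec_cell h1)).1 h3⟩
    · obtain ⟨z, hz, hvz, hzt, h4⟩ := (hK.rel_iff_of_lt hv (.inl (.inl h1)) h2).1 h3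
      exact ⟨z, hz, hvz, hK.lt_trans' (hK.sec_cell h1) hyc hzt hty, h4⟩

theorem rel_iff_of_const {x y : M} {β : Prop} (hx : K.sec G.sec x) (hy : K.sec G.sec y)
    (hxy : K.lt G.sec.cell x y)
    (hβ : ∀ z, K.sec G.sec z → K.lt G.sec.cell x z → K.lt G.sec.cell z y → (K.atPt G z ↔ β)) :
    K.rel G x y ↔ β := by
  rw [hK.rel_split_left hx (.inl (.inl hy)) hxy (.inl rfl) hβ]
  exact or_iff_left fun h => hK.irrefl _ _ h.2.1

theorem rel_split {x t y : M} (hx : K.sec G.sec x) (ht : K.sec G.sec t) (hy : K.sec G.sec y)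
    (hxt : K.lt G.sec.cell x t) (hty : K.lt G.sec.cell t y) :
    K.rel G x y ↔ K.rel G x t ∨ K.rel G t t ∨ K.rel G t y := by
  have hxc := hK.sec_cell hx
  have htc := hK.sec_cell ht
  have hyc := hK.sec_cell hy
  rw [hK.rel_iff_of_lt (.inl (.inl hx)) (.inl (.inl hy)) (hK.lt_trans hxc htc hxt hty),
    hK.rel_iff_of_lt (.inl (.inl hx)) (.inl (.inl ht)) hxt,
    hK.rel_iff_of_lt (.inl (.inl ht)) (.inl (.inl hy)) hty, hK.rel_self htc]
  constructor
  · rintro ⟨z, hz, hxz, hzy, h⟩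
    rcases (hK.sec_dlo G.sec).linear z t hz ht with h1 | rfl | h1
    exacts [.inl ⟨z, hz, hxz, h1, h⟩, .inr (.inl h), .inr (.inr ⟨z, hz, h1, hzy, h⟩)]
  · rintro (⟨z, hz, h1, h2, h⟩ | h | ⟨z, hz, h1, h2, h⟩)
    · exact ⟨z, hz, h1, hK.lt_trans (hK.sec_cell hz) htc h2 hty, h⟩
    · exact ⟨t, ht, hxt, hty, h⟩
    · exact ⟨z, hz, hK.lt_trans hxc htc hxt h1, h2, h⟩

end Ops.Laws

namespace PartIso

variable {K : Ops Ψ M} {K' : Ops Ψ N} {A : M → N → Prop}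
variable (hA : PartIso K K' A) (hK : K.Laws) (hK' : K'.Laws)
include hA hK hK'

theorem eventually_atPt {G : Rel Ψ 2} {x : M} (hx : Gen K A G.sec x) :
    ∀ᶠ z in secFilter K K' A G.sec x, K'.atPt G z ↔ K.atPt G x := by
  obtain ⟨t, t', u, u', ht, hu, hb, _, h2⟩ := hA.exists_interval_atPt hK hK' hx
  rw [FlowOps.Laws.between_iff] at hb
  filter_upwards [(hA.compat hK hK' _).eventually_mem, hA.eventually_lt_iff hK hK' hx ht,
    hA.eventually_gt_iff hK hK' hx hu] with z h3 h4 h5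
  exact h2 z (FlowOps.Laws.between_iff.2 ⟨h3, h4.2 hb.2.1, h5.2 hb.2.2.1,
    (hA.bar_iff _ ht).1 hb.2.2.2.1, (hA.bar_iff _ hu).1 hb.2.2.2.2⟩)

theorem eventually_rel_left {G : Rel Ψ 2} {x : M} (hx : Gen K A G.sec x) {v : M} {v' : N}
    (hv : A v v') : ∀ᶠ z in secFilter K K' A G.sec x, K'.rel G z v' ↔ K.rel G x v := by
  have hmem := (hA.compat hK hK' G.sec).eventually_mem (a := x)
  have hgt := hA.eventually_gt_iff hK hK' hx hv
  by_cases h : K.bar G.sec v ∧ K.lt G.sec.cell x v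
  swap
  · filter_upwards [hmem, hgt, hA.eventually_ne hK hK' hx hv] with z hz h1 h2
    refine iff_of_false (fun h3 => ?_) fun h3 => ?_
    · have h4 := (hA.bar_iff _ hv).2 (hK'.rel_bar h3).2
      exact h ⟨h4, h1.1 ((hK'.rel_left (hK'.sec_cell hz) h3).resolve_left h2)⟩
    · refine h ⟨(hK.rel_bar h3).2, (hK.rel_left (hK.sec_cell hx.1) h3).resolve_left ?_⟩
      rintro rfl
      exact hx.2 _ hv
  obtain ⟨hvb, hxv⟩ := h
  have hvb' := (hA.bar_iff _ hv).1 hvb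
  obtain ⟨t, t', u, u', ht, hu, hb, h1, h2⟩ := hA.exists_interval_atPt hK hK' hx
  rw [FlowOps.Laws.between_iff] at hb
  obtain ⟨_, htx, hxu, htb, hub⟩ := hb
  have htb' := (hA.bar_iff _ ht).1 htb
  have hub' := (hA.bar_iff _ hu).1 hub
  -- the upper end of the interval of constancy can be chosen below `v`
  obtain ⟨w, w', hw, hxw, hor, hw1, hw2⟩ : ∃ w w', A w w' ∧ K.lt G.sec.cell x w ∧
      (v = w ∨ K.sec G.sec w ∧ K.lt G.sec.cell w v) ∧
      (∀ z, K.sec G.sec z → K.lt G.sec.cell z w → K.lt G.sec.cell z u) ∧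
      (∀ z, K'.sec G.sec z → K'.lt G.sec.cell z w' → K'.lt G.sec.cell z u') := by
    by_cases hus : K.sec G.sec u
    · by_cases hvs : K.sec G.sec v
      · rcases (hK.sec_dlo G.sec).linear v u hvs hus with h3 | rfl | h3
        · refine ⟨v, v', hv, hxv, .inl rfl, fun z hz hzv => ?_, fun z hz hzv => ?_⟩
          · exact hK.lt_trans (hK.sec_cell hz) (hK.sec_cell hvs) hzv h3
          · exact hK'.lt_trans (hK'.sec_cell hz) (hK'.sec_cell ((hA.sec_iff _ hv).1 hvs)) hzv
              ((hA.lt_iff _ hv hu).1 h3)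
        · exact ⟨v, u', hu, hxv, .inl rfl, fun z _ h => h, fun z _ h => h⟩
        · exact ⟨u, u', hu, hxu, .inr ⟨hus, h3⟩, fun z _ h => h, fun z _ h => h⟩
      · refine ⟨u, u', hu, hxu, .inr ⟨hus, ?_⟩, fun z _ h => h, fun z _ h => h⟩
        have : v = K.mx G.sec.cell := by
          rcases hK.lt_right hxv with h3 | h3
          · rcases hvb with (h4 | h4) | h4
            exacts [absurd h4 hvs, absurd h4 (hK.ne_mn h3), h4]
          · exact h3
        exact this ▸ hK.lt_mx _ _ (hK.sec_cell hus)
    · have hu2 : u = K.mx G.sec.cell := by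
        rcases hK.lt_right hxu with h3 | h3
        · rcases hub with (h4 | h4) | h4
          exacts [absurd h4 hus, absurd h4 (hK.ne_mn h3), h4]
        · exact h3
      have hu2' : u' = K'.mx G.sec.cell := (hA.eq_iff hu (hA.mx _)).1 hu2
      refine ⟨v, v', hv, hxv, .inl rfl, fun z hz _ => ?_, fun z hz _ => ?_⟩
      · exact hu2 ▸ hK.lt_mx _ _ (hK.sec_cell hz)
      · exact hu2' ▸ hK'.lt_mx _ _ (hK'.sec_cell hz)
  have key := hK.rel_split_left (β := K.atPt G x) hx.1 hvb hxw hor fun z hz hxz hzw =>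
    h1 z (FlowOps.Laws.between_iff.2 ⟨hz,
      hK.lt_trans' (hK.sec_cell hx.1) (hK.sec_cell hz) htx hxz, hw1 z hz hzw, htb, hub⟩)
  have hor' : v' = w' ∨ K'.sec G.sec w' ∧ K'.lt G.sec.cell w' v' := by
    rwa [← hA.eq_iff hv hw, ← hA.sec_iff _ hw, ← hA.lt_iff _ hw hv]
  filter_upwards [hmem, hA.eventually_lt_iff hK hK' hx ht, hA.eventually_gt_iff hK hK' hx hw]
    with y hy hty hyw
  have key' := hK'.rel_split_left (β := K.atPt G x) hy hvb' (hyw.2 hxw) hor' fun z hz hyz hzw =>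
    h2 z (FlowOps.Laws.between_iff.2 ⟨hz,
      hK'.lt_trans' (hK'.sec_cell hy) (hK'.sec_cell hz) (hty.2 htx) hyz, hw2 z hz hzw, htb', hub'⟩)
  rw [key, key', hA.sec_iff _ hw, hA.lt_iff _ hw hv, hA.rel_iff G hw hw, hA.rel_iff G hw hv]

theorem eventually_rel_right {G : Rel Ψ 2} {x : M} (hx : Gen K A G.sec x) {v : M} {v' : N}
    (hv : A v v') : ∀ᶠ z in secFilter K K' A G.sec x, K'.rel G v' z ↔ K.rel G v x := by
  have hmem := (hA.compat hK hK' G.sec).eventually_mem (a := x)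
  have hlt := hA.eventually_lt_iff hK hK' hx hv
  by_cases h : K.bar G.sec v ∧ K.lt G.sec.cell v x
  swap
  · filter_upwards [hmem, hlt, hA.eventually_ne hK hK' hx hv] with z hz h1 h2
    refine iff_of_false (fun h3 => ?_) fun h3 => ?_
    · have h4 := (hA.bar_iff _ hv).2 (hK'.rel_bar h3).1
      exact h ⟨h4, h1.1 ((hK'.rel_right (hK'.sec_cell hz) h3).resolve_left (Ne.symm h2))⟩
    · refine h ⟨(hK.rel_bar h3).1, (hK.rel_right (hK.sec_cell hx.1) h3).resolve_left ?_⟩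
      rintro rfl
      exact hx.2 _ hv
  obtain ⟨hvb, hvx⟩ := h
  have hvb' := (hA.bar_iff _ hv).1 hvb
  obtain ⟨t, t', u, u', ht, hu, hb, h1, h2⟩ := hA.exists_interval_atPt hK hK' hx
  rw [FlowOps.Laws.between_iff] at hb
  obtain ⟨_, htx, hxu, htb, hub⟩ := hb
  have htb' := (hA.bar_iff _ ht).1 htb
  have hub' := (hA.bar_iff _ hu).1 hub
  -- the lower end of the interval of constancy can be chosen above `v`
  obtain ⟨w, w', hw, hwx, hor, hw1, hw2⟩ : ∃ w w', A w w' ∧ K.lt G.sec.cell w x ∧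
      (v = w ∨ K.sec G.sec w ∧ K.lt G.sec.cell v w) ∧
      (∀ z, K.sec G.sec z → K.lt G.sec.cell w z → K.lt G.sec.cell t z) ∧
      (∀ z, K'.sec G.sec z → K'.lt G.sec.cell w' z → K'.lt G.sec.cell t' z) := by
    by_cases hts : K.sec G.sec t
    · by_cases hvs : K.sec G.sec v
      · rcases (hK.sec_dlo G.sec).linear t v hts hvs with h3 | rfl | h3
        · refine ⟨v, v', hv, hvx, .inl rfl, fun z hz hvz => ?_, fun z hz hvz => ?_⟩
          · exact hK.lt_trans' (hK.sec_cell hvs) (hK.sec_cell hz) h3 hvz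
          · exact hK'.lt_trans' (hK'.sec_cell ((hA.sec_iff _ hv).1 hvs)) (hK'.sec_cell hz)
              ((hA.lt_iff _ ht hv).1 h3) hvz
        · exact ⟨t, t', ht, hvx, .inl rfl, fun z _ h => h, fun z _ h => h⟩
        · exact ⟨t, t', ht, htx, .inr ⟨hts, h3⟩, fun z _ h => h, fun z _ h => h⟩
      · refine ⟨t, t', ht, htx, .inr ⟨hts, ?_⟩, fun z _ h => h, fun z _ h => h⟩
        have : v = K.mn G.sec.cell := by
          rcases hK.lt_left hvx with h3 | h3
          · rcases hvb with (h4 | h4) | h4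
            exacts [absurd h4 hvs, h4, absurd h4 (hK.ne_mx h3)]
          · exact h3
        exact this ▸ hK.mn_lt _ _ (hK.sec_cell hts)
    · have ht2 : t = K.mn G.sec.cell := by
        rcases hK.lt_left htx with h3 | h3
        · rcases htb with (h4 | h4) | h4
          exacts [absurd h4 hts, h4, absurd h4 (hK.ne_mx h3)]
        · exact h3
      have ht2' : t' = K'.mn G.sec.cell := (hA.eq_iff ht (hA.mn _)).1 ht2
      refine ⟨v, v', hv, hvx, .inl rfl, fun z hz _ => ?_, fun z hz _ => ?_⟩
      · exact ht2 ▸ hK.mn_lt _ _ (hK.sec_cell hz)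
      · exact ht2' ▸ hK'.mn_lt _ _ (hK'.sec_cell hz)
  have key := hK.rel_split_right (β := K.atPt G x) hx.1 hvb hwx hor fun z hz hwz hzx =>
    h1 z (FlowOps.Laws.between_iff.2 ⟨hz, hw1 z hz hwz,
      hK.lt_trans (hK.sec_cell hz) (hK.sec_cell hx.1) hzx hxu, htb, hub⟩)
  have hor' : v' = w' ∨ K'.sec G.sec w' ∧ K'.lt G.sec.cell v' w' := by
    rwa [← hA.eq_iff hv hw, ← hA.sec_iff _ hw, ← hA.lt_iff _ hv hw]
  filter_upwards [hmem, hA.eventually_gt_iff hK hK' hx hu, hA.eventually_lt_iff hK hK' hx hw]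
    with y hy hyu hwy
  have key' := hK'.rel_split_right (β := K.atPt G x) hy hvb' (hwy.2 hwx) hor' fun z hz hwz hzy =>
    h2 z (FlowOps.Laws.between_iff.2 ⟨hz, hw2 z hz hwz,
      hK'.lt_trans (hK'.sec_cell hz) (hK'.sec_cell hy) hzy (hyu.2 hxu), htb', hub'⟩)
  rw [key, key', hA.sec_iff _ hw, hA.lt_iff _ hv hw, hA.rel_iff G hw hw, hA.rel_iff G hv hw]

end PartIso

end DulacFlowConfiguration

/-! ### The orbit of a generic point -/

namespace DulacFlowConfiguration

open FlowConfiguration Filter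

variable {Ψ : DulacFlowConfiguration} {M N : Type}

/-- A relation between points `y` of `M` and maps `ζ` on `N` that respects the operations and, near
the filter `F`, the atomic formulas. -/
structure IsTracking (K : Ops Ψ M) (K' : Ops Ψ N) (F : Filter N) (T : M → (N → N) → Prop) :
    Prop where
  prog : ∀ g {y ζ}, T y ζ → T (K.prog g y) (fun z => K'.prog g (ζ z))
  s : T K.s fun _ => K'.s
  single : ∀ c, T (K.single c) fun _ => K'.single c
  e : ∀ C, T (K.e C) fun _ => K'.e C
  lo : ∀ g C, T (K.lo g C) fun _ => K'.lo g C
  hi : ∀ g C, T (K.hi g C) fun _ => K'.hi g C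
  gamma : ∀ C j, T (K.gamma C j) fun _ => K'.gamma C j
  eq_iff : ∀ {y ζ y' ζ'}, T y ζ → T y' ζ' → ∀ᶠ z in F, ζ z = ζ' z ↔ y = y'
  cell_iff : ∀ C {y ζ}, T y ζ → ∀ᶠ z in F, K'.cell C (ζ z) ↔ K.cell C y
  E_iff : ∀ C {y ζ}, T y ζ → ∀ᶠ z in F, K'.E C (ζ z) ↔ K.E C y
  lt_iff : ∀ C {y ζ y' ζ'}, T y ζ → T y' ζ' → ∀ᶠ z in F, K'.lt C (ζ z) (ζ' z) ↔ K.lt C y y'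
  rel_iff : ∀ G {y ζ y' ζ'}, T y ζ → T y' ζ' → ∀ᶠ z in F, K'.rel G (ζ z) (ζ' z) ↔ K.rel G y y'

theorem _root_.FlowConfiguration.FlowOps.Laws.cell_eq_of_lt {Φ : FlowConfiguration}
    {K : FlowOps Φ M} (hK : K.Laws) {C D : Φ.Cell} {x y : M}
    (h : K.lt C x y) : (K.cell D x → D = C) ∧ (K.cell D y → D = C) := by
  refine ⟨fun hx => ?_, fun hy => ?_⟩
  · rcases hK.lt_left h with h' | h'
    exacts [hK.cell_unique _ _ _ hx h', absurd h' (hK.ne_mn hx)]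
  · rcases hK.lt_right h with h' | h'
    exacts [hK.cell_unique _ _ _ hy h', absurd h' (hK.ne_mx hy)]

namespace PartIso

variable {K : Ops Ψ M} {K' : Ops Ψ N} {A : M → N → Prop}

/-- The pair `(y, ζ)` consists of a generic point `y` and of a map `ζ` whose values fill the cut of
`y` near `F`, and `y` and `ζ` lie on the same place of the orbits of `a` and of the identity map. -/
structure OnOrbit (K : Ops Ψ M) (K' : Ops Ψ N) (A : M → N → Prop) (F : Filter N) (a y : M)
    (ζ : N → N) (D : Ψ.flow.Section₁) : Prop where
  gen : Gen K A D y
  tendsto : Tendsto ζ F (secFilter K K' A D y)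
  orbit : (∃ k, y = (K.prog .f)^[k] a ∧ ∀ᶠ z in F, ζ z = (K'.prog .f)^[k] z) ∨
    ∃ k, a = (K.prog .f)^[k] y ∧ ∀ᶠ z in F, z = (K'.prog .f)^[k] (ζ z)

/-- The pairs that describe the substructure generated by a generic point `a` over the domain of
the partial isomorphism. -/
def OrbitTracks (K : Ops Ψ M) (K' : Ops Ψ N) (A : M → N → Prop) (F : Filter N) (a : M) (y : M)
    (ζ : N → N) : Prop :=
  (∃ t', A y t' ∧ ∀ᶠ z in F, ζ z = t') ∨ ∃ D, OnOrbit K K' A F a y ζ D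

variable (hA : PartIso K K' A) (hK : K.Laws) (hK' : K'.Laws) {C : Ψ.flow.Section₁} {a : M}
  (ha : Gen K A C a)
include hA hK hK'

omit hK hK' in
theorem iterate_mem {y : M} {t' : N} (h : A y t') (g : Dir) (k : ℕ) :
    ∃ u', A ((K.prog g)^[k] y) u' := by
  induction k with
  | zero => exact ⟨t', h⟩
  | succ k ih =>
    obtain ⟨u', hu⟩ := ih
    rw [Function.iterate_succ_apply']
    exact ⟨_, hA.prog g hu⟩

theorem prog_gen_of_notMem {D : Ψ.flow.Section₁} {y : M} (hy : Gen K A D y) (g : Dir)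
    (h : ∀ t', ¬ A (K.prog g y) t') :
    ∃ D', Gen K A D' (K.prog g y) ∧
      Tendsto (K'.prog g) (secFilter K K' A D y) (secFilter K K' A D' (K.prog g y)) ∧
      K.prog g.opp (K.prog g y) = y ∧
      ∀ᶠ z in secFilter K K' A D y, K'.prog g.opp (K'.prog g z) = z := by
  rcases hA.prog_gen hK hK' hy g with ⟨h1, _⟩ | h1
  · exact absurd (h1 ▸ hA.s) (h K'.s)
  · exact h1

/-- As long as the forward orbit of a generic point stays outside the domain of the partial
isomorphism, it can be traced back. -/
theorem iterate_inv {F : Filter N} {D : Ψ.flow.Section₁} {y : M} {ζ : N → N} (hy : Gen K A D y)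
    (hζ : Tendsto ζ F (secFilter K K' A D y)) (k : ℕ)
    (h : ∀ t', ¬ A ((K.prog .f)^[k] y) t') :
    (K.prog .b)^[k] ((K.prog .f)^[k] y) = y ∧
      ∀ᶠ z in F, (K'.prog .b)^[k] ((K'.prog .f)^[k] (ζ z)) = ζ z := by
  induction k generalizing D y ζ with
  | zero => exact ⟨rfl, Eventually.of_forall fun z => rfl⟩
  | succ k ih =>
    rw [Function.iterate_succ_apply] at h
    have h0 : ∀ t', ¬ A (K.prog .f y) t' := fun t' ht => by
      obtain ⟨u', hu⟩ := hA.iterate_mem ht .f k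
      exact h u' hu
    obtain ⟨D', h1, h2, h3, h4⟩ := hA.prog_gen_of_notMem hK hK' hy .f h0
    obtain ⟨h5, h6⟩ := ih h1 (h2.comp hζ) h
    constructor
    · rw [Function.iterate_succ_apply (K.prog .f), Function.iterate_succ_apply' (K.prog .b), h5]
      exact h3
    · filter_upwards [h6, hζ.eventually h4] with z h7 h8
      rw [Function.iterate_succ_apply (K'.prog .f), Function.iterate_succ_apply' (K'.prog .b)]
      exact (congrArg _ h7).trans h8

include ha

theorem OrbitTracks.prog (g : Dir) {y : M} {ζ : N → N}
    (h : OrbitTracks K K' A (secFilter K K' A C a) a y ζ) :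
    OrbitTracks K K' A (secFilter K K' A C a) a (K.prog g y) (fun z => K'.prog g (ζ z)) := by
  rcases h with ⟨t', ht, hζ⟩ | ⟨D, hy, hζ, ho⟩
  · exact .inl ⟨_, hA.prog g ht, hζ.mono fun z hz => congrArg (K'.prog g) hz⟩
  rcases hA.prog_gen hK hK' hy g with ⟨h1, h2⟩ | ⟨D', h1, h2, h3, h4⟩
  · exact .inl ⟨K'.s, h1 ▸ hA.s, hζ.eventually h2⟩
  refine .inr ⟨D', h1, h2.comp hζ, ?_⟩
  cases g
  · rcases ho with ⟨k, h5, h6⟩ | ⟨_ | k, h5, h6⟩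
    · refine .inl ⟨k + 1, ?_, ?_⟩
      · rw [Function.iterate_succ_apply', ← h5]
      · filter_upwards [h6] with z hz
        rw [Function.iterate_succ_apply', ← hz]
    · refine .inl ⟨1, ?_, ?_⟩
      · exact congrArg (K.prog .f) h5.symm
      · filter_upwards [h6] with z hz
        exact congrArg (K'.prog .f) hz.symm
    · exact .inr ⟨k, h5, h6⟩
  · rcases ho with ⟨_ | k, h5, h6⟩ | ⟨k, h5, h6⟩
    · refine .inr ⟨1, ?_, ?_⟩
      · exact h5.symm.trans h3.symm
      · filter_upwards [h6, hζ.eventually h4] with z h7 h8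
        exact h7.symm.trans h8.symm
    · left
      rw [Function.iterate_succ_apply'] at h5
      have h7 := Follows.iterate hA hK hK' (follows_id ha) .f k
      rcases h7 with ⟨t', ht, _⟩ | ⟨D'', h7, h8⟩
      · exact absurd (h5 ▸ hA.prog .f ht) (hy.2 _)
      · obtain ⟨_, _, _, h9, h10⟩ := hA.prog_gen_of_notMem hK hK' h7 .f (h5 ▸ hy.2)
        refine ⟨k, ?_, ?_⟩
        · rw [h5]
          exact h9
        · filter_upwards [h6, h8.eventually h10] with z h11 h12
          rw [h11, Function.iterate_succ_apply']
          exact h12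
    · refine .inr ⟨k + 1, ?_, ?_⟩
      · rw [Function.iterate_succ_apply]
        exact h5.trans (congrArg _ h3.symm)
      · filter_upwards [h6, hζ.eventually h4] with z h7 h8
        rw [Function.iterate_succ_apply]
        exact h7.trans (congrArg _ h8.symm)

/-- Of two points on the orbit of a generic point, one is an iterated image of the other. -/
theorem OnOrbit.exists_iterate {y₁ y₂ : M} {ζ₁ ζ₂ : N → N} {D₁ D₂ : Ψ.flow.Section₁}
    (h₁ : OnOrbit K K' A (secFilter K K' A C a) a y₁ ζ₁ D₁)
    (h₂ : OnOrbit K K' A (secFilter K K' A C a) a y₂ ζ₂ D₂) :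
    (∃ m, y₂ = (K.prog .f)^[m] y₁ ∧
      ∀ᶠ z in secFilter K K' A C a, ζ₂ z = (K'.prog .f)^[m] (ζ₁ z)) ∨
    ∃ m, y₁ = (K.prog .f)^[m] y₂ ∧
      ∀ᶠ z in secFilter K K' A C a, ζ₁ z = (K'.prog .f)^[m] (ζ₂ z) := by
  have back : ∀ {y y' : M} {ζ ζ' : N → N} {D D'} (k m : ℕ), Gen K A D y → Gen K A D' y' →
      Tendsto ζ (secFilter K K' A C a) (secFilter K K' A D y) →
      Tendsto ζ' (secFilter K K' A C a) (secFilter K K' A D' y') →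
      a = (K.prog .f)^[k] y → (∀ᶠ z in secFilter K K' A C a, z = (K'.prog .f)^[k] (ζ z)) →
      a = (K.prog .f)^[k + m] y' →
      (∀ᶠ z in secFilter K K' A C a, z = (K'.prog .f)^[k + m] (ζ' z)) →
      y = (K.prog .f)^[m] y' ∧
        ∀ᶠ z in secFilter K K' A C a, ζ z = (K'.prog .f)^[m] (ζ' z) := by
    intro y y' ζ ζ' D D' k m hy hy' hζ hζ' e1 e2 e3 e4
    obtain ⟨i1, i2⟩ := hA.iterate_inv hK hK' hy hζ k (e1 ▸ ha.2)
    rw [Function.iterate_add_apply] at e3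
    have hm : ∀ t', ¬ A ((K.prog .f)^[m] y') t' := fun t' ht => by
      obtain ⟨u', hu⟩ := hA.iterate_mem ht .f k
      exact ha.2 u' (e3 ▸ hu)
    rcases Follows.iterate hA hK hK' (.inr ⟨D', hy', hζ'⟩) .f m with ⟨t', ht, _⟩ | ⟨D'', h1, h2⟩
    · exact absurd ht (hm t')
    obtain ⟨j1, j2⟩ := hA.iterate_inv hK hK' h1 h2 k (e3 ▸ ha.2)
    constructor
    · rw [← i1, ← e1, ← j1, ← e3]
    · filter_upwards [i2, j2, e2, e4] with z f1 f2 f3 f4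
      rw [Function.iterate_add_apply] at f4
      rw [← f1, ← f3, ← f2, ← f4]
  obtain ⟨g₁, t₁, ⟨k, e₁, i₁⟩ | ⟨k, e₁, i₁⟩⟩ := h₁ <;>
    obtain ⟨g₂, t₂, ⟨l, e₂, i₂⟩ | ⟨l, e₂, i₂⟩⟩ := h₂
  · rcases le_total k l with h | h
    · obtain ⟨m, rfl⟩ := Nat.exists_eq_add_of_le' h
      refine .inl ⟨m, ?_, ?_⟩
      · rw [e₂, e₁, Function.iterate_add_apply]
      · filter_upwards [i₁, i₂] with z h1 h2
        rw [h2, h1, Function.iterate_add_apply]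
    · obtain ⟨m, rfl⟩ := Nat.exists_eq_add_of_le' h
      refine .inr ⟨m, ?_, ?_⟩
      · rw [e₂, e₁, Function.iterate_add_apply]
      · filter_upwards [i₁, i₂] with z h1 h2
        rw [h2, h1, Function.iterate_add_apply]
  · refine .inr ⟨k + l, ?_, ?_⟩
    · rw [e₁, Function.iterate_add_apply, ← e₂]
    · filter_upwards [i₁, i₂] with z h1 h2
      rw [h1, Function.iterate_add_apply, ← h2]
  · refine .inl ⟨l + k, ?_, ?_⟩
    · rw [e₂, Function.iterate_add_apply, ← e₁]
    · filter_upwards [i₁, i₂] with z h1 h2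
      rw [h2, Function.iterate_add_apply, ← h1]
  · rcases le_total k l with h | h
    · obtain ⟨m, rfl⟩ := Nat.exists_eq_add_of_le h
      exact .inr ⟨m, back k m g₁ g₂ t₁ t₂ e₁ i₁ e₂ i₂⟩
    · obtain ⟨m, rfl⟩ := Nat.exists_eq_add_of_le h
      exact .inl ⟨m, back l m g₂ g₁ t₂ t₁ e₂ i₂ e₁ i₁⟩

/-- The order between two points of a section on the orbit of a generic point is expressed by the
properties defining the new predicates, hence it is constant near the corresponding cut. -/
theorem OnOrbit.lt_iff {y₁ y₂ : M} {ζ₁ ζ₂ : N → N} {D : Ψ.flow.Section₁}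
    (h₁ : OnOrbit K K' A (secFilter K K' A C a) a y₁ ζ₁ D)
    (h₂ : OnOrbit K K' A (secFilter K K' A C a) a y₂ ζ₂ D) :
    ∀ᶠ z in secFilter K K' A C a, K'.lt D.cell (ζ₁ z) (ζ₂ z) ↔ K.lt D.cell y₁ y₂ := by
  have s₁ := h₁.tendsto.eventually (hA.compat hK hK' D).eventually_mem
  have s₂ := h₂.tendsto.eventually (hA.compat hK hK' D).eventually_mem
  rcases OnOrbit.exists_iterate hA hK hK' ha h₁ h₂ with ⟨m, e, i⟩ | ⟨m, e, i⟩
  · have := h₁.tendsto.eventually (hA.eventually_atPt hK hK' (G := .B .f m D) h₁.gen)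
    have f := h₂.gen.1
    filter_upwards [this, i, s₁, s₂] with z hz iz f1 f2
    simp only [Ops.atPt, ← iz, ← e] at hz
    simpa only [f1, f2, h₁.gen.1, f, true_and] using hz
  · have := h₂.tendsto.eventually (hA.eventually_atPt hK hK' (G := .S .f m D) h₂.gen)
    have f := h₂.gen.1
    filter_upwards [this, i, s₁, s₂] with z hz iz f1 f2
    simp only [Ops.atPt, ← iz, ← e] at hz
    simpa only [f1, f2, h₁.gen.1, f, true_and] using hz

theorem OnOrbit.eq_iff {y₁ y₂ : M} {ζ₁ ζ₂ : N → N} {D₁ D₂ : Ψ.flow.Section₁}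
    (h₁ : OnOrbit K K' A (secFilter K K' A C a) a y₁ ζ₁ D₁)
    (h₂ : OnOrbit K K' A (secFilter K K' A C a) a y₂ ζ₂ D₂) :
    ∀ᶠ z in secFilter K K' A C a, ζ₁ z = ζ₂ z ↔ y₁ = y₂ := by
  have s₁ := h₁.tendsto.eventually (hA.compat hK hK' D₁).eventually_mem
  have s₂ := h₂.tendsto.eventually (hA.compat hK hK' D₂).eventually_mem
  by_cases hD : D₁ = D₂
  · subst hD
    filter_upwards [s₁, s₂, OnOrbit.lt_iff hA hK hK' ha h₁ h₂, OnOrbit.lt_iff hA hK hK' ha h₂ h₁]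
      with z f1 f2 l1 l2
    constructor
    · intro h
      rw [h] at l1 l2
      rcases (hK.sec_dlo D₁).linear _ _ h₁.gen.1 h₂.gen.1 with h3 | h3 | h3
      exacts [absurd (l1.2 h3) (hK'.irrefl _ _), h3, absurd (l2.2 h3) (hK'.irrefl _ _)]
    · rintro rfl
      rcases (hK'.sec_dlo D₁).linear _ _ f1 f2 with h3 | h3 | h3
      exacts [absurd (l1.1 h3) (hK.irrefl _ _), h3, absurd (l2.1 h3) (hK.irrefl _ _)]
  · filter_upwards [s₁, s₂] with z f1 f2
    refine iff_of_false (fun h => hD ?_) (fun h => hD ?_)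
    · exact hK'.sec_unique f1 (h ▸ f2)
    · exact hK.sec_unique h₁.gen.1 (h ▸ h₂.gen.1)

theorem OnOrbit.rel_iff (G : Rel Ψ 2) {y₁ y₂ : M} {ζ₁ ζ₂ : N → N} {D₁ D₂ : Ψ.flow.Section₁}
    (h₁ : OnOrbit K K' A (secFilter K K' A C a) a y₁ ζ₁ D₁)
    (h₂ : OnOrbit K K' A (secFilter K K' A C a) a y₂ ζ₂ D₂) :
    ∀ᶠ z in secFilter K K' A C a, K'.rel G (ζ₁ z) (ζ₂ z) ↔ K.rel G y₁ y₂ := by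
  have s₁ := h₁.tendsto.eventually (hA.compat hK hK' D₁).eventually_mem
  have s₂ := h₂.tendsto.eventually (hA.compat hK hK' D₂).eventually_mem
  by_cases hD₁ : D₁ = G.sec
  swap
  · filter_upwards [s₁] with z f1
    exact iff_of_false (fun h => hK'.not_bar f1 hD₁ (hK'.rel_bar h).1)
      fun h => hK.not_bar h₁.gen.1 hD₁ (hK.rel_bar h).1
  by_cases hD₂ : D₂ = G.sec
  swap
  · filter_upwards [s₂] with z f1
    exact iff_of_false (fun h => hK'.not_bar f1 hD₂ (hK'.rel_bar h).2)
      fun h => hK.not_bar h₂.gen.1 hD₂ (hK.rel_bar h).2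
  subst hD₁ hD₂
  have hlt := OnOrbit.lt_iff hA hK hK' ha h₁ h₂
  have heq := OnOrbit.eq_iff hA hK hK' ha h₁ h₂
  have c₁ := hK.sec_cell h₁.gen.1
  have c₂ := hK.sec_cell h₂.gen.1
  by_cases e : y₁ = y₂
  · have := h₁.tendsto.eventually (hA.eventually_atPt hK hK' h₁.gen)
    filter_upwards [this, heq, s₁] with z f1 f2 f3
    rw [← f2.2 e, hK'.rel_self (hK'.sec_cell f3), f1, ← e, hK.rel_self c₁]
  by_cases l : K.lt G.sec.cell y₁ y₂
  swap
  · filter_upwards [hlt, heq, s₁] with z f1 f2 f3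
    refine iff_of_false (fun h => ?_) fun h => (hK.rel_left c₁ h).elim e l
    exact (hK'.rel_left (hK'.sec_cell f3) h).elim (mt f2.1 e) (mt f1.1 l)
  by_cases ht : ∃ t t', A t t' ∧ K.sec G.sec t ∧ K.lt G.sec.cell y₁ t ∧ K.lt G.sec.cell t y₂
  · obtain ⟨t, t', ht, hts, h3, h4⟩ := ht
    have hts' := (hA.sec_iff _ ht).1 hts
    filter_upwards [h₁.tendsto.eventually (hA.eventually_rel_left hK hK' h₁.gen ht),
      h₂.tendsto.eventually (hA.eventually_rel_right hK hK' h₂.gen ht),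
      h₁.tendsto.eventually (hA.eventually_gt_iff hK hK' h₁.gen ht),
      h₂.tendsto.eventually (hA.eventually_lt_iff hK hK' h₂.gen ht), s₁, s₂]
      with z f1 f2 f3 f4 f5 f6
    rw [hK.rel_split h₁.gen.1 hts h₂.gen.1 h3 h4, hK'.rel_split f5 hts' f6 (f3.2 h3) (f4.2 h4),
      f1, f2, hA.rel_iff G ht ht]
  · -- both points lie in one interval of constancy
    obtain ⟨t, t', u, u', ht', hu, hb, g1, g2⟩ := hA.exists_interval_atPt hK hK' h₁.gen
    rw [FlowOps.Laws.between_iff] at hb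
    obtain ⟨_, hty, hyu, htb, hub⟩ := hb
    have hyu₂ : K.lt G.sec.cell y₂ u := by
      by_cases hus : K.sec G.sec u
      · rcases (hK.sec_dlo G.sec).linear y₂ u h₂.gen.1 hus with h3 | rfl | h3
        · exact h3
        · exact absurd hu (h₂.gen.2 _)
        · exact absurd ⟨u, u', hu, hus, hyu, h3⟩ ht
      · rcases hK.lt_right hyu with h3 | rfl
        · rcases hub with (h4 | h4) | h4
          exacts [absurd h4 hus, absurd h4 (hK.ne_mn h3), absurd h4 (hK.ne_mx h3)]
        · exact hK.lt_mx _ _ c₂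
    have htb' := (hA.bar_iff _ ht').1 htb
    have hub' := (hA.bar_iff _ hu).1 hub
    rw [hK.rel_iff_of_const (β := K.atPt G y₁) h₁.gen.1 h₂.gen.1 l fun z hz h3 h4 =>
      g1 z (FlowOps.Laws.between_iff.2 ⟨hz, hK.lt_trans' c₁ (hK.sec_cell hz) hty h3,
        hK.lt_trans (hK.sec_cell hz) c₂ h4 hyu₂, htb, hub⟩)]
    filter_upwards [h₁.tendsto.eventually (hA.eventually_lt_iff hK hK' h₁.gen ht'),
      h₂.tendsto.eventually (hA.eventually_gt_iff hK hK' h₂.gen hu), hlt, s₁, s₂]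
      with z f1 f2 f3 f4 f5
    exact hK'.rel_iff_of_const f4 f5 (f3.2 l) fun w hw h3 h4 =>
      g2 w (FlowOps.Laws.between_iff.2 ⟨hw,
        hK'.lt_trans' (hK'.sec_cell f4) (hK'.sec_cell hw) (f1.2 hty) h3,
        hK'.lt_trans (hK'.sec_cell hw) (hK'.sec_cell f5) h4 (f2.2 hyu₂), htb', hub'⟩)

omit hA hK hK' ha in
theorem OrbitTracks.const {F : Filter N} {t : M} {t' : N} (h : A t t') :
    OrbitTracks K K' A F a t fun _ => t' := .inl ⟨t', h, Eventually.of_forall fun _ => rfl⟩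

theorem isTracking_orbitTracks :
    IsTracking K K' (secFilter K K' A C a) (OrbitTracks K K' A (secFilter K K' A C a) a) where
  prog g {y ζ} h := OrbitTracks.prog hA hK hK' ha g h
  s := OrbitTracks.const hA.s
  single c := OrbitTracks.const (hA.single c)
  e c := OrbitTracks.const (hA.e c)
  lo g c := OrbitTracks.const (hA.lo g c)
  hi g c := OrbitTracks.const (hA.hi g c)
  gamma c j := OrbitTracks.const (hA.gamma c j)
  eq_iff {y ζ y' ζ'} h h' := by
    rcases h with ⟨t, ht, hζ⟩ | ⟨D, h⟩ <;> rcases h' with ⟨t', ht', hζ'⟩ | ⟨D', h'⟩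
    · filter_upwards [hζ, hζ'] with z h1 h2
      rw [h1, h2, hA.eq_iff ht ht']
    · filter_upwards [hζ, h'.tendsto.eventually (hA.eventually_ne hK hK' h'.gen ht)] with z h1 h2
      refine iff_of_false (h1 ▸ Ne.symm h2) ?_
      rintro rfl
      exact h'.gen.2 _ ht
    · filter_upwards [hζ', h.tendsto.eventually (hA.eventually_ne hK hK' h.gen ht')] with z h1 h2
      refine iff_of_false (h1 ▸ h2) ?_
      rintro rfl
      exact h.gen.2 _ ht'
    · exact OnOrbit.eq_iff hA hK hK' ha h h'
  cell_iff C' {y ζ} h := by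
    rcases h with ⟨t, ht, hζ⟩ | ⟨D, h⟩
    · filter_upwards [hζ] with z h1
      rw [h1, hA.cell_iff _ ht]
    · filter_upwards [h.tendsto.eventually (hA.compat hK hK' D).eventually_mem] with z h1
      have e := hK.sec_cell h.gen.1
      have e' := hK'.sec_cell h1
      exact ⟨fun h2 => hK'.cell_unique _ _ _ h2 e' ▸ e, fun h2 => hK.cell_unique _ _ _ h2 e ▸ e'⟩
  E_iff C' {y ζ} h := by
    have : Follows K K' A (secFilter K K' A C a) y ζ := by
      rcases h with h | ⟨D, h⟩
      exacts [.inl h, .inr ⟨D, h.gen, h.tendsto⟩]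
    exact Follows.eventually_sec hA hK hK' this (.inr C')
  lt_iff C' {y ζ y' ζ'} h h' := by
    rcases h with ⟨t, ht, hζ⟩ | ⟨D, h⟩ <;> rcases h' with ⟨t', ht', hζ'⟩ | ⟨D', h'⟩
    · filter_upwards [hζ, hζ'] with z h1 h2
      rw [h1, h2, hA.lt_iff _ ht ht']
    · have s := h'.tendsto.eventually (hA.compat hK hK' D').eventually_mem
      by_cases e : D'.cell = C'
      · subst e
        filter_upwards [hζ, h'.tendsto.eventually (hA.eventually_lt_iff hK hK' h'.gen ht)]
          with z h1 h2
        rw [h1, h2]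
      · filter_upwards [s] with z h1
        exact iff_of_false (fun h2 => e ((hK'.cell_eq_of_lt h2).2 (hK'.sec_cell h1)))
          fun h2 => e ((hK.cell_eq_of_lt h2).2 (hK.sec_cell h'.gen.1))
    · have s := h.tendsto.eventually (hA.compat hK hK' D).eventually_mem
      by_cases e : D.cell = C'
      · subst e
        filter_upwards [hζ', h.tendsto.eventually (hA.eventually_gt_iff hK hK' h.gen ht')]
          with z h1 h2
        rw [h1, h2]
      · filter_upwards [s] with z h1
        exact iff_of_false (fun h2 => e ((hK'.cell_eq_of_lt h2).1 (hK'.sec_cell h1)))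
          fun h2 => e ((hK.cell_eq_of_lt h2).1 (hK.sec_cell h.gen.1))
    · have s := h.tendsto.eventually (hA.compat hK hK' D).eventually_mem
      have s' := h'.tendsto.eventually (hA.compat hK hK' D').eventually_mem
      by_cases e : D.cell = C' ∧ D'.cell = C'
      · obtain ⟨rfl, e⟩ := e
        obtain rfl := Section₁.cell_injective e
        exact OnOrbit.lt_iff hA hK hK' ha h h'
      · filter_upwards [s, s'] with z h1 h2
        refine iff_of_false (fun h3 => e ?_) fun h3 => e ?_
        · exact ⟨(hK'.cell_eq_of_lt h3).1 (hK'.sec_cell h1),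
            (hK'.cell_eq_of_lt h3).2 (hK'.sec_cell h2)⟩
        · exact ⟨(hK.cell_eq_of_lt h3).1 (hK.sec_cell h.gen.1),
            (hK.cell_eq_of_lt h3).2 (hK.sec_cell h'.gen.1)⟩
  rel_iff G {y ζ y' ζ'} h h' := by
    rcases h with ⟨t, ht, hζ⟩ | ⟨D, h⟩ <;> rcases h' with ⟨t', ht', hζ'⟩ | ⟨D', h'⟩
    · filter_upwards [hζ, hζ'] with z h1 h2
      rw [h1, h2, hA.rel_iff _ ht ht']
    · have s := h'.tendsto.eventually (hA.compat hK hK' D').eventually_mem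
      by_cases e : D' = G.sec
      · subst e
        filter_upwards [hζ, h'.tendsto.eventually (hA.eventually_rel_right hK hK' h'.gen ht)]
          with z h1 h2
        rw [h1, h2]
      · filter_upwards [s] with z h1
        exact iff_of_false (fun h2 => hK'.not_bar h1 e (hK'.rel_bar h2).2)
          fun h2 => hK.not_bar h'.gen.1 e (hK.rel_bar h2).2
    · have s := h.tendsto.eventually (hA.compat hK hK' D).eventually_mem
      by_cases e : D = G.sec
      · subst e
        filter_upwards [hζ', h.tendsto.eventually (hA.eventually_rel_left hK hK' h.gen ht')]
          with z h1 h2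
        rw [h1, h2]
      · filter_upwards [s] with z h1
        exact iff_of_false (fun h2 => hK'.not_bar h1 e (hK'.rel_bar h2).1)
          fun h2 => hK.not_bar h.gen.1 e (hK.rel_bar h2).1
    · exact OnOrbit.rel_iff hA hK hK' ha G h h'

omit hA hK hK' in
theorem orbitTracks_self : OrbitTracks K K' A (secFilter K K' A C a) a a id :=
  .inr ⟨C, ha, tendsto_id, .inl ⟨0, rfl, Eventually.of_forall fun _ => rfl⟩⟩

end PartIso

end DulacFlowConfiguration

/-! ### Points outside the sections -/

namespace DulacFlowConfiguration

open FlowConfiguration Filter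

variable {Ψ : DulacFlowConfiguration} {M N : Type}

/-- Near some filter on `N`, the points of `N` realize the same atomic formulas over the range of
the partial isomorphism as `a` does over its domain. -/
def HasTracking (K : Ops Ψ M) (K' : Ops Ψ N) (A : M → N → Prop) (a : M) : Prop :=
  ∃ (F : Filter N) (T : M → (N → N) → Prop), F.NeBot ∧ IsTracking K K' F T ∧
    (∀ t t', A t t' → T t fun _ => t') ∧ T a id

namespace PartIso

variable {K : Ops Ψ M} {K' : Ops Ψ N} {A : M → N → Prop}
variable (hA : PartIso K K' A) (hK : K.Laws) (hK' : K'.Laws)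
include hA hK hK'

theorem hasTracking_of_sec {C : Ψ.flow.Section₁} {a : M} (ha : Gen K A C a) :
    HasTracking K K' A a :=
  ⟨_, _, (hA.compat hK hK' C).neBot ha.1, hA.isTracking_orbitTracks hK hK' ha,
    fun _ _ h => OrbitTracks.const h, orbitTracks_self ha⟩

/-- A point outside the sections whose images are in the domain of the partial isomorphism
generates only itself over that domain, and its atomic formulas are determined by its cut. -/
theorem hasTracking_of_separated {C : Ψ.flow.Cell} {a : M} (ha : ∀ t', ¬ A a t')
    (hc : K.cell C a) (hsec : ∀ D, ¬ K.sec D a) {F : Filter N} [hF : F.NeBot]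
    (hc' : ∀ᶠ z in F, K'.cell C z) (hsec' : ∀ᶠ z in F, ∀ D, ¬ K'.sec D z)
    (hprog : ∀ g, ∃ t', A (K.prog g a) t' ∧ ∀ᶠ z in F, K'.prog g z = t')
    (hs : Separated K K' A F C a) : HasTracking K K' A a := by
  have hbar : ∀ D, ¬ K.bar D a := by
    rintro D ((h | h) | h)
    exacts [hsec D h, hK.ne_mn hc h, hK.ne_mx hc h]
  have hbar' : ∀ᶠ z in F, ∀ D, ¬ K'.bar D z := by
    filter_upwards [hc', hsec'] with z h1 h2
    rintro D ((h | h) | h)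
    exacts [h2 D h, hK'.ne_mn h1 h, hK'.ne_mx h1 h]
  have const : ∀ {t t'}, A t t' →
      (∃ u', A t u' ∧ ∀ᶠ z in F, (fun _ : N => t') z = u') ∨
        t = a ∧ ∀ᶠ z in F, (fun _ : N => t') z = z :=
    fun {t t'} h => .inl ⟨t', h, Eventually.of_forall fun _ => rfl⟩
  refine ⟨F, fun y ζ => (∃ t', A y t' ∧ ∀ᶠ z in F, ζ z = t') ∨ (y = a ∧ ∀ᶠ z in F, ζ z = z), hF,
    ?_, fun t t' h => const h, .inr ⟨rfl, Eventually.of_forall fun _ => rfl⟩⟩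
  exact
  { prog := by
      rintro g y ζ (⟨t', ht, hζ⟩ | ⟨rfl, hζ⟩)
      · exact .inl ⟨_, hA.prog g ht, hζ.mono fun z hz => congrArg _ hz⟩
      · obtain ⟨t', ht, h⟩ := hprog g
        refine .inl ⟨t', ht, ?_⟩
        filter_upwards [hζ, h] with z h1 h2
        rw [h1, h2]
    s := const hA.s
    single := fun c => const (hA.single c)
    e := fun c => const (hA.e c)
    lo := fun g c => const (hA.lo g c)
    hi := fun g c => const (hA.hi g c)
    gamma := fun c j => const (hA.gamma c j)
    eq_iff := by
      rintro y ζ y' ζ' (⟨t, ht, hζ⟩ | ⟨rfl, hζ⟩) (⟨t', ht', hζ'⟩ | ⟨rfl, hζ'⟩)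
      · filter_upwards [hζ, hζ'] with z h1 h2
        rw [h1, h2, hA.eq_iff ht ht']
      · filter_upwards [hζ, hζ', Separated.ne hA hK' hs hc' ht] with z h1 h2 h3
        rw [h1, h2]
        exact iff_of_false (Ne.symm h3) fun h => ha _ (h ▸ ht)
      · filter_upwards [hζ, hζ', Separated.ne hA hK' hs hc' ht'] with z h1 h2 h3
        rw [h1, h2]
        exact iff_of_false h3 fun h => ha _ (h ▸ ht')
      · filter_upwards [hζ, hζ'] with z h1 h2
        simp [h1, h2]
    cell_iff := by
      rintro D y ζ (⟨t, ht, hζ⟩ | ⟨rfl, hζ⟩)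
      · filter_upwards [hζ] with z h1
        rw [h1, hA.cell_iff D ht]
      · filter_upwards [hζ, hc'] with z h1 h2
        rw [h1]
        exact ⟨fun h => hK'.cell_unique _ _ _ h h2 ▸ hc, fun h => hK.cell_unique _ _ _ h hc ▸ h2⟩
    E_iff := by
      rintro D y ζ (⟨t, ht, hζ⟩ | ⟨rfl, hζ⟩)
      · filter_upwards [hζ] with z h1
        rw [h1, hA.E_iff D ht]
      · filter_upwards [hζ, hsec'] with z h1 h2
        exact iff_of_false (h1.symm ▸ h2 (.inr D)) (hsec (.inr D))
    lt_iff := by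
      rintro D y ζ y' ζ' (⟨t, ht, hζ⟩ | ⟨rfl, hζ⟩) (⟨t', ht', hζ'⟩ | ⟨rfl, hζ'⟩)
      · filter_upwards [hζ, hζ'] with z h1 h2
        rw [h1, h2, hA.lt_iff D ht ht']
      · by_cases hD : C = D
        · subst hD
          filter_upwards [hζ, hζ', Separated.lt_iff hA hK hK' hs hc hc' ht] with z h1 h2 h3
          rw [h1, h2, h3]
        · filter_upwards [hζ', hc'] with z h1 h2
          exact iff_of_false (fun h => hD ((hK'.cell_eq_of_lt h).2 (h1.symm ▸ h2)))
            fun h => hD ((hK.cell_eq_of_lt h).2 hc)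
      · by_cases hD : C = D
        · subst hD
          filter_upwards [hζ, hζ', Separated.gt_iff hA hK hK' hs hc hc' ht'] with z h1 h2 h3
          rw [h1, h2, h3]
        · filter_upwards [hζ, hc'] with z h1 h2
          exact iff_of_false (fun h => hD ((hK'.cell_eq_of_lt h).1 (h1.symm ▸ h2)))
            fun h => hD ((hK.cell_eq_of_lt h).1 hc)
      · filter_upwards [hζ, hζ'] with z h1 h2
        rw [h1, h2]
        exact iff_of_false (hK'.irrefl _ _) (hK.irrefl _ _)
    rel_iff := by
      rintro G y ζ y' ζ' (⟨t, ht, hζ⟩ | ⟨rfl, hζ⟩) (⟨t', ht', hζ'⟩ | ⟨rfl, hζ'⟩)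
      · filter_upwards [hζ, hζ'] with z h1 h2
        rw [h1, h2, hA.rel_iff G ht ht']
      · filter_upwards [hζ', hbar'] with z h1 h2
        exact iff_of_false (fun h => h2 _ (h1 ▸ (hK'.rel_bar h).2)) fun h => hbar _ (hK.rel_bar h).2
      · filter_upwards [hζ, hbar'] with z h1 h2
        exact iff_of_false (fun h => h2 _ (h1 ▸ (hK'.rel_bar h).1)) fun h => hbar _ (hK.rel_bar h).1
      · filter_upwards [hζ, hbar'] with z h1 h2
        exact iff_of_false (fun h => h2 _ (h1 ▸ (hK'.rel_bar h).1))
          fun h => hbar _ (hK.rel_bar h).1 }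

theorem hasTracking_of_tan {C : Ψ.flow.Tan} {a : M} (ha : ∀ t', ¬ A a t')
    (hc : K.cell (tan C) a) : HasTracking K K' A a := by
  have hcomp : CutCompat (K.cell (tan C)) (K.lt (tan C)) (K'.cell (tan C)) (K'.lt (tan C)) A :=
    ⟨hK.dlo _, hK'.dlo _, fun h => hA.cell_iff _ h, fun h h' _ _ => hA.lt_iff _ h h'⟩
  have hne := hcomp.neBot (a := a) hc
  have hec := hK.e_cell C
  refine hA.hasTracking_of_separated hK hK' ha hc (hK.not_sec_of_tan hc)
    (hcomp.eventually_mem (a := a))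
    (hcomp.eventually_mem.mono fun z hz => hK'.not_sec_of_tan hz) ?_ ?_
  · rcases (hK.dlo (tan C)).linear a _ hc hec with h | rfl | h
    · have hev := hcomp.eventually_lt (hA.e C) hec h
      rintro (_ | _)
      · refine ⟨K'.e C, by rw [hK.tan_f_lt C a hc h]; exact hA.e C, ?_⟩
        filter_upwards [hev, hcomp.eventually_mem] with z h1 h2 using hK'.tan_f_lt C z h2 h1
      · refine ⟨K'.prog .b (K'.e C), by rw [hK.tan_b_le C a hc h]; exact hA.prog _ (hA.e C), ?_⟩
        filter_upwards [hev, hcomp.eventually_mem] with z h1 h2 using hK'.tan_b_le C z h2 h1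
    · exact absurd (hA.e C) (ha _)
    · have hev := hcomp.eventually_gt (hA.e C) hec h
      rintro (_ | _)
      · refine ⟨K'.prog .f (K'.e C), by rw [hK.tan_f_ge C a hc h]; exact hA.prog _ (hA.e C), ?_⟩
        filter_upwards [hev, hcomp.eventually_mem] with z h1 h2 using hK'.tan_f_ge C z h2 h1
      · refine ⟨K'.e C, by rw [hK.tan_b_gt C a hc h]; exact hA.e C, ?_⟩
        filter_upwards [hev, hcomp.eventually_mem] with z h1 h2 using hK'.tan_b_gt C z h2 h1
  · intro t t' ht htc
    rcases (hK.dlo (tan C)).linear t a htc hc with h | rfl | h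
    · exact .inl ⟨h, hcomp.eventually_gt ht htc h⟩
    · exact absurd ht (ha _)
    · exact .inr ⟨h, hcomp.eventually_lt ht htc h⟩

/-- A point of `C ∖ E_C` whose leaf belongs to a point in the domain of the partial isomorphism. -/
theorem hasTracking_of_phi {O : Ψ.flow.Opn} {g : Dir} {a y : M} {y' : N} (ha : ∀ t', ¬ A a t')
    (hphi : K.phi O g a y) (hy : A y y') : HasTracking K K' A a := by
  obtain ⟨hc, hE, hyE⟩ := phi_cell hphi
  have hyE' := (hA.E_iff O hy).1 hyE
  have hyc := hK.E_cell O y hyE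
  have hyc' := hK'.E_cell O y' hyE'
  have hleaf : K.leaf O a y := FlowOps.Laws.leaf_of_phi hphi
  have hcomp : CutCompat (K.leaf O · y) (K.lt (opn O)) (K'.leaf O · y') (K'.lt (opn O)) A := by
    refine ⟨?_, ?_, fun h => hA.leaf_iff hK hK' O h hy, fun h h' _ _ => hA.lt_iff _ h h'⟩
    · simpa [FlowOps.leaf, hyE] using hK.phi_dlo O y hyE
    · simpa [FlowOps.leaf, hyE'] using hK'.phi_dlo O y' hyE'
  have hne := hcomp.neBot (a := a) hleaf
  have hyy : K.leaf O y y := ⟨hyE, .inr rfl⟩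
  have hev := hcomp.eventually_mem (a := a)
  have hphi' : ∀ᶠ z in cutFilter (K.leaf O · y) (K.lt (opn O)) (K'.leaf O · y')
      (K'.lt (opn O)) A a, K'.phi O g z y' := by
    cases g
    · filter_upwards [hcomp.eventually_lt hy hyy hphi.2.2.2.1, hev] with z h1 h2
      rcases h2.2 with (h2 | h2) | rfl
      · exact absurd h2.2.2.2.1 (hK'.lt_asymm h2.1 hyc' h1)
      · exact h2
      · exact absurd h1 (hK'.irrefl _ _)
    · filter_upwards [hcomp.eventually_gt hy hyy hphi.2.2.2.1, hev] with z h1 h2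
      rcases h2.2 with (h2 | h2) | rfl
      · exact h2
      · exact absurd h1 (hK'.lt_asymm h2.1 hyc' h2.2.2.2.1)
      · exact absurd h1 (hK'.irrefl _ _)
  refine hA.hasTracking_of_separated hK hK' ha hc (hK.not_sec_of_opn hc hE)
    (hphi'.mono fun z hz => (phi_cell hz).1)
    (hphi'.mono fun z hz => hK'.not_sec_of_opn (phi_cell hz).1 (phi_cell hz).2.1) ?_ ?_
  · have key : ∀ g', (∃ t', A (K.prog g' a) t' ∧ ∀ᶠ z in cutFilter (K.leaf O · y) (K.lt (opn O))
        (K'.leaf O · y') (K'.lt (opn O)) A a, K'.prog g' z = t') ∨ g' ≠ g ∧ g' ≠ g.opp := by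
      intro g'
      by_cases h1 : g' = g
      · subst h1
        exact .inl ⟨y', by rwa [hK.phi_prog _ _ _ _ hphi],
          hphi'.mono fun z hz => hK'.phi_prog _ _ _ _ hz⟩
      by_cases h2 : g' = g.opp
      · subst h2
        refine .inl ⟨_, by rw [hK.phi_opp_prog O g.opp a y (by rwa [Dir.opp_opp])];
                           exact hA.prog _ hy, hphi'.mono fun z hz =>
          hK'.phi_opp_prog O g.opp z y' (by rwa [Dir.opp_opp])⟩
      · exact .inr ⟨h1, h2⟩
    intro g'
    refine (key g').resolve_right ?_
    cases g <;> cases g' <;> simp [Dir.opp]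
  · intro t t' ht htc
    by_cases htl : K.leaf O t y
    · rcases (hK.dlo (opn O)).linear t a htc hc with h | rfl | h
      · exact .inl ⟨h, hcomp.eventually_gt ht htl h⟩
      · exact absurd ht (ha _)
      · exact .inr ⟨h, hcomp.eventually_lt ht htl h⟩
    · obtain ⟨u, u', hu, hl, hl'⟩ := hA.exists_leaf hK hK' ht htc
      rcases (hK.E_dlo O).linear u y hl.1 hyE with h | rfl | h
      · refine .inl ⟨hK.lt_of_leaf hl hleaf h, ?_⟩
        filter_upwards [hev] with z hz
        exact hK'.lt_of_leaf hl' hz ((hA.lt_iff _ hu hy).1 h)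
      · exact absurd hl htl
      · refine .inr ⟨hK.lt_of_leaf hleaf hl h, ?_⟩
        filter_upwards [hev] with z hz
        exact hK'.lt_of_leaf hz hl' ((hA.lt_iff _ hy hu).1 h)

end PartIso

end DulacFlowConfiguration

/-! ### Terms and quantifier-free formulas -/

namespace FirstOrder.Language

variable {L : FirstOrder.Language.{0, 0}}

/-- Tuples with the same atomic formulas yield such tuples when terms are applied to them. -/
theorem SameAtoms.subst {β β' M N : Type*} [L.Structure M] [L.Structure N] {v : β → M} {w : β → N}
    (h : SameAtoms (L := L) v w) (τ : β' → L.Term β) :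
    SameAtoms (L := L) (fun i => (τ i).realize v) (fun i => (τ i).realize w) :=
  ⟨fun t t' => by simpa using h.eq (t.subst τ) (t'.subst τ),
   fun R ts => by simpa using h.rel R (fun i => (ts i).subst τ)⟩

end FirstOrder.Language

namespace DulacFlowConfiguration

open FlowConfiguration Filter

section Symbols

variable {Ψ : DulacFlowConfiguration} {M : Type} [Ψ.language.Structure M]

theorem funMap_s (x : Fin 0 → M) :
    Structure.funMap (L := Ψ.language)
      (Sum.inl FlowConfiguration.Func.s : Ψ.language.Functions 0) x =
      (ops Ψ M).s :=
  congrArg _ (Subsingleton.elim _ _)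

theorem funMap_single (c : Ψ.flow.Single) (x : Fin 0 → M) :
    Structure.funMap (L := Ψ.language)
      (Sum.inl (FlowConfiguration.Func.single c) : Ψ.language.Functions 0) x =
      (ops Ψ M).single c :=
  congrArg _ (Subsingleton.elim _ _)

theorem funMap_e (C : Ψ.flow.Tan) (x : Fin 0 → M) :
    Structure.funMap (L := Ψ.language)
      (Sum.inl (FlowConfiguration.Func.e C) : Ψ.language.Functions 0) x =
      (ops Ψ M).e C :=
  congrArg _ (Subsingleton.elim _ _)

theorem funMap_lowerEnd (g : Dir) (C : Ψ.flow.Trans) (x : Fin 0 → M) :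
    Structure.funMap (L := Ψ.language)
      (Sum.inl (FlowConfiguration.Func.lowerEnd g C) : Ψ.language.Functions 0) x =
      (ops Ψ M).lo g C :=
  congrArg _ (Subsingleton.elim _ _)

theorem funMap_upperEnd (g : Dir) (C : Ψ.flow.Trans) (x : Fin 0 → M) :
    Structure.funMap (L := Ψ.language)
      (Sum.inl (FlowConfiguration.Func.upperEnd g C) : Ψ.language.Functions 0) x =
      (ops Ψ M).hi g C :=
  congrArg _ (Subsingleton.elim _ _)

theorem funMap_gamma (C : Ψ.flow.Section₁) (j : Fin Ψ.nu) (x : Fin 0 → M) :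
    Structure.funMap (L := Ψ.language)
      (Sum.inr (DulacFlowConfiguration.Func.gamma C j) : Ψ.language.Functions 0) x =
      (ops Ψ M).gamma C j :=
  congrArg _ (Subsingleton.elim _ _)

theorem funMap_prog (g : Dir) (x : Fin 1 → M) :
    Structure.funMap (L := Ψ.language)
      (Sum.inl (FlowConfiguration.Func.prog g) : Ψ.language.Functions 1) x =
      (ops Ψ M).prog g (x 0) :=
  congrArg _ (List.ofFn_injective rfl)

theorem relMap_cell (C : Ψ.flow.Cell) (x : Fin 1 → M) :
    Structure.RelMap (L := Ψ.language)
      (Sum.inl (FlowConfiguration.Rel.cell C) : Ψ.language.Relations 1) x ↔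
      (ops Ψ M).cell C (x 0) :=
  iff_of_eq (congrArg _ (List.ofFn_injective rfl))

theorem relMap_E (C : Ψ.flow.Opn) (x : Fin 1 → M) :
    Structure.RelMap (L := Ψ.language)
      (Sum.inl (FlowConfiguration.Rel.E C) : Ψ.language.Relations 1) x ↔
      (ops Ψ M).E C (x 0) :=
  iff_of_eq (congrArg _ (List.ofFn_injective rfl))

theorem relMap_lt (C : Ψ.flow.Cell) (x : Fin 2 → M) :
    Structure.RelMap (L := Ψ.language)
      (Sum.inl (FlowConfiguration.Rel.lt C) : Ψ.language.Relations 2) x ↔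
      (ops Ψ M).lt C (x 0) (x 1) :=
  iff_of_eq (congrArg _ (List.ofFn_injective rfl))

theorem relMap_rel (G : DulacFlowConfiguration.Rel Ψ 2) (x : Fin 2 → M) :
    Structure.RelMap (L := Ψ.language) (Sum.inr G : Ψ.language.Relations 2) x ↔
      (ops Ψ M).rel G (x 0) (x 1) :=
  iff_of_eq (congrArg _ (List.ofFn_injective rfl))

end Symbols

variable {Ψ : DulacFlowConfiguration} {M N : Type} [Ψ.language.Structure M]
  [Ψ.language.Structure N]

/-- Tuples with the same atomic formulas generate isomorphic substructures. -/
theorem partIso_of_sameAtoms {β : Type} {v : β → M} {w : β → N}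
    (h : SameAtoms (L := Ψ.language) v w) :
    PartIso (ops Ψ M) (ops Ψ N)
      (fun x x' => ∃ t : Ψ.language.Term β, x = t.realize v ∧ x' = t.realize w) where
  prog g := by
    rintro _ _ ⟨t, rfl, rfl⟩
    exact ⟨.func (Sum.inl (FlowConfiguration.Func.prog g)) fun _ => t,
      (funMap_prog g fun _ => t.realize v).symm, (funMap_prog g fun _ => t.realize w).symm⟩
  s := ⟨.func (Sum.inl FlowConfiguration.Func.s) Fin.elim0,
    (funMap_s _).symm,
    (funMap_s _).symm⟩
  single c := ⟨.func (Sum.inl (FlowConfiguration.Func.single c)) Fin.elim0,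
    (funMap_single c _).symm,
    (funMap_single c _).symm⟩
  e C := ⟨.func (Sum.inl (FlowConfiguration.Func.e C)) Fin.elim0,
    (funMap_e C _).symm,
    (funMap_e C _).symm⟩
  lo g C := ⟨.func (Sum.inl (FlowConfiguration.Func.lowerEnd g C)) Fin.elim0,
    (funMap_lowerEnd g C _).symm,
    (funMap_lowerEnd g C _).symm⟩
  hi g C := ⟨.func (Sum.inl (FlowConfiguration.Func.upperEnd g C)) Fin.elim0,
    (funMap_upperEnd g C _).symm,
    (funMap_upperEnd g C _).symm⟩
  gamma C j := ⟨.func (Sum.inr (DulacFlowConfiguration.Func.gamma C j)) Fin.elim0,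
    (funMap_gamma C j _).symm,
    (funMap_gamma C j _).symm⟩
  eq_iff := by
    rintro _ _ _ _ ⟨t, rfl, rfl⟩ ⟨u, rfl, rfl⟩
    exact h.eq t u
  cell_iff C := by
    rintro _ _ ⟨t, rfl, rfl⟩
    exact (relMap_cell C _).symm.trans
      ((h.rel (k := 1) (Sum.inl (FlowConfiguration.Rel.cell C)) fun _ => t).trans
        (relMap_cell C _))
  E_iff C := by
    rintro _ _ ⟨t, rfl, rfl⟩
    exact (relMap_E C _).symm.trans
      ((h.rel (k := 1) (Sum.inl (FlowConfiguration.Rel.E C)) fun _ => t).trans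
        (relMap_E C _))
  lt_iff C := by
    rintro _ _ _ _ ⟨t, rfl, rfl⟩ ⟨u, rfl, rfl⟩
    exact (relMap_lt C _).symm.trans
      ((h.rel (k := 2) (Sum.inl (FlowConfiguration.Rel.lt C)) ![t, u]).trans
        (relMap_lt C _))
  rel_iff G := by
    rintro _ _ _ _ ⟨t, rfl, rfl⟩ ⟨u, rfl, rfl⟩
    exact (relMap_rel G _).symm.trans
      ((h.rel (k := 2) (Sum.inr G) ![t, u]).trans
        (relMap_rel G _))

namespace IsTracking

variable {F : Filter N} {T : M → (N → N) → Prop} (hT : IsTracking (ops Ψ M) (ops Ψ N) F T)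
  {γ : Type} {V : γ → M} {W : N → γ → N} (hV : ∀ i, T (V i) fun z => W z i)
include hT hV

theorem term (t : Ψ.language.Term γ) : T (t.realize V) fun z => t.realize (W z) := by
  induction t with
  | var i => exact hV i
  | func f ts ih =>
    have key : ∀ {x x' : M} {ζ ζ' : N → N}, T x ζ → x' = x → (∀ z, ζ' z = ζ z) → T x' ζ' := by
      rintro x _ ζ ζ' h rfl hζ
      rwa [funext hζ]
    rcases f with f | f
    · cases f with
      | s => exact key hT.s (funMap_s _) fun z => funMap_s _
      | single c => exact key (hT.single c) (funMap_single c _) fun z => funMap_single c _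
      | e C => exact key (hT.e C) (funMap_e C _) fun z => funMap_e C _
      | lowerEnd g C => exact key (hT.lo g C) (funMap_lowerEnd g C _) fun z => funMap_lowerEnd g C _
      | upperEnd g C => exact key (hT.hi g C) (funMap_upperEnd g C _) fun z => funMap_upperEnd g C _
      | prog g => exact key (hT.prog g (ih 0)) (funMap_prog g _) fun z => funMap_prog g _
    · cases f with
      | gamma C j => exact key (hT.gamma C j) (funMap_gamma C j _) fun z => funMap_gamma C j _

theorem rel_iff_of_terms {k : ℕ} (R : Ψ.language.Relations k) (ts : Fin k → Ψ.language.Term γ) :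
    ∀ᶠ z in F, Structure.RelMap R (fun i => (ts i).realize (W z)) ↔
      Structure.RelMap R (fun i => (ts i).realize V) := by
  have ht := fun i => hT.term hV (ts i)
  rcases R with R | R
  · cases R with
    | cell C =>
      exact (hT.cell_iff C (ht 0)).mono fun z hz =>
        (relMap_cell C _).trans (hz.trans (relMap_cell C fun i => (ts i).realize V).symm)
    | E C =>
      exact (hT.E_iff C (ht 0)).mono fun z hz =>
        (relMap_E C _).trans (hz.trans (relMap_E C fun i => (ts i).realize V).symm)
    | lt C =>
      exact (hT.lt_iff C (ht 0) (ht 1)).mono fun z hz =>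
        (relMap_lt C _).trans (hz.trans (relMap_lt C fun i => (ts i).realize V).symm)
  · obtain rfl : k = 2 := by cases R <;> rfl
    exact (hT.rel_iff R (ht 0) (ht 1)).mono fun z hz =>
      (relMap_rel R _).trans (hz.trans (relMap_rel R fun i => (ts i).realize V).symm)

end IsTracking

theorem IsTracking.eventually_realize_iff {F : Filter N} {T : M → (N → N) → Prop}
    (hT : IsTracking (ops Ψ M) (ops Ψ N) F T) {γ : Type} {k : ℕ} {V : γ → M} {W : N → γ → N}
    {xs : Fin k → M} {ys : N → Fin k → N} (hV : ∀ i, T (V i) fun z => W z i)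
    (hxs : ∀ i, T (xs i) fun z => ys z i) {θ : Ψ.language.BoundedFormula γ k} (hθ : θ.IsQF) :
    ∀ᶠ z in F, θ.Realize (W z) (ys z) ↔ θ.Realize V xs := by
  have h : ∀ i, T (Sum.elim V xs i) fun z => Sum.elim (W z) (ys z) i := by
    rintro (i | i)
    exacts [hV i, hxs i]
  induction hθ with
  | falsum => exact Eventually.of_forall fun _ => Iff.rfl
  | of_isAtomic h' =>
    cases h' with
    | equal t t' => simpa using hT.eq_iff (hT.term h t) (hT.term h t')
    | rel R ts => simpa [BoundedFormula.realize_rel] using hT.rel_iff_of_terms h R ts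
  | imp _ _ h1 h2 =>
    filter_upwards [h1, h2] with z h3 h4
    simp [h3, h4]

/-- A quantifier-free condition on a point that has a tracking is met in the other model. -/
theorem HasTracking.exists_realize {β : Type} {v : β → M} {w : β → N} {a : M}
    (h : HasTracking (ops Ψ M) (ops Ψ N)
      (fun x x' => ∃ t : Ψ.language.Term β, x = t.realize v ∧ x' = t.realize w) a)
    {θ : Ψ.language.Formula (β ⊕ Unit)} (hθ : θ.IsQF) (ha : θ.Realize (Sum.elim v fun _ => a)) :
    ∃ b : N, θ.Realize (Sum.elim w fun _ => b) := by
  obtain ⟨F, T, hF, hT, hconst, hself⟩ := h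
  have := hT.eventually_realize_iff (V := Sum.elim v fun _ => a)
    (W := fun z => Sum.elim w fun _ => z) (xs := default) (ys := fun _ => default) (by
      rintro (i | _)
      · exact hconst _ _ ⟨.var i, rfl, rfl⟩
      · exact hself) (fun i => i.elim0) hθ
  obtain ⟨z, hz⟩ := this.exists
  exact ⟨z, hz.2 ha⟩

theorem exists_realize_of_term {β : Type} {v : β → M} {w : β → N}
    (h : SameAtoms (L := Ψ.language) v w) {θ : Ψ.language.Formula (β ⊕ Unit)} (hθ : θ.IsQF)
    (t : Ψ.language.Term β) (ha : θ.Realize (Sum.elim v fun _ => t.realize v)) :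
    θ.Realize (Sum.elim w fun _ => t.realize w) := by
  have h' := h.subst (Sum.elim Term.var fun _ => t : β ⊕ Unit → Ψ.language.Term β)
  refine (Formula.IsQF.realize_iff_of_sameAtoms hθ ?_).1 ha
  convert h' using 1 <;> · ext (i | i) <;> rfl

end DulacFlowConfiguration

/-! ### Quantifier elimination -/

namespace DulacFlowConfiguration

open FlowConfiguration

variable {Ψ : DulacFlowConfiguration}

theorem exists_realize_of_hasTracking {M N : Type} [Ψ.language.Structure M]
    [Ψ.language.Structure N] {β : Type} {v : β → M} {w : β → N}
    (h : SameAtoms (L := Ψ.language) v w) {θ : Ψ.language.Formula (β ⊕ Unit)} (hθ : θ.IsQF)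
    {a : M} (ha : θ.Realize (Sum.elim v fun _ => a))
    (H : (∀ x' : N, ¬ ∃ t : Ψ.language.Term β, a = t.realize v ∧ x' = t.realize w) →
      HasTracking (ops Ψ M) (ops Ψ N)
        (fun x x' => ∃ t : Ψ.language.Term β, x = t.realize v ∧ x' = t.realize w) a) :
    ∃ b : N, θ.Realize (Sum.elim w fun _ => b) := by
  by_cases hm : ∃ t : Ψ.language.Term β, a = t.realize v
  · obtain ⟨t, rfl⟩ := hm
    exact ⟨_, exists_realize_of_term h hθ t ha⟩
  · exact (H fun x' ⟨t, ht, _⟩ => hm ⟨t, ht⟩).exists_realize hθ ha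

/-- The quantifier-free formula stating that `φ_O^g` holds between the last variable and the
variable before it. -/
def phiQF (Ψ : DulacFlowConfiguration) (β : Type) (O : Ψ.flow.Opn) (g : Dir) :
    Ψ.language.Formula ((β ⊕ Unit) ⊕ Unit) :=
  Relations.formula₁ (Sum.inl (FlowConfiguration.Rel.cell (opn O)) : Ψ.language.Relations 1)
      (.var (.inr ())) ⊓
    ∼(Relations.formula₁ (Sum.inl (FlowConfiguration.Rel.E O) : Ψ.language.Relations 1)
      (.var (.inr ()))) ⊓
    Relations.formula₁ (Sum.inl (FlowConfiguration.Rel.E O) : Ψ.language.Relations 1)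
      (.var (.inl (.inr ()))) ⊓
    Term.equal (Functions.apply₁
      (Sum.inl (FlowConfiguration.Func.prog g) : Ψ.language.Functions 1) (.var (.inr ())))
      (.var (.inl (.inr ())))

theorem isQF_phiQF {β : Type} (O : Ψ.flow.Opn) (g : Dir) : (phiQF Ψ β O g).IsQF :=
  (((BoundedFormula.IsAtomic.rel _ _).isQF.inf (BoundedFormula.IsAtomic.rel _ _).isQF.not).inf
    (BoundedFormula.IsAtomic.rel _ _).isQF).inf (BoundedFormula.IsAtomic.equal _ _).isQF

theorem realize_phiQF {M : Type} [Ψ.language.Structure M] (hK : (ops Ψ M).Laws) {β : Type}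
    {O : Ψ.flow.Opn} {g : Dir} {v : β → M} {x y : M} :
    (phiQF Ψ β O g).Realize (Sum.elim (Sum.elim v fun _ => y) fun _ => x) ↔
      (ops Ψ M).phi O g x y := by
  have e : (phiQF Ψ β O g).Realize (Sum.elim (Sum.elim v fun _ => y) fun _ => x) ↔
      (((ops Ψ M).cell (opn O) x ∧ ¬ (ops Ψ M).E O x) ∧ (ops Ψ M).E O y) ∧
        (ops Ψ M).prog g x = y := by
    unfold phiQF Formula.Realize
    simp only [BoundedFormula.realize_inf, BoundedFormula.realize_not]
    refine and_congr (and_congr (and_congr ?_ (not_congr ?_)) ?_) ?_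
    · exact Formula.realize_rel₁
    · exact Formula.realize_rel₁
    · exact Formula.realize_rel₁
    · exact Formula.realize_equal.trans
        (iff_of_eq (congrArg (· = y) Term.realize_functions_apply₁))
  rw [e]
  constructor
  · rintro ⟨⟨⟨h1, h2⟩, h3⟩, h4⟩
    exact (hK.phi_iff h1 h2).2 ⟨h3, h4⟩
  · intro h
    obtain ⟨h1, h2, h3⟩ := phi_cell h
    exact ⟨⟨⟨h1, h2⟩, h3⟩, hK.phi_prog _ _ _ _ h⟩

/-- Modulo `T(Ψ)`, a quantifier over the points `x` with `φ_O^g(x, y)` can be eliminated. -/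
theorem exists_isQF_iff_exists_phi {β : Type} {θ : Ψ.language.Formula (β ⊕ Unit)} (hθ : θ.IsQF)
    (O : Ψ.flow.Opn) (g : Dir) : ∃ ψ : Ψ.language.Formula (β ⊕ Unit), ψ.IsQF ∧
      ∀ (M : Type) [Ψ.language.Structure M] [Nonempty M] [M ⊨ Ψ.theory] (v : β → M) (y : M),
        ψ.Realize (Sum.elim v fun _ => y) ↔
          ∃ x, (ops Ψ M).phi O g x y ∧ θ.Realize (Sum.elim v fun _ => x) := by
  let κ : Ψ.language.Formula ((β ⊕ Unit) ⊕ Unit) :=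
    phiQF Ψ β O g ⊓ θ.relabel (Sum.map Sum.inl id)
  have hκ : κ.IsQF := (isQF_phiQF O g).inf (hθ.relabel _)
  have hreal : ∀ (M : Type) [Ψ.language.Structure M] [M ⊨ Ψ.theory] (v : β → M) (y x : M),
      κ.Realize (Sum.elim (Sum.elim v fun _ => y) fun _ => x) ↔
        (ops Ψ M).phi O g x y ∧ θ.Realize (Sum.elim v fun _ => x) := by
    intro M _ hM v y x
    refine BoundedFormula.realize_inf.trans (and_congr (realize_phiQF (laws_of_model hM)) ?_)
    refine Formula.realize_relabel.trans (iff_of_eq (congrArg _ ?_))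
    ext (i | i) <;> rfl
  obtain ⟨ψ, hψ, h⟩ := Ψ.theory.exists_isQF_iff_of_sameAtoms (κ.iExs Unit) <| by
    intro M N _ _ _ _ hM hN v w hvw hv
    rw [Formula.realize_iExs] at hv ⊢
    obtain ⟨i, hi⟩ := hv
    have hK := laws_of_model hM
    have hK' := laws_of_model hN
    have ev : v = Sum.elim (v ∘ Sum.inl) fun _ => v (.inr ()) := by ext (i | i) <;> rfl
    have hi' := hi
    rw [ev] at hi'
    obtain ⟨b, hb⟩ := exists_realize_of_hasTracking hvw hκ (a := i ()) hi fun hm =>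
      (partIso_of_sameAtoms hvw).hasTracking_of_phi hK hK' hm ((hreal M _ _ _).1 hi').1
        ⟨.var (.inr ()), rfl, rfl⟩
    exact ⟨fun _ => b, hb⟩
  refine ⟨ψ, hψ, fun M _ _ _ v y => ?_⟩
  rw [← h.realize_iff, Formula.realize_iExs]
  exact ⟨fun ⟨i, hi⟩ => ⟨i (), (hreal M v y (i ())).1 hi⟩,
    fun ⟨x, hx⟩ => ⟨fun _ => x, (hreal M v y x).2 hx⟩⟩

end DulacFlowConfiguration

open DulacFlowConfiguration FlowConfiguration

theorem mainTheorem4 (Ψ : DulacFlowConfiguration) : Ψ.theory.HasQuantifierElimination := by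
  refine Theory.hasQuantifierElimination_of_sameAtoms ?_
  rintro β θ hθ M N _ _ _ _ hM hN v w hvw ⟨a, ha⟩
  have hK := laws_of_model hM
  have hK' := laws_of_model hN
  have hA := partIso_of_sameAtoms hvw
  rcases hK.cover a with rfl | ⟨c, rfl⟩ | ⟨O | C | D, hc⟩
  · exact exists_realize_of_hasTracking hvw hθ ha fun hm => absurd hA.s (hm _)
  · exact exists_realize_of_hasTracking hvw hθ ha fun hm => absurd (hA.single c) (hm _)
  · by_cases hE : (ops Ψ M).E O a
    · exact exists_realize_of_hasTracking hvw hθ ha fun hm =>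
        hA.hasTracking_of_sec hK hK' (C := .inr O) ⟨hE, hm⟩
    -- first the point of `E_O` next to `a` is moved to `N`, and then `a` itself
    obtain ⟨g, hg⟩ := hK.exists_phi_prog hc hE
    obtain ⟨ψ, hψ, h⟩ := exists_isQF_iff_exists_phi hθ O g
    obtain ⟨y', hy'⟩ := exists_realize_of_hasTracking hvw hψ ((h M v _).2 ⟨a, hg, ha⟩) fun hm =>
      hA.hasTracking_of_sec hK hK' (C := .inr O) ⟨(phi_cell hg).2.2, hm⟩
    obtain ⟨b, _, hb⟩ := (h N w y').1 hy'
    exact ⟨b, hb⟩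
  · exact exists_realize_of_hasTracking hvw hθ ha fun hm => hA.hasTracking_of_tan hK hK' hm hc
  · exact exists_realize_of_hasTracking hvw hθ ha fun hm =>
      hA.hasTracking_of_sec hK hK' (C := .inl D) ⟨hc, hm⟩
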